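/- Let $d\ge 2$ and $k\ge 0$ be integers (polygons if $d=2$, polyhedra if $d=3$). Let $\mathcal T_h$ be a partition of a bounded open polytopal set $\Omega\subset\mathbb R^d$ into finitely many closed polytopes $T$ with disjoint interiors, and let $\mathcal E_h$ be its finite set of flat faces (edges if $d=2$): the faces do not overlap, the boundary $\partial T$ of each cell is a union of faces, and each face lies on $\partial\Omega$ or is shared by exactly two cells. Each $T$ is divided into finitely many non-degenerate simplices $T_i$ with disjoint interiors such that two of them meet in a common face or not at all, any two are joined by a chain of simplices $T_i$ in which consecutive ones share a facet, and each face $e\subset\partial T$ is a union of facets of the $T_i$. Let $h_T$ be the diameter of $T$. The partition is called $\rho$-shape-regular ($\rho>0$) if, for every $T$, each $T_i$ contains a ball of radius $\rho h_T$. Let $\mathbf n$ be the unit outward normal on $\partial T$, and let $P_m(S)$ be the restrictions to $S$ of polynomials of degree at most $m$. Put $$V_h=\{v=\{v_0,v_b\}:\ v_0|_T\in P_k(T)\ \forall T\in\mathcal T_h,\ v_b|_e\in P_{k+1}(e)\ \forall e\in\mathcal E_h\},\qquad V_h^0=\{v\in V_h:\ v_b=0\text{ on every face } e\subset\partial\Omega\},$$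 $$\Lambda_k(T)=\{\mathbf q\in H(\mathrm{div},T):\ \mathbf q|_{T_i}\in[P_{k+1}(T_i)]^d\ \forall i,\ \nabla\cdot\mathbf q\in P_k(T),\ \mathbf q\cdot\mathbf n|_e\in P_{k+1}(e)\ \forall e\subset\partial T\}.$$ 1. For every $v\in V_h$ and every $T$ there is exactly one $\nabla_w v|_T\in\Lambda_k(T)$ with $$(\nabla_w v,\mathbf q)_T=-(v_0,\nabla\cdot\mathbf q)_T+\langle v_b,\mathbf q\cdot\mathbf n\rangle_{\partial T}\qquad\forall\,\mathbf q\in\Lambda_k(T).$$ 2. For every $\rho>0$ there are constants $C_1,C_2>0$, depending only on $d$, $k$ and $\rho$ (in particular not on the mesh size), such that on every $\rho$-shape-regular partition $$C_1\|v\|_{1,h}\le |||v|||\le C_2\|v\|_{1,h}\qquad\forall\,v\in V_h,$$ where $$|||v|||^2=\sum_{T\in\mathcal T_h}\|\nabla_w v\|_T^2,\qquad \|v\|_{1,h}^2=\sum_{T\in\mathcal T_h}\left(\|\nabla v_0\|_T^2+h_T^{-1}\|v_0-v_b\|_{\partial T}^2\right).$$ 3. On every such partition and for every $f\in L^2(\Omega)$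 the weak Galerkin scheme for $-\Delta u=f$ in $\Omega$, $u=0$ on $\partial\Omega$, has a unique solution: there is exactly one $u_h\in V_h^0$ with $$\sum_{T\in\mathcal T_h}(\nabla_w u_h,\nabla_w v)_T=(f,v_0)\qquad\forall\,v=\{v_0,v_b\}\in V_h^0 .$$ -/

import Mathlib

open MeasureTheory
open scoped ContDiff

noncomputable section

namespace WG

/-- Euclidean space `ℝ^d`. -/
abbrev Pt (d : ℕ) : Type := EuclideanSpace ℝ (Fin d)

/-- `P_m`: real polynomial functions on `ℝ^d` of total degree at most `m`. -/
def polySpace (d m : ℕ) : Submodule ℝ (Pt d → ℝ) where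
  carrier := {f | ∃ p : MvPolynomial (Fin d) ℝ, p.totalDegree ≤ m ∧
    ∀ x : Pt d, f x = MvPolynomial.eval (fun i => x i) p}
  zero_mem' := ⟨0, by simp, by simp⟩
  add_mem' := by
    rintro f g ⟨p, hp, hf⟩ ⟨q, hq, hg⟩
    exact ⟨p + q, (MvPolynomial.totalDegree_add p q).trans (max_le hp hq),
      fun x => by simp [hf x, hg x]⟩
  smul_mem' := by
    rintro c f ⟨p, hp, hf⟩
    exact ⟨c • p, (MvPolynomial.totalDegree_smul_le c p).trans hp,
      fun x => by simp [hf x, MvPolynomial.smul_eval]⟩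

/-- `P_m(S)`: functions on the set `S` that are restrictions of polynomials of degree at most `m`.
A function on `S` is represented by its extension by zero to `ℝ^d`. -/
def polySpaceOn {d : ℕ} (S : Set (Pt d)) (m : ℕ) : Submodule ℝ (Pt d → ℝ) where
  carrier := {f | ∃ p ∈ polySpace d m, f = S.indicator p}
  zero_mem' := ⟨0, Submodule.zero_mem _, by simp⟩
  add_mem' := by
    rintro f g ⟨p, hp, rfl⟩ ⟨q, hq, rfl⟩
    exact ⟨p + q, Submodule.add_mem _ hp hq, (Set.indicator_add' S p q).symm⟩
  smul_mem' := by
    rintro c f ⟨p, hp, rfl⟩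
    exact ⟨c • p, Submodule.smul_mem _ c hp, (Set.indicator_const_smul S c p).symm⟩

/-- The closed `d`-simplex spanned by the vertices of `s`. -/
def body {d : ℕ} (s : Affine.Simplex ℝ (Pt d) d) : Set (Pt d) :=
  convexHull ℝ (Set.range s.points)

/-- The vertices of the facet of `s` opposite to the vertex number `a`. -/
def facetVertices {d : ℕ} (s : Affine.Simplex ℝ (Pt d) d) (a : Fin (d + 1)) : Set (Pt d) :=
  s.points '' {a}ᶜ

/-- The (closed) facet of `s` opposite to the vertex number `a`. -/
def facet {d : ℕ} (s : Affine.Simplex ℝ (Pt d) d) (a : Fin (d + 1)) : Set (Pt d) :=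
  convexHull ℝ (facetVertices s a)

/-- The unit outward normal of `s` on the facet opposite to the vertex number `a`. All vectors
`points b - points a`, `b ≠ a`, have the same component orthogonal to that facet, and this
component points out of `s`. -/
def outwardNormal {d : ℕ} (s : Affine.Simplex ℝ (Pt d) d) (a : Fin (d + 1)) : Pt d :=
  let w : Pt d := (vectorSpan ℝ (facetVertices s a))ᗮ.starProjection
    (∑ b, (s.points b - s.points a))
  ‖w‖⁻¹ • w

/-- A polytopal partition of an open set `Ω ⊆ ℝ^d` into finitely many polytopes `cell T`, together
with its finite set of flat faces `face e` (edges if `d = 2`) and with a simplicial subdivision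
of each cell. Neither the cells nor the faces need be convex, and hanging nodes are allowed (a
cell may have several coplanar faces). -/
structure PolytopalMesh (d : ℕ) (Ω : Set (Pt d)) where
  Cell : Type
  Face : Type
  [cellFintype : Fintype Cell]
  [faceFintype : Fintype Face]
  cell : Cell → Set (Pt d)
  face : Face → Set (Pt d)
  /-- The index type of the simplices into which a cell is divided. -/
  Sub : Cell → Type
  [subFintype : ∀ T, Fintype (Sub T)]
  [subNonempty : ∀ T, Nonempty (Sub T)]
  simplex : ∀ T, Sub T → Affine.Simplex ℝ (Pt d) d
  /-- A cell is the union of its simplices, which do not overlap. -/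
  cell_eq : ∀ T, cell T = ⋃ i, body (simplex T i)
  sub_disjoint : ∀ T i j, i ≠ j →
    Disjoint (interior (body (simplex T i))) (interior (body (simplex T j)))
  /-- The subdivision of a cell is conforming: two simplices meet in a common face (or not). -/
  sub_conforming : ∀ T i j, body (simplex T i) ∩ body (simplex T j) =
    convexHull ℝ (Set.range (simplex T i).points ∩ Set.range (simplex T j).points)
  /-- A cell is one piece: its simplices are glued to each other along common facets. -/
  sub_connected : ∀ T i j, Relation.ReflTransGen
    (fun i' j' => ∃ a b, facetVertices (simplex T i') a = facetVertices (simplex T j') b) i j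
  /-- The cells form a partition of `Ω`. -/
  isOpen_domain : IsOpen Ω
  closure_domain : closure Ω = ⋃ T, cell T
  interior_cell_subset : ∀ T, interior (cell T) ⊆ Ω
  cell_disjoint : ∀ T T', T ≠ T' → Disjoint (interior (cell T)) (interior (cell T'))
  /-- Every face is flat, that is, contained in a hyperplane. -/
  face_flat : ∀ e, ∃ (ν : Pt d) (c : ℝ), ν ≠ 0 ∧ ∀ x ∈ face e, inner ℝ ν x = c
  face_nonempty : ∀ e, (face e).Nonempty
  /-- Every face lies on the boundary of some cell. -/
  exists_cell : ∀ e, ∃ T, face e ⊆ frontier (cell T)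
  /-- The boundary of a cell is the union of the faces contained in it. -/
  frontier_eq : ∀ T, frontier (cell T) = ⋃ e ∈ {e | face e ⊆ frontier (cell T)}, face e
  /-- Distinct faces do not overlap. -/
  face_overlap : ∀ e e', e ≠ e' → μHE[d - 1] (face e ∩ face e') = 0
  /-- The subdivision of a cell divides each face of the cell into facets of simplices. -/
  face_eq : ∀ T e, face e ⊆ frontier (cell T) →
    face e = ⋃ ia ∈ {ia : Sub T × Fin (d + 1) | facet (simplex T ia.1) ia.2 ⊆ face e},
      facet (simplex T ia.1) ia.2
  /-- Every face lies on the boundary of the domain or is shared by exactly two cells. -/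
  face_shared : ∀ e, face e ⊆ frontier Ω ∨ {T | face e ⊆ frontier (cell T)}.ncard = 2

attribute [instance] PolytopalMesh.cellFintype PolytopalMesh.faceFintype
  PolytopalMesh.subFintype PolytopalMesh.subNonempty

namespace PolytopalMesh

variable {d : ℕ} {Ω : Set (Pt d)} (M : PolytopalMesh d Ω)

/-- The diameter `h_T` of a cell. -/
def diam (T : M.Cell) : ℝ := Metric.diam (M.cell T)

/-- Shape regularity with parameter `ρ`: every simplex of the subdivision of a cell `T` contains a
ball of radius `ρ h_T`. -/
def ShapeRegular (ρ : ℝ) : Prop :=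
  ∀ T i, ∃ c : Pt d, Metric.closedBall c (ρ * M.diam T) ⊆ body (M.simplex T i)

open scoped Classical in
/-- The faces `e ⊆ ∂T` of a cell `T`. -/
def faces (T : M.Cell) : Finset M.Face :=
  Finset.univ.filter fun e => M.face e ⊆ frontier (M.cell T)

open scoped Classical in
/-- The facets of the simplices of the subdivision of `T` that make up the face `e` of `T`. -/
def facets (T : M.Cell) (e : M.Face) : Finset (M.Sub T × Fin (d + 1)) :=
  Finset.univ.filter fun ia => facet (M.simplex T ia.1) ia.2 ⊆ M.face e

/-- Pairs `{v_0, v_b}`: one function per cell and one function per face. -/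
abbrev WeakFun : Type := (M.Cell → Pt d → ℝ) × (M.Face → Pt d → ℝ)

/-- The space `V_h`: `v_0` is in `P_k(T)` on each cell, `v_b` is in `P_{k+1}(e)` on each face.
As a cell has interior points, `v_0` on `T` is represented by a polynomial on `ℝ^d`. -/
def Vh (k : ℕ) : Submodule ℝ M.WeakFun :=
  (Submodule.pi Set.univ fun _ : M.Cell => polySpace d k).prod
    (Submodule.pi Set.univ fun e : M.Face => polySpaceOn (M.face e) (k + 1))

/-- The space `V_h^0` of those `v ∈ V_h` with `v_b = 0` on `∂Ω`. -/
def Vh0 (k : ℕ) : Submodule ℝ M.WeakFun where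
  carrier := {v | v ∈ M.Vh k ∧ ∀ e, M.face e ⊆ frontier Ω → v.2 e = 0}
  zero_mem' := ⟨Submodule.zero_mem _, fun _ _ => rfl⟩
  add_mem' := by
    rintro v w ⟨hv, hv'⟩ ⟨hw, hw'⟩
    exact ⟨Submodule.add_mem _ hv hw, fun e he => by simp [hv' e he, hw' e he]⟩
  smul_mem' := by
    rintro c v ⟨hv, hv'⟩
    exact ⟨Submodule.smul_mem _ c hv, fun e he => by simp [hv' e he]⟩

/-- Piecewise vector fields on a cell `T`: one field per simplex of the subdivision of `T`. -/
abbrev PwField (T : M.Cell) : Type := M.Sub T → Pt d → Pt d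

/-- The `L²(T)` inner product of piecewise vector fields. -/
def pwInner (T : M.Cell) (g q : M.PwField T) : ℝ :=
  ∑ i, ∫ x in body (M.simplex T i), inner ℝ (g i x) (q i x)

/-- `p` is the weak (distributional) divergence on `T` of the piecewise vector field `q`. -/
def IsWeakDiv (T : M.Cell) (q : M.PwField T) (p : Pt d → ℝ) : Prop :=
  ∀ φ : Pt d → ℝ, ContDiff ℝ ∞ φ → HasCompactSupport φ → tsupport φ ⊆ interior (M.cell T) →
    ∑ i, ∫ x in body (M.simplex T i), inner ℝ (q i x) (gradient φ x) =
      -∫ x in M.cell T, p x * φ x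

/-- The space `Λ_k(T)` of fields `q ∈ H(div, T)` with `q|_{T_i} ∈ [P_{k+1}(T_i)]^d` on every
simplex, `∇ · q ∈ P_k(T)`, and `q · n ∈ P_{k+1}(e)` on every face `e` of `T`. -/
def Lam (k : ℕ) (T : M.Cell) : Set (M.PwField T) :=
  {q | (∀ i, ∀ l : Fin d, (fun x => q i x l) ∈ polySpace d (k + 1)) ∧
    (∃ p ∈ polySpace d k, M.IsWeakDiv T q p) ∧
    ∀ e ∈ M.faces T, ∃ p ∈ polySpace d (k + 1), ∀ ia ∈ M.facets T e,
      ∀ x ∈ facet (M.simplex T ia.1) ia.2,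
        inner ℝ (q ia.1 x) (outwardNormal (M.simplex T ia.1) ia.2) = p x}

/-- The boundary pairing `⟨v_b, q · n⟩_{∂T}`. -/
def bdryPairing (T : M.Cell) (vb : M.Face → Pt d → ℝ) (q : M.PwField T) : ℝ :=
  ∑ e ∈ M.faces T, ∑ ia ∈ M.facets T e, ∫ x in facet (M.simplex T ia.1) ia.2,
    vb e x * inner ℝ (q ia.1 x) (outwardNormal (M.simplex T ia.1) ia.2) ∂μHE[d - 1]

/-- `g` is a weak gradient of `v` on `T`: it lies in `Λ_k(T)` and satisfies
`(g, q)_T = -(v_0, ∇ · q)_T + ⟨v_b, q · n⟩_{∂T}` for all `q ∈ Λ_k(T)`. -/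
def IsWeakGrad (k : ℕ) (T : M.Cell) (v : M.WeakFun) (g : M.PwField T) : Prop :=
  g ∈ M.Lam k T ∧ ∀ q ∈ M.Lam k T, ∀ p ∈ polySpace d k, M.IsWeakDiv T q p →
    M.pwInner T g q = -(∫ x in M.cell T, v.1 T x * p x) + M.bdryPairing T v.2 q

open scoped Classical in
/-- The weak gradient `∇_w v` on the cell `T`. -/
def weakGrad (k : ℕ) (v : M.WeakFun) (T : M.Cell) : M.PwField T :=
  if h : ∃ g, M.IsWeakGrad k T v g then h.choose else 0

/-- The bilinear form `(∇_w u, ∇_w v)` summed over all cells. -/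
def form (k : ℕ) (u v : M.WeakFun) : ℝ :=
  ∑ T, M.pwInner T (M.weakGrad k u T) (M.weakGrad k v T)

/-- The energy semi-norm `|||v|||`. -/
def tripleNorm (k : ℕ) (v : M.WeakFun) : ℝ := √(M.form k v v)

/-- The discrete `H¹` semi-norm `‖v‖_{1,h}`. -/
def oneNorm (v : M.WeakFun) : ℝ :=
  √(∑ T, ((∫ x in M.cell T, ‖gradient (v.1 T) x‖ ^ 2) +
    (M.diam T)⁻¹ * ∑ e ∈ M.faces T, ∫ x in M.face e, (v.1 T x - v.2 e x) ^ 2 ∂μHE[d - 1]))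

/-- `u` solves the weak Galerkin scheme for `-Δu = f` in `Ω`, `u = 0` on `∂Ω`. -/
def IsWGSolution (k : ℕ) (f : Pt d → ℝ) (u : M.WeakFun) : Prop :=
  u ∈ M.Vh0 k ∧ ∀ v ∈ M.Vh0 k, M.form k u v = ∑ T, ∫ x in M.cell T, f x * v.1 T x

end PolytopalMesh

end WG

end

/-! Well-posedness of the weak gradient is linear algebra. The `L²` product is positive definite on
the finite-dimensional space `Λ_k(T)`, and the right-hand side is linear in `q` because a weak
divergence in `P_k` is unique; the weak gradient is the Riesz representative. Integration by parts
on a cell (`IsWeakDiv.integral_by_parts`) turns its definition into `(∇_w v, q)_T = (∇v₀, q)_T +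
⟨v_b - v₀, q·n⟩_{∂T}` (`pwInner_weakGrad`), the source of the norm estimates.

The norm equivalence holds cell by cell. For the upper bound take `q = ∇_w v` and control `q·n` by a
trace inequality. The lower bound needs two test fields. A field with `q·n = 0` and `∇·q = -(v₀ -
c)`, `c` the mean of `v₀`, gives `(∇_w v, q) = ‖v₀ - c‖²`, and an inverse inequality then bounds
`∇v₀`. A field with `q·n = h⁻¹(v_b - v₀)` and constant divergence isolates the jump. Both exist by
`exists_cell_lift`: compatible polynomial data for divergence and normal component are attained in
`H(div, T)` by a piecewise polynomial field whose norm is bounded by the data with the right powers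
of `h`.

On one simplex the lift has two pieces. Combinations of `λ_b v_b (x_b - x_a)` prescribe the normal
component on one facet and vanish on the others (`exists_facet_lift`). Bubble fields built from `λ_a
λ_b (∂_{ab} w)(x_b - x_a)` have no normal component and reach every divergence of zero mean
(`exists_bubble_lift`), because minus their divergence is the operator of a weighted Dirichlet
energy. On a cell, constant fluxes through the interior facets are chosen so that every simplex is
balanced; they are sent along paths of adjacent simplices (`exists_flux`), whose number is bounded
by shape regularity.

Uniformity comes from scaling. The trace, Poincaré and inverse inequalities and the facet lift are
obtained on one reference simplex by compactness in finite dimension and carried over by affine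
maps, which preserve barycentric coordinates, mean values and edge derivatives. Only heights and
edge lengths remain: heights lie between `ρ h` and `h`, and edges are at most `h`.

For the scheme, uniqueness suffices. A finite mesh is shape-regular for some `ρ`, so zero energy
forces `v₀` to be a constant `c_T` on each cell, equal to `v_b` on its faces. By the divergence
theorem for `⟨u, x⟩ u`, `‖u‖ = 1`, the sum `∑ c_T² |T|` is a sum of face fluxes that cancel across
shared faces and vanish on `∂Ω` (`piecewise_const_eq_zero`). Hence all `c_T` are zero, without any
chain of cells leading to the boundary. -/

noncomputable section

namespace WG

/-! ### Polynomial functions: calculus by induction on the degree -/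

section Polynomials

variable {d m m' : ℕ}

theorem polySpace_mono (h : m ≤ m') : polySpace d m ≤ polySpace d m' := by
  rintro f ⟨p, hp, hf⟩
  exact ⟨p, hp.trans h, hf⟩

theorem const_mem_polySpace (c : ℝ) : (fun _ => c : Pt d → ℝ) ∈ polySpace d m :=
  ⟨MvPolynomial.C c, by simp, by simp⟩

theorem coord_mem_polySpace (l : Fin d) : (fun x : Pt d => x l) ∈ polySpace d 1 :=
  ⟨MvPolynomial.X l, by simp, by simp⟩

theorem mul_mem_polySpace {f g : Pt d → ℝ} (hf : f ∈ polySpace d m) (hg : g ∈ polySpace d m') :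
    (fun x => f x * g x) ∈ polySpace d (m + m') := by
  obtain ⟨p, hp, hf⟩ := hf
  obtain ⟨q, hq, hg⟩ := hg
  exact ⟨p * q, (MvPolynomial.totalDegree_mul p q).trans (add_le_add hp hq),
    fun x => by simp [hf x, hg x]⟩

theorem add_mem_polySpace {f g : Pt d → ℝ} (hf : f ∈ polySpace d m) (hg : g ∈ polySpace d m) :
    (fun x => f x + g x) ∈ polySpace d m :=
  Submodule.add_mem _ hf hg

theorem sub_mem_polySpace {f g : Pt d → ℝ} (hf : f ∈ polySpace d m) (hg : g ∈ polySpace d m) :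
    (fun x => f x - g x) ∈ polySpace d m :=
  Submodule.sub_mem _ hf hg

theorem const_mul_mem_polySpace {f : Pt d → ℝ} (c : ℝ) (hf : f ∈ polySpace d m) :
    (fun x => c * f x) ∈ polySpace d m :=
  Submodule.smul_mem _ c hf

theorem sum_mem_polySpace {ι : Type*} (s : Finset ι) {f : ι → Pt d → ℝ}
    (hf : ∀ i ∈ s, f i ∈ polySpace d m) : (fun x => ∑ i ∈ s, f i x) ∈ polySpace d m := by
  have := Submodule.sum_mem _ hf
  rwa [show (∑ i ∈ s, f i) = fun x => ∑ i ∈ s, f i x from by ext x; simp] at this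

theorem polySpace_zero_eq_const {f : Pt d → ℝ} (hf : f ∈ polySpace d 0) :
    ∃ c, f = fun _ => c := by
  obtain ⟨p, hp, hf⟩ := hf
  have := (MvPolynomial.totalDegree_eq_zero_iff_eq_C (p := p)).1 (by omega)
  refine ⟨p.coeff 0, funext fun x => ?_⟩
  rw [hf x, this]
  simp

/-- A polynomial of degree at most `m + 1` is a constant plus a combination of the coordinates
with coefficients of degree at most `m`. -/
theorem exists_decomp_polySpace_succ {f : Pt d → ℝ} (hf : f ∈ polySpace d (m + 1)) :
    ∃ (c : ℝ) (g : Fin d → Pt d → ℝ), (∀ l, g l ∈ polySpace d m) ∧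
      f = fun x => c + ∑ l, x l * g l x := by
  classical
  obtain ⟨p, hp, hf⟩ := hf
  let Q : MvPolynomial (Fin d) ℝ → Prop := fun p => ∃ (c : ℝ) (g : Fin d → Pt d → ℝ),
    (∀ l, g l ∈ polySpace d m) ∧
      ∀ x : Pt d, MvPolynomial.eval (fun i => x i) p = c + ∑ l, x l * g l x
  suffices Q p by
    obtain ⟨c, g, hg, h⟩ := this
    exact ⟨c, g, hg, funext fun x => by rw [hf x, h x]⟩
  rw [p.as_sum]
  refine Finset.sum_induction _ Q ?_ ⟨0, fun _ => 0, fun l => Submodule.zero_mem _, by simp⟩ ?_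
  · rintro p q ⟨c, g, hg, h⟩ ⟨c', g', hg', h'⟩
    refine ⟨c + c', g + g', fun l => Submodule.add_mem _ (hg l) (hg' l), fun x => ?_⟩
    simp [h x, h' x, mul_add, Finset.sum_add_distrib]
    ring
  · intro s hs
    have hdeg : (s.sum fun _ e => e) ≤ m + 1 := (MvPolynomial.le_totalDegree hs).trans hp
    by_cases h0 : s = 0
    · exact ⟨p.coeff s, fun _ => 0, fun l => Submodule.zero_mem _, by simp [h0]⟩
    · obtain ⟨l, hl⟩ : ∃ l, s l ≠ 0 := by
        by_contra! hcon
        exact h0 (Finsupp.ext hcon)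
      obtain ⟨s', rfl⟩ : ∃ s', s = Finsupp.single l 1 + s' := by
        refine ⟨s - Finsupp.single l 1, ?_⟩
        ext i
        by_cases hi : i = l
        · subst hi; simp; omega
        · simp [Ne.symm hi]
      -- A nonconstant monomial has a factor `x_l`; the rest of the monomial is the coefficient at
      -- `l`, and the other coefficients are zero.
      refine ⟨0, Function.update 0 l
        (fun x => MvPolynomial.eval (fun i => x i) (MvPolynomial.monomial s'
          (p.coeff (Finsupp.single l 1 + s')))), fun l' => ?_, fun x => ?_⟩
      · by_cases hl' : l' = l
        · subst hl'
          rw [Function.update_self]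
          refine ⟨_, (MvPolynomial.totalDegree_monomial_le _ _).trans ?_, fun x => rfl⟩
          rw [Finsupp.sum_add_index' (by simp) (by simp), Finsupp.sum_single_index rfl] at hdeg
          exact Nat.le_of_add_le_add_left (hdeg.trans_eq (add_comm m 1))
        · rw [Function.update_of_ne hl']
          exact Submodule.zero_mem _
      · rw [Finset.sum_eq_single l]
        · simp only [Function.update_self, zero_add]
          rw [show MvPolynomial.monomial (Finsupp.single l 1 + s')
              (p.coeff (Finsupp.single l 1 + s')) = MvPolynomial.X l *
              MvPolynomial.monomial s' (p.coeff (Finsupp.single l 1 + s')) by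
            rw [MvPolynomial.X, MvPolynomial.monomial_mul, one_mul]]
          simp
        · intro l' _ hl'
          simp [Function.update_of_ne hl']
        · simp

theorem contDiff_of_mem_polySpace {n : WithTop ℕ∞} {f : Pt d → ℝ} (hf : f ∈ polySpace d m) :
    ContDiff ℝ n f := by
  induction m generalizing f with
  | zero =>
    obtain ⟨c, rfl⟩ := polySpace_zero_eq_const hf
    exact contDiff_const
  | succ m ih =>
    obtain ⟨c, g, hg, rfl⟩ := exists_decomp_polySpace_succ hf
    refine contDiff_const.add (ContDiff.sum fun l _ => ContDiff.mul ?_ (ih (hg l)))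
    exact (EuclideanSpace.proj (𝕜 := ℝ) l).contDiff

theorem continuous_of_mem_polySpace {f : Pt d → ℝ} (hf : f ∈ polySpace d m) : Continuous f :=
  (contDiff_of_mem_polySpace (n := 0) hf).continuous

theorem differentiable_of_mem_polySpace {f : Pt d → ℝ} (hf : f ∈ polySpace d m) :
    Differentiable ℝ f :=
  (contDiff_of_mem_polySpace (n := 1) hf).differentiable (by simp)

/-- Induction on the degree through the decomposition `c + ∑ x_l g_l` and the product rule. The
truncated `0 - 1 = 0` is harmless, as constants have zero derivative. -/
theorem fderiv_mem_polySpace {f : Pt d → ℝ} (hf : f ∈ polySpace d m) (u : Pt d) :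
    (fun x => fderiv ℝ f x u) ∈ polySpace d (m - 1) := by
  induction m generalizing f with
  | zero =>
    obtain ⟨c, rfl⟩ := polySpace_zero_eq_const hf
    simpa using const_mem_polySpace (d := d) (m := 0) (0 : ℝ)
  | succ m ih =>
    obtain ⟨c, g, hg, rfl⟩ := exists_decomp_polySpace_succ hf
    have hd : ∀ x, fderiv ℝ (fun x : Pt d => c + ∑ l, x l * g l x) x u =
        ∑ l, (u l * g l x + x l * fderiv ℝ (g l) x u) := by
      intro x
      have h1 : HasFDerivAt (fun x : Pt d => c + ∑ l, x l * g l x)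
          (∑ l, (x l • fderiv ℝ (g l) x + g l x • EuclideanSpace.proj (𝕜 := ℝ) l)) x := by
        refine HasFDerivAt.const_add c (HasFDerivAt.fun_sum fun l _ => ?_)
        exact ((EuclideanSpace.proj (𝕜 := ℝ) l).hasFDerivAt).mul
          ((differentiable_of_mem_polySpace (hg l)) x).hasFDerivAt
      rw [h1.fderiv]
      simp only [FunLike.coe_sum, Finset.sum_apply, add_apply, smul_apply, smul_eq_mul]
      refine Finset.sum_congr rfl fun l _ => ?_
      change _ + g l x * u l = _
      ring
    simp only [hd, Nat.add_sub_cancel]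
    refine sum_mem_polySpace _ fun l _ => add_mem_polySpace (const_mul_mem_polySpace _ (hg l)) ?_
    -- For `m = 0` the degree count `1 + (m - 1)` would give `1`; constancy of `g_l` settles that
    -- case.
    rcases Nat.eq_zero_or_pos m with rfl | hm
    · obtain ⟨c, hc⟩ := polySpace_zero_eq_const (hg l)
      simp only [hc]
      simpa using const_mem_polySpace (d := d) (m := 0) (0 : ℝ)
    · have := mul_mem_polySpace (coord_mem_polySpace l) (ih (hg l))
      rwa [show 1 + (m - 1) = m by omega] at this

/-- Only the coordinates have to be substituted in the decomposition, so an affine substitution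
keeps the degree. This permits transport between simplices. -/
theorem comp_mem_polySpace {d' : ℕ} {f : Pt d → ℝ} (hf : f ∈ polySpace d m) {φ : Pt d' → Pt d}
    (hφ : ∀ l, (fun x => φ x l) ∈ polySpace d' 1) : (fun x => f (φ x)) ∈ polySpace d' m := by
  induction m generalizing f with
  | zero =>
    obtain ⟨c, rfl⟩ := polySpace_zero_eq_const hf
    exact const_mem_polySpace c
  | succ m ih =>
    obtain ⟨c, g, hg, rfl⟩ := exists_decomp_polySpace_succ hf
    refine add_mem_polySpace (const_mem_polySpace c) (sum_mem_polySpace _ fun l _ => ?_)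
    have := mul_mem_polySpace (hφ l) (ih (hg l))
    rwa [add_comm] at this

theorem linear_mem_polySpace (L : Pt d →ₗ[ℝ] ℝ) : (fun x => L x) ∈ polySpace d 1 := by
  have : (fun x => L x) = fun x : Pt d => ∑ l, L (EuclideanSpace.single l 1) * x l := by
    ext x
    conv_lhs => rw [← (EuclideanSpace.basisFun (Fin d) ℝ).sum_repr x]
    simp [map_sum, mul_comm]
  rw [this]
  exact sum_mem_polySpace _ fun l _ => const_mul_mem_polySpace _ (coord_mem_polySpace l)

theorem affine_mem_polySpace (A : Pt d →ᵃ[ℝ] ℝ) : (fun x => A x) ∈ polySpace d 1 := by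
  have : (fun x => A x) = fun x => A.linear x + A 0 := by
    ext x
    have := A.map_vadd 0 x
    simpa using this
  rw [this]
  exact add_mem_polySpace (linear_mem_polySpace _) (const_mem_polySpace _)

/-- A polynomial that vanishes on a non-empty open set is zero. -/
theorem eq_zero_of_eqOn_open {f : Pt d → ℝ} (hf : f ∈ polySpace d m) {U : Set (Pt d)}
    (hU : IsOpen U) (hne : U.Nonempty) (h : ∀ x ∈ U, f x = 0) : f = 0 := by
  obtain ⟨p, hp, hf⟩ := hf
  obtain ⟨x, hx⟩ := hne
  have hU' : IsOpen ((WithLp.toLp 2 : (Fin d → ℝ) → Pt d) ⁻¹' U) :=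
    hU.preimage (PiLp.continuous_toLp 2 _)
  obtain ⟨ε, hε, hball⟩ := Metric.isOpen_iff.1 hU' (WithLp.ofLp x) (by simpa using hx)
  have hp0 : p = 0 := by
    -- An open set contains a product of intervals, and a polynomial that vanishes on a product of
    -- infinite sets is zero.
    refine MvPolynomial.funext_set (fun i => Metric.ball (x i) ε) (fun i => ?_) fun y hy => ?_
    · rw [Real.ball_eq_Ioo]
      exact Set.Ioo_infinite (by linarith)
    · have hy' : y ∈ Metric.ball (WithLp.ofLp x) ε := by
        rw [ball_pi _ hε]
        exact hy
      have h1 := h _ (hball hy')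
      rw [hf] at h1
      simpa using h1
  ext y
  simp [hf y, hp0]

instance finiteDimensional_polySpace : FiniteDimensional ℝ (polySpace d m) := by
  let ev : MvPolynomial (Fin d) ℝ →ₗ[ℝ] (Pt d → ℝ) :=
    { toFun := fun p x => MvPolynomial.eval (fun i => x i) p
      map_add' := fun p q => by ext; simp
      map_smul' := fun c p => by ext; simp [MvPolynomial.smul_eval] }
  have : polySpace d m = (MvPolynomial.restrictTotalDegree (Fin d) ℝ m).map ev := by
    ext f
    constructor
    · rintro ⟨p, hp, hf⟩
      exact ⟨p, (MvPolynomial.mem_restrictTotalDegree _ _ _).2 hp, funext fun x => (hf x).symm⟩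
    · rintro ⟨p, hp, rfl⟩
      exact ⟨p, (MvPolynomial.mem_restrictTotalDegree _ _ _).1 hp, fun x => rfl⟩
  rw [this]
  infer_instance

end Polynomials

end WG
end

noncomputable section

namespace WG

/-! ### Barycentric coordinates, outward normals and heights of a simplex -/

section SimplexGeometry

variable {n : ℕ} (s : Affine.Simplex ℝ (Pt (n + 1)) (n + 1))

/-- The vertices of a full-dimensional simplex as an affine basis. -/
def simplexBasis : AffineBasis (Fin (n + 1 + 1)) ℝ (Pt (n + 1)) :=
  ⟨s.points, s.independent, by
    rw [s.independent.affineSpan_eq_top_iff_card_eq_finrank_add_one]; simp⟩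

/-- Barycentric coordinates. -/
def bc (a : Fin (n + 1 + 1)) (x : Pt (n + 1)) : ℝ := (simplexBasis s).coord a x

theorem simplexBasis_apply (b : Fin (n + 1 + 1)) : simplexBasis s b = s.points b := rfl

theorem bc_points (a b : Fin (n + 1 + 1)) : bc s a (s.points b) = if a = b then 1 else 0 :=
  (simplexBasis s).coord_apply a b

theorem bc_points_self (a : Fin (n + 1 + 1)) : bc s a (s.points a) = 1 := by simp [bc_points]

theorem sum_bc (x : Pt (n + 1)) : ∑ a, bc s a x = 1 := (simplexBasis s).sum_coord_apply_eq_one x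

theorem sum_bc_smul (x : Pt (n + 1)) : ∑ a, bc s a x • s.points a = x :=
  (simplexBasis s).linear_combination_coord_eq_self x

theorem sum_bc_smul_sub (x p : Pt (n + 1)) : ∑ a, bc s a x • (s.points a - p) = x - p := by
  simp only [smul_sub, Finset.sum_sub_distrib, ← Finset.sum_smul, sum_bc, sum_bc_smul, one_smul]

theorem bc_mem_polySpace (a : Fin (n + 1 + 1)) : bc s a ∈ polySpace (n + 1) 1 :=
  affine_mem_polySpace ((simplexBasis s).coord a)

@[fun_prop]
theorem continuous_bc (a : Fin (n + 1 + 1)) : Continuous (bc s a) :=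
  continuous_of_mem_polySpace (bc_mem_polySpace s a)

@[fun_prop]
theorem differentiable_bc (a : Fin (n + 1 + 1)) : Differentiable ℝ (bc s a) :=
  differentiable_of_mem_polySpace (bc_mem_polySpace s a)

theorem bc_lineMap (a : Fin (n + 1 + 1)) (x y : Pt (n + 1)) (t : ℝ) :
    bc s a (x + t • (y - x)) = (1 - t) * bc s a x + t * bc s a y := by
  have := ((simplexBasis s).coord a).apply_lineMap x y t
  simp only [AffineMap.lineMap_apply, vsub_eq_sub, vadd_eq_add, smul_eq_mul] at this
  rw [bc, add_comm x, this]
  simp only [bc]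
  ring

theorem fderiv_bc (a : Fin (n + 1 + 1)) (x u : Pt (n + 1)) :
    fderiv ℝ (bc s a) x u = ((simplexBasis s).coord a).linear u := by
  have h : bc s a = fun x => ((simplexBasis s).coord a).linear.toContinuousLinearMap x +
      (simplexBasis s).coord a 0 := by
    ext x
    have := ((simplexBasis s).coord a).map_vadd 0 x
    simpa [bc] using this
  rw [h, ((((simplexBasis s).coord a).linear.toContinuousLinearMap.hasFDerivAt
    (x := x)).add_const _).fderiv]
  simp

theorem fderiv_bc_sub (a : Fin (n + 1 + 1)) (x y z : Pt (n + 1)) :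
    fderiv ℝ (bc s a) x (y - z) = bc s a y - bc s a z := by
  rw [fderiv_bc, bc, bc, ← vsub_eq_sub, AffineMap.linearMap_vsub]
  simp

theorem bc_add (a : Fin (n + 1 + 1)) (x u : Pt (n + 1)) :
    bc s a (x + u) = bc s a x + fderiv ℝ (bc s a) 0 u := by
  have := fderiv_bc_sub s a 0 (x + u) x
  rw [add_sub_cancel_left] at this
  linarith

theorem ext_bc {x y : Pt (n + 1)} (h : ∀ a, bc s a x = bc s a y) : x = y := by
  rw [← sum_bc_smul s x, ← sum_bc_smul s y]
  simp [h]

theorem body_eq : body s = {x | ∀ a, 0 ≤ bc s a x} :=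
  (simplexBasis s).convexHull_eq_nonneg_coord

theorem mem_body {x : Pt (n + 1)} : x ∈ body s ↔ ∀ a, 0 ≤ bc s a x := by
  rw [body_eq]; rfl

theorem interior_body : interior (body s) = {x | ∀ a, 0 < bc s a x} :=
  (simplexBasis s).interior_convexHull

theorem mem_interior_body {x : Pt (n + 1)} : x ∈ interior (body s) ↔ ∀ a, 0 < bc s a x := by
  rw [interior_body]; rfl

theorem bc_le_one {x : Pt (n + 1)} (hx : x ∈ body s) (a : Fin (n + 1 + 1)) : bc s a x ≤ 1 := by
  rw [← sum_bc s x]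
  exact Finset.single_le_sum (f := fun a => bc s a x) (fun b _ => (mem_body s).1 hx b)
    (Finset.mem_univ a)

/-- The face of a simplex spanned by the vertices in `I`, in barycentric coordinates. -/
theorem mem_convexHull_image {I : Set (Fin (n + 1 + 1))} {x : Pt (n + 1)} :
    x ∈ convexHull ℝ (s.points '' I) ↔ (∀ b ∉ I, bc s b x = 0) ∧ ∀ b, 0 ≤ bc s b x := by
  classical
  constructor
  · intro hx
    have hsub : convexHull ℝ (s.points '' I) ⊆
        {x | (∀ b ∉ I, bc s b x = 0) ∧ ∀ b, 0 ≤ bc s b x} := by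
      refine convexHull_min ?_ ?_
      · rintro _ ⟨c, hc, rfl⟩
        refine ⟨fun b hb => ?_, fun b => ?_⟩
        · rw [bc_points, if_neg]; rintro rfl; exact hb hc
        · rw [bc_points]; split_ifs <;> norm_num
      · rw [convex_iff_segment_subset]
        rintro x ⟨hx, hx'⟩ y ⟨hy, hy'⟩
        rw [segment_eq_image']
        rintro _ ⟨t, ⟨ht0, ht1⟩, rfl⟩
        refine ⟨fun b hb => ?_, fun b => ?_⟩
        · simp only [bc_lineMap, hx b hb, hy b hb]; ring
        · simp only [bc_lineMap]
          have := hx' b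
          have := hy' b
          have : 0 ≤ 1 - t := by linarith
          positivity
    exact hsub hx
  · rintro ⟨h0, hp⟩
    have h1 : ∑ b ∈ Finset.univ.filter (· ∈ I), bc s b x = 1 := by
      rw [← sum_bc s x, Finset.sum_filter]
      exact Finset.sum_congr rfl fun b _ => by
        split_ifs with h
        · rfl
        · exact (h0 b h).symm
    have h2 : ∑ b ∈ Finset.univ.filter (· ∈ I), bc s b x • s.points b = x := by
      conv_rhs => rw [← sum_bc_smul s x]
      rw [Finset.sum_filter]
      refine Finset.sum_congr rfl fun b _ => ?_
      split_ifs with h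
      · rfl
      · rw [h0 b h, zero_smul]
    rw [← h2]
    refine (convex_convexHull ℝ _).sum_mem (fun b _ => hp b) h1 fun b hb => ?_
    exact subset_convexHull _ _ ⟨b, by simpa using hb, rfl⟩

theorem mem_facet {a : Fin (n + 1 + 1)} {x : Pt (n + 1)} :
    x ∈ facet s a ↔ bc s a x = 0 ∧ ∀ b, 0 ≤ bc s b x := by
  rw [facet, facetVertices, mem_convexHull_image]
  simp

theorem facet_subset_body (a : Fin (n + 1 + 1)) : facet s a ⊆ body s := fun _ hx =>
  (mem_body s).2 ((mem_facet s).1 hx).2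

theorem points_mem_body (a : Fin (n + 1 + 1)) : s.points a ∈ body s :=
  subset_convexHull _ _ ⟨a, rfl⟩

theorem isCompact_body : IsCompact (body s) := (Set.finite_range s.points).isCompact_convexHull ℝ

theorem isCompact_facet (a : Fin (n + 1 + 1)) : IsCompact (facet s a) :=
  ((Set.toFinite {a}ᶜ).image s.points).isCompact_convexHull ℝ

theorem convex_body : Convex ℝ (body s) := convex_convexHull _ _

theorem facetVertices_subset_facet (a : Fin (n + 1 + 1)) : facetVertices s a ⊆ facet s a :=
  subset_convexHull _ _

/-- A point with prescribed barycentric coordinates. -/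
theorem bc_sum_smul (w : Fin (n + 1 + 1) → ℝ) (hw : ∑ a, w a = 1) (b : Fin (n + 1 + 1)) :
    bc s b (∑ a, w a • s.points a) = w b := by
  have h := (simplexBasis s).coord_apply_combination_of_mem (Finset.mem_univ b) hw
  rw [Finset.univ.affineCombination_eq_linear_combination _ _ hw] at h
  exact h

theorem interior_body_nonempty : (interior (body s)).Nonempty := by
  refine ⟨∑ a, (fun _ => ((n : ℝ) + 1 + 1)⁻¹) a • s.points a, (mem_interior_body s).2 fun a => ?_⟩
  rw [bc_sum_smul]
  · positivity
  · simp only [Finset.sum_const, Finset.card_univ, Fintype.card_fin, nsmul_eq_mul]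
    push_cast
    exact mul_inv_cancel₀ (by positivity)

/-- Points in the relative interior of a facet. -/
theorem exists_relint_facet (a : Fin (n + 1 + 1)) :
    ∃ x, bc s a x = 0 ∧ ∀ b, b ≠ a → 0 < bc s b x := by
  classical
  refine ⟨∑ b, (if b = a then 0 else ((n : ℝ) + 1)⁻¹) • s.points b, ?_, fun b hb => ?_⟩
  all_goals rw [bc_sum_smul s (fun b => if b = a then 0 else ((n : ℝ) + 1)⁻¹)]
  · simp
  · rw [Finset.sum_ite, Finset.sum_const, Finset.filter_ne']
    simp [Finset.card_erase_of_mem]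
    field_simp
  · simp only [hb, if_false]; positivity
  · rw [Finset.sum_ite, Finset.sum_const, Finset.filter_ne']
    simp [Finset.card_erase_of_mem]
    field_simp

/-- The height of a simplex over its facet opposite to the vertex `a`. -/
def ht (a : Fin (n + 1 + 1)) : ℝ :=
  ((n : ℝ) + 1)⁻¹ * inner ℝ (outwardNormal s a) (∑ b, (s.points b - s.points a))

theorem sub_mem_vectorSpan_facet {a b c : Fin (n + 1 + 1)} (hb : b ≠ a) (hc : c ≠ a) :
    s.points b - s.points c ∈ vectorSpan ℝ (facetVertices s a) :=
  vsub_mem_vectorSpan ℝ ⟨b, hb, rfl⟩ ⟨c, hc, rfl⟩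

theorem fderiv_bc_eq_zero_of_mem_vectorSpan {a : Fin (n + 1 + 1)} {v : Pt (n + 1)}
    (hv : v ∈ vectorSpan ℝ (facetVertices s a)) : ((simplexBasis s).coord a).linear v = 0 := by
  have : vectorSpan ℝ (facetVertices s a) ≤ LinearMap.ker ((simplexBasis s).coord a).linear := by
    rw [vectorSpan_def, Submodule.span_le]
    rintro _ ⟨_, ⟨b, hb, rfl⟩, _, ⟨c, hc, rfl⟩, rfl⟩
    rw [SetLike.mem_coe, LinearMap.mem_ker]
    dsimp only
    rw [AffineMap.linearMap_vsub, ← simplexBasis_apply, ← simplexBasis_apply,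
      AffineBasis.coord_apply, AffineBasis.coord_apply, if_neg (Ne.symm hb), if_neg (Ne.symm hc)]
    simp
  exact this hv

/-- Otherwise the sum of the edges leaving `a` would be parallel to the facet, where the linear part
of `λ_a` vanishes; but it takes each of these `n + 1` edges to `-1`. -/
theorem normalVector_ne_zero (a : Fin (n + 1 + 1)) :
    (vectorSpan ℝ (facetVertices s a))ᗮ.starProjection
      (∑ b, (s.points b - s.points a)) ≠ 0 := by
  classical
  intro h
  rw [Submodule.starProjection_apply_eq_zero_iff, Submodule.orthogonal_orthogonal] at h
  have h1 := fderiv_bc_eq_zero_of_mem_vectorSpan s h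
  have h2 : ∀ b, ((simplexBasis s).coord a).linear (s.points b - s.points a) =
      (if a = b then 1 else 0) - 1 := by
    intro b
    rw [← fderiv_bc s a 0, fderiv_bc_sub, bc_points, bc_points_self]
  rw [map_sum, Finset.sum_congr rfl fun b _ => h2 b, Finset.sum_sub_distrib] at h1
  simp at h1
  have : (0 : ℝ) ≤ n := Nat.cast_nonneg n
  linarith

theorem norm_outwardNormal (a : Fin (n + 1 + 1)) : ‖outwardNormal s a‖ = 1 := by
  rw [outwardNormal, norm_smul, norm_inv, norm_norm]
  exact inv_mul_cancel₀ (norm_ne_zero_iff.2 (normalVector_ne_zero s a))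

theorem outwardNormal_mem_orthogonal (a : Fin (n + 1 + 1)) :
    outwardNormal s a ∈ (vectorSpan ℝ (facetVertices s a))ᗮ :=
  Submodule.smul_mem _ _ (Submodule.starProjection_apply_mem _ _)

theorem inner_outwardNormal_of_mem {a : Fin (n + 1 + 1)} {v : Pt (n + 1)}
    (hv : v ∈ vectorSpan ℝ (facetVertices s a)) : inner ℝ (outwardNormal s a) v = 0 := by
  rw [real_inner_comm]
  exact (Submodule.mem_orthogonal _ _).1 (outwardNormal_mem_orthogonal s a) v hv

theorem ht_pos (a : Fin (n + 1 + 1)) : 0 < ht s a := by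
  rw [ht]
  refine mul_pos (by positivity) ?_
  set v := ∑ b, (s.points b - s.points a)
  have h := normalVector_ne_zero s a
  have h2 : inner ℝ ((vectorSpan ℝ (facetVertices s a))ᗮ.starProjection v) v =
      ‖(vectorSpan ℝ (facetVertices s a))ᗮ.starProjection v‖ ^ 2 := by
    rw [← real_inner_self_eq_norm_sq, Submodule.inner_starProjection_left_eq_right,
      Submodule.inner_starProjection_left_eq_right, Submodule.starProjection_eq_self_iff.2
        (Submodule.starProjection_apply_mem _ v)]
  rw [outwardNormal, real_inner_smul_left]
  rw [h2]
  have := norm_pos_iff.2 h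
  positivity

/-- Differences of two such edges lie in the facet direction and are orthogonal to the normal. The
`n + 1` edges leaving `a` thus share one normal component, of which `ht` is the average. -/
theorem inner_outwardNormal_sub {a b : Fin (n + 1 + 1)} (hb : b ≠ a) :
    inner ℝ (outwardNormal s a) (s.points b - s.points a) = ht s a := by
  classical
  have h : ∀ c, inner ℝ (outwardNormal s a) (s.points c - s.points a) =
      if c = a then 0 else inner ℝ (outwardNormal s a) (s.points b - s.points a) := by
    intro c
    split_ifs with hc
    · simp [hc]
    · have := inner_outwardNormal_of_mem s (sub_mem_vectorSpan_facet s hc hb)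
      rw [← sub_eq_zero, ← inner_sub_right]
      simpa using this
  rw [ht, inner_sum, Finset.sum_congr rfl fun c _ => h c, Finset.sum_ite, Finset.sum_const_zero,
    Finset.sum_const, Finset.filter_ne']
  simp only [Finset.card_erase_of_mem (Finset.mem_univ a), Finset.card_univ, Fintype.card_fin,
    zero_add, nsmul_eq_mul, Nat.add_sub_cancel]
  push_cast
  field_simp

/-- Expand `x - x_a = ∑ λ_c (x_c - x_a)`: every `c ≠ a` contributes `ht · λ_c`, and these weights
add up to `1 - λ_a`. Hence `∇λ_a` is the outward normal divided by `-ht`. -/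
theorem inner_outwardNormal_sub_vertex (a : Fin (n + 1 + 1)) (x : Pt (n + 1)) :
    inner ℝ (outwardNormal s a) (x - s.points a) = ht s a * (1 - bc s a x) := by
  classical
  rw [← sum_bc_smul_sub s x, inner_sum]
  have h : ∀ c, inner ℝ (outwardNormal s a) (bc s c x • (s.points c - s.points a)) =
      ht s a * (bc s c x - if c = a then bc s a x else 0) := by
    intro c
    split_ifs with hc
    · simp [hc]
    · rw [real_inner_smul_right, inner_outwardNormal_sub s hc]; ring
  rw [Finset.sum_congr rfl fun c _ => h c, ← Finset.mul_sum, Finset.sum_sub_distrib, sum_bc]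
  simp

theorem inner_outwardNormal_sub' (a : Fin (n + 1 + 1)) (x y : Pt (n + 1)) :
    inner ℝ (outwardNormal s a) (x - y) = ht s a * (bc s a y - bc s a x) := by
  have h1 := inner_outwardNormal_sub_vertex s a x
  have h2 := inner_outwardNormal_sub_vertex s a y
  rw [show x - y = (x - s.points a) - (y - s.points a) by abel, inner_sub_right, h1, h2]
  ring

theorem inner_outwardNormal (a : Fin (n + 1 + 1)) (x u : Pt (n + 1)) :
    inner ℝ (outwardNormal s a) u = -(ht s a * fderiv ℝ (bc s a) x u) := by
  have := inner_outwardNormal_sub' s a u 0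
  have h2 := fderiv_bc_sub s a x u 0
  rw [sub_zero] at this h2
  rw [this, h2]
  ring

/-- An edge is seen only by the normals of the two facets opposite to its ends. A field along an
edge therefore loses its flux through one of these facets once it carries the barycentric coordinate
vanishing there; the lifts below rest on this. -/
theorem inner_edge_outwardNormal (a b c : Fin (n + 1 + 1)) :
    inner ℝ (s.points b - s.points a) (outwardNormal s c) =
      ht s c * ((if c = a then 1 else 0) - (if c = b then 1 else 0)) := by
  rw [real_inner_comm, inner_outwardNormal_sub', bc_points, bc_points]

/-- A simplex that contains a ball of radius `r` has all heights at least `r`. -/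
theorem le_ht_of_closedBall_subset {c : Pt (n + 1)} {r : ℝ} (hr : 0 ≤ r)
    (h : Metric.closedBall c r ⊆ body s) (a : Fin (n + 1 + 1)) : r ≤ ht s a := by
  have h1 : c ∈ body s := h (Metric.mem_closedBall_self hr)
  have h2 : c + r • outwardNormal s a ∈ body s := h (by
    rw [Metric.mem_closedBall, dist_eq_norm, add_sub_cancel_left, norm_smul, norm_outwardNormal,
      mul_one, Real.norm_of_nonneg hr])
  -- Moving by `r` along the normal lowers `λ_a` by `r / ht`, while `λ_a` stays between `0` and `1`.
  have h3 := inner_outwardNormal_sub' s a (c + r • outwardNormal s a) c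
  rw [add_sub_cancel_left, real_inner_smul_right, real_inner_self_eq_norm_sq,
    norm_outwardNormal] at h3
  have h4 := bc_le_one s h1 a
  have h5 := (mem_body s).1 h2 a
  have := ht_pos s a
  nlinarith

/-- Heights are bounded by the length of edges. -/
theorem ht_le_of_edge_le {h : ℝ} (hh : ∀ a b, ‖s.points b - s.points a‖ ≤ h)
    (a : Fin (n + 1 + 1)) : ht s a ≤ h := by
  obtain ⟨b, hb⟩ := exists_ne a
  rw [← inner_outwardNormal_sub s hb]
  refine (real_inner_le_norm _ _).trans ?_
  rw [norm_outwardNormal, one_mul]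
  exact hh a b

end SimplexGeometry

end WG
end

noncomputable section

namespace WG

/-! ### The standard corner simplex -/

section Corner

/-- The standard corner simplex in `ℝ^m`. -/
def corner (m : ℕ) : Set (Fin m → ℝ) := {y | (∀ i, 0 ≤ y i) ∧ ∑ i, y i ≤ 1}

theorem isClosed_corner (m : ℕ) : IsClosed (corner m) := by
  have h1 : IsClosed {y : Fin m → ℝ | ∀ i, 0 ≤ y i} := by
    rw [Set.ofPred_forall]
    exact isClosed_iInter fun i => isClosed_le continuous_const (continuous_apply i)
  exact h1.inter (isClosed_le (continuous_finsetSum _ fun i _ => continuous_apply i)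
    continuous_const)

theorem corner_subset_Icc (m : ℕ) : corner m ⊆ Set.Icc 0 1 := fun _ hy =>
  ⟨hy.1, fun i => (Finset.single_le_sum (fun j _ => hy.1 j) (Finset.mem_univ i)).trans hy.2⟩

theorem isCompact_corner (m : ℕ) : IsCompact (corner m) :=
  isCompact_Icc.of_isClosed_subset (isClosed_corner m) (corner_subset_Icc m)

theorem measurableSet_corner (m : ℕ) : MeasurableSet (corner m) := (isClosed_corner m).measurableSet

theorem volume_corner_pos (m : ℕ) : 0 < volume.real (corner m) := by
  rw [Measure.real, ENNReal.toReal_pos_iff]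
  refine ⟨?_, (isCompact_corner m).measure_lt_top⟩
  let U : Set (Fin m → ℝ) := {y | (∀ i, 0 < y i) ∧ ∑ i, y i < 1}
  have hU : IsOpen U := by
    have h1 : IsOpen {y : Fin m → ℝ | ∀ i, 0 < y i} := by
      rw [Set.ofPred_forall]
      exact isOpen_iInter_of_finite fun i => isOpen_lt continuous_const (continuous_apply i)
    exact h1.inter (isOpen_lt (continuous_finsetSum _ fun i _ => continuous_apply i)
      continuous_const)
  have hne : U.Nonempty := by
    refine ⟨fun _ => ((m : ℝ) + 1)⁻¹, fun i => by positivity, ?_⟩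
    simp only [Finset.sum_const, Finset.card_univ, Fintype.card_fin, nsmul_eq_mul]
    rw [← div_eq_mul_inv, div_lt_one (by positivity)]
    linarith
  exact (hU.measure_pos volume hne).trans_le
    (measure_mono fun y hy => ⟨fun i => (hy.1 i).le, hy.2.le⟩)

theorem cons_mem_corner {m : ℕ} {t : ℝ} {y : Fin m → ℝ} :
    (Fin.cons t y : Fin (m + 1) → ℝ) ∈ corner (m + 1) ↔
      y ∈ corner m ∧ t ∈ Set.Icc 0 (1 - ∑ i, y i) := by
  simp only [corner, Set.mem_ofPred_eq, Fin.forall_fin_succ, Fin.cons_zero, Fin.cons_succ,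
    Fin.sum_univ_succ, Set.mem_Icc]
  constructor
  · rintro ⟨⟨h1, h2⟩, h3⟩
    exact ⟨⟨h2, by linarith⟩, h1, by linarith⟩
  · rintro ⟨⟨h1, h2⟩, h3, h4⟩
    exact ⟨⟨h3, h1⟩, by linarith⟩

/-- Integration of a partial derivative over the corner simplex. -/
theorem integral_corner_fderiv {m : ℕ} {G : (Fin (m + 1) → ℝ) → ℝ} (hG : ContDiff ℝ 1 G) :
    ∫ y in corner (m + 1), fderiv ℝ G y (Pi.single 0 1) =
      ∫ y in corner m, (G (Fin.cons (1 - ∑ i, y i) y) - G (Fin.cons 0 y)) := by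
  set H : (Fin (m + 1) → ℝ) → ℝ := fun y => fderiv ℝ G y (Pi.single 0 1) with hH
  have hHc : Continuous H := (hG.continuous_fderiv (by simp)).clm_apply continuous_const
  let e := MeasurableEquiv.piFinSuccAbove (fun _ : Fin (m + 1) => ℝ) 0
  have he : MeasurePreserving e := volume_preserving_piFinSuccAbove _ 0
  have hes : ∀ t y, e.symm (t, y) = Fin.cons t y := fun t y => by
    change Fin.insertNth (α := fun _ => ℝ) 0 t y = _
    simp
  have h1 : ∫ y in corner (m + 1), H y =
      ∫ z : ℝ × (Fin m → ℝ), (corner (m + 1)).indicator H (e.symm z) := by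
    rw [← integral_indicator (measurableSet_corner _), ← he.symm.integral_comp']
  have hintg : Integrable (fun z : ℝ × (Fin m → ℝ) => (corner (m + 1)).indicator H (e.symm z))
      (volume.prod volume) := by
    have : Integrable ((corner (m + 1)).indicator H) :=
      (integrable_indicator_iff (measurableSet_corner _)).2
        (hHc.continuousOn.integrableOn_compact (isCompact_corner _))
    exact (he.symm.integrable_comp_emb e.symm.measurableEmbedding).2 this
  rw [h1, Measure.volume_eq_prod, integral_prod_symm _ hintg,
    ← integral_indicator (measurableSet_corner m)]
  refine integral_congr_ae (Filter.Eventually.of_forall fun y => ?_)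
  simp only [hes]
  by_cases hy : y ∈ corner m
  · rw [Set.indicator_of_mem hy]
    -- After Fubini, the line over `y` meets the corner simplex in the interval from `0` to `1 - ∑
    -- y`, where the fundamental theorem of calculus applies.
    have h2 : ∀ t, (corner (m + 1)).indicator H (Fin.cons t y) =
        (Set.Icc 0 (1 - ∑ i, y i)).indicator (fun t => H (Fin.cons t y)) t := by
      intro t
      by_cases ht : t ∈ Set.Icc 0 (1 - ∑ i, y i)
      · rw [Set.indicator_of_mem ht, Set.indicator_of_mem (cons_mem_corner.2 ⟨hy, ht⟩)]
      · rw [Set.indicator_of_notMem ht,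
          Set.indicator_of_notMem fun h => ht (cons_mem_corner.1 h).2]
    have hcc : Continuous fun t : ℝ => (Fin.cons t y : Fin (m + 1) → ℝ) :=
      Continuous.finCons (A := fun _ => ℝ) continuous_id continuous_const
    simp only [h2]
    rw [integral_indicator measurableSet_Icc, integral_Icc_eq_integral_Ioc,
      ← intervalIntegral.integral_of_le (by linarith [hy.2]),
      intervalIntegral.integral_eq_sub_of_hasDerivAt (f := fun t => G (Fin.cons t y))]
    · intro t _
      have hd : HasDerivAt (fun t : ℝ => (Fin.cons t y : Fin (m + 1) → ℝ)) (Pi.single 0 1) t := by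
        rw [hasDerivAt_pi]
        intro i
        refine Fin.cases ?_ (fun j => ?_) i
        · simp only [Fin.cons_zero, Pi.single_eq_same]
          exact hasDerivAt_id t
        · simpa using hasDerivAt_const t (y j)
      exact ((hG.differentiable (by simp)) _).hasFDerivAt.comp_hasDerivAt t hd
    · exact (hHc.comp hcc).intervalIntegrable _ _
  · rw [Set.indicator_of_notMem hy]
    have h2 : ∀ t, (corner (m + 1)).indicator H (Fin.cons t y) = 0 := fun t =>
      Set.indicator_of_notMem (fun h => hy (cons_mem_corner.1 h).1) _
    simp [h2]

end Corner

/-! ### Affine parametrization of simplices of any dimension -/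

section Parametrization

variable {d m : ℕ}

/-- The affine parametrization of the simplex with vertices `x`. -/
def param (x : Fin (m + 1) → Pt d) (y : Fin m → ℝ) : Pt d :=
  x 0 + ∑ l : Fin m, y l • (x l.succ - x 0)

/-- The linear part of the parametrization of a simplex. -/
def edgeMap (x : Fin (m + 1) → Pt d) : EuclideanSpace ℝ (Fin m) →ₗ[ℝ] Pt d where
  toFun y := ∑ l : Fin m, y l • (x l.succ - x 0)
  map_add' y z := by simp [add_smul, Finset.sum_add_distrib]
  map_smul' c y := by simp [mul_smul, Finset.smul_sum]

theorem param_eq (x : Fin (m + 1) → Pt d) (y : Fin m → ℝ) :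
    param x y = x 0 + edgeMap x (WithLp.toLp 2 y) := rfl

theorem param_eq_sum (x : Fin (m + 1) → Pt d) (y : Fin m → ℝ) :
    param x y = ∑ i, (Fin.cons (1 - ∑ l, y l) y : Fin (m + 1) → ℝ) i • x i := by
  rw [Fin.sum_univ_succ]
  simp only [Fin.cons_zero, Fin.cons_succ, param, smul_sub, Finset.sum_sub_distrib, sub_smul,
    one_smul, Finset.sum_smul]
  abel

theorem sum_cons_one_sub (y : Fin m → ℝ) :
    ∑ i, (Fin.cons (1 - ∑ l, y l) y : Fin (m + 1) → ℝ) i = 1 := by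
  rw [Fin.sum_univ_succ]; simp

theorem edgeMap_injective {x : Fin (m + 1) → Pt d} (hx : AffineIndependent ℝ x) :
    Function.Injective (edgeMap x) := by
  rw [← LinearMap.ker_eq_bot, LinearMap.ker_eq_bot']
  intro y hy
  have h := (affineIndependent_iff_linearIndependent_vsub ℝ x 0).1 hx
  have h2 : LinearIndependent ℝ fun l : Fin m => x l.succ - x 0 :=
    h.comp (fun l : Fin m => (⟨l.succ, Fin.succ_ne_zero l⟩ : {i : Fin (m + 1) // i ≠ 0}))
      fun a b hab => by simpa using hab
  ext l
  exact Fintype.linearIndependent_iff.1 h2 y hy l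

theorem param_injective {x : Fin (m + 1) → Pt d} (hx : AffineIndependent ℝ x) :
    Function.Injective (param x) := fun y z h => by
  rw [param_eq, param_eq, add_right_inj] at h
  exact WithLp.toLp_injective 2 (edgeMap_injective hx h)

theorem contDiff_param {k : WithTop ℕ∞} (x : Fin (m + 1) → Pt d) : ContDiff ℝ k (param x) := by
  unfold param
  exact contDiff_const.add (ContDiff.sum fun l _ => (contDiff_apply ℝ ℝ l).smul contDiff_const)

theorem continuous_param (x : Fin (m + 1) → Pt d) : Continuous (param x) :=
  (contDiff_param (k := 0) x).continuous

theorem fderiv_param_single (x : Fin (m + 1) → Pt d) (y : Fin m → ℝ) (l : Fin m) :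
    fderiv ℝ (param x) y (Pi.single l 1) = x l.succ - x 0 := by
  have h : HasFDerivAt (param x) (∑ l : Fin m,
      (ContinuousLinearMap.proj (R := ℝ) (φ := fun _ : Fin m => ℝ) l).smulRight
        (x l.succ - x 0)) y := by
    unfold param
    refine HasFDerivAt.const_add _ (HasFDerivAt.fun_sum fun l _ => ?_)
    exact ((ContinuousLinearMap.proj (R := ℝ) (φ := fun _ : Fin m => ℝ) l).smulRight
      (x l.succ - x 0)).hasFDerivAt
  rw [h.fderiv]
  simp [Pi.single_apply]

theorem measurableEmbedding_param {x : Fin (m + 1) → Pt d} (hx : AffineIndependent ℝ x) :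
    MeasurableEmbedding (param x) := by
  have h1 : MeasurableEmbedding (edgeMap x) :=
    (LinearMap.isClosedEmbedding_of_injective
      (LinearMap.ker_eq_bot.2 (edgeMap_injective hx))).measurableEmbedding
  have h2 : MeasurableEmbedding (WithLp.toLp 2 : (Fin m → ℝ) → EuclideanSpace ℝ (Fin m)) :=
    (MeasurableEquiv.toLp 2 (Fin m → ℝ)).measurableEmbedding
  exact (measurableEmbedding_addLeft (x 0)).comp (h1.comp h2)

theorem param_preimage_convexHull {x : Fin (m + 1) → Pt d} (hx : AffineIndependent ℝ x) :
    param x ⁻¹' convexHull ℝ (Set.range x) = corner m := by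
  have hsub : convexHull ℝ (Set.range x) ⊆ param x '' corner m := by
    refine convexHull_min ?_ ?_
    · rintro _ ⟨i, rfl⟩
      refine Fin.cases ?_ (fun j => ?_) i
      · exact ⟨0, ⟨fun _ => le_rfl, by simp⟩, by simp [param]⟩
      · refine ⟨Pi.single j 1, ⟨fun l => ?_, by simp⟩, ?_⟩
        · rw [Pi.single_apply]; split_ifs <;> norm_num
        · simp [param, Pi.single_apply]
    · rintro _ ⟨y, hy, rfl⟩ _ ⟨z, hz, rfl⟩ a b ha hb hab
      refine ⟨a • y + b • z, ⟨fun i => ?_, ?_⟩, ?_⟩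
      · have := hy.1 i; have := hz.1 i
        simp only [Pi.add_apply, Pi.smul_apply, smul_eq_mul]; positivity
      · simp only [Pi.add_apply, Pi.smul_apply, smul_eq_mul, Finset.sum_add_distrib,
          ← Finset.mul_sum]
        nlinarith [hy.2, hz.2]
      · have h1 : x 0 = a • x 0 + b • x 0 := by rw [← add_smul, hab, one_smul]
        have h2 : ∀ y z : Fin m → ℝ, (WithLp.toLp 2 (a • y + b • z) : EuclideanSpace ℝ (Fin m)) =
          a • WithLp.toLp 2 y + b • WithLp.toLp 2 z := fun y z => rfl
        rw [param_eq, param_eq, param_eq, h2, map_add, map_smul, map_smul]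
        conv_lhs => rw [h1]
        module
  ext y
  constructor
  · intro hy
    obtain ⟨z, hz, hzy⟩ := hsub hy
    rwa [← param_injective hx hzy]
  · intro hy
    rw [Set.mem_preimage, param_eq_sum]
    refine (convex_convexHull ℝ _).sum_mem (fun i _ => ?_) ?_
      fun i _ => subset_convexHull _ _ ⟨i, rfl⟩
    · refine Fin.cases ?_ (fun j => ?_) i
      · simpa using hy.2
      · simpa using hy.1 j
    · rw [Fin.sum_univ_succ]; simp

theorem convexHull_subset_range_param {x : Fin (m + 1) → Pt d} :
    convexHull ℝ (Set.range x) ⊆ Set.range (param x) := by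
  refine convexHull_min ?_ ?_
  · rintro _ ⟨i, rfl⟩
    refine Fin.cases ?_ (fun j => ?_) i
    · exact ⟨0, by simp [param]⟩
    · exact ⟨Pi.single j 1, by simp [param, Pi.single_apply]⟩
  · rintro _ ⟨y, rfl⟩ _ ⟨z, rfl⟩ a b ha hb hab
    refine ⟨a • y + b • z, ?_⟩
    have h1 : x 0 = a • x 0 + b • x 0 := by rw [← add_smul, hab, one_smul]
    have h2 : ∀ y z : Fin m → ℝ, (WithLp.toLp 2 (a • y + b • z) : EuclideanSpace ℝ (Fin m)) =
      a • WithLp.toLp 2 y + b • WithLp.toLp 2 z := fun y z => rfl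
    rw [param_eq, param_eq, param_eq, h2, map_add, map_smul, map_smul]
    conv_lhs => rw [h1]
    module

-- An injective affine map multiplies measure by the determinant of its linear part, with Hausdorff
-- measure on the image. Integrals over bodies and over facets thereby both reduce to the corner
-- simplex.
open scoped Pointwise in
theorem map_param {x : Fin (m + 1) → Pt d} (hx : AffineIndependent ℝ x) :
    Measure.map (param x) (ENNReal.ofReal (edgeMap x).normDet • volume) =
      (μHE[m]).restrict (Set.range (param x)) := by
  have hemb := measurableEmbedding_param hx
  ext S hS
  rw [Measure.map_apply hemb.measurable hS, Measure.restrict_apply hS,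
    ← Set.image_preimage_eq_inter_range, Measure.smul_apply, smul_eq_mul]
  have h1 : param x '' (param x ⁻¹' S) =
      x 0 +ᵥ (edgeMap x '' (WithLp.toLp 2 '' (param x ⁻¹' S))) := by
    rw [Set.image_image, ← Set.image_vadd, Set.image_image]
    rfl
  have h2 := LinearMap.euclideanHausdorffMeasure_image_eq_normDet_mul_volume (edgeMap x)
    (WithLp.toLp 2 '' (param x ⁻¹' S))
  rw [finrank_euclideanSpace_fin] at h2
  rw [h1, measure_vadd, h2]
  congr 1
  have h3 := (EuclideanSpace.volume_preserving_symm_measurableEquiv_toLp (Fin m))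
    |>.symm.measure_preimage_equiv (WithLp.toLp 2 '' (param x ⁻¹' S))
  rw [← h3]
  congr 1
  ext y
  simp only [Set.mem_preimage]
  constructor
  · intro hy; exact ⟨y, hy, rfl⟩
  · rintro ⟨z, hz, hzy⟩
    rwa [← WithLp.toLp_injective 2 hzy]

theorem normDet_edgeMap_pos {x : Fin (m + 1) → Pt d} (hx : AffineIndependent ℝ x) :
    0 < (edgeMap x).normDet := by
  refine lt_of_le_of_ne (LinearMap.normDet_nonneg _) (Ne.symm ?_)
  rw [Ne, LinearMap.normDet_eq_zero_iff_ker_ne_bot, not_not]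
  exact LinearMap.ker_eq_bot.2 (edgeMap_injective hx)

theorem measure_convexHull {x : Fin (m + 1) → Pt d} (hx : AffineIndependent ℝ x) :
    μHE[m] (convexHull ℝ (Set.range x)) =
      ENNReal.ofReal (edgeMap x).normDet * volume (corner m) := by
  have h := congrArg (fun μ => μ (convexHull ℝ (Set.range x))) (map_param hx)
  simp only at h
  have hm : MeasurableSet (convexHull ℝ (Set.range x)) :=
    ((Set.finite_range x).isCompact_convexHull ℝ).isClosed.measurableSet
  rw [Measure.map_apply (measurableEmbedding_param hx).measurable hm, Measure.restrict_apply hm,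
    Set.inter_eq_left.2 convexHull_subset_range_param, param_preimage_convexHull hx,
    Measure.smul_apply, smul_eq_mul] at h
  exact h.symm

theorem measure_convexHull_lt_top {x : Fin (m + 1) → Pt d} (hx : AffineIndependent ℝ x) :
    μHE[m] (convexHull ℝ (Set.range x)) < ⊤ := by
  rw [measure_convexHull hx]
  exact ENNReal.mul_lt_top ENNReal.ofReal_lt_top (isCompact_corner m).measure_lt_top

theorem measureReal_convexHull {x : Fin (m + 1) → Pt d} (hx : AffineIndependent ℝ x) :
    (μHE[m]).real (convexHull ℝ (Set.range x)) =
      (edgeMap x).normDet * volume.real (corner m) := by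
  rw [Measure.real, measure_convexHull hx, ENNReal.toReal_mul,
    ENNReal.toReal_ofReal (LinearMap.normDet_nonneg _), Measure.real]

theorem setIntegral_convexHull {x : Fin (m + 1) → Pt d} (hx : AffineIndependent ℝ x)
    (f : Pt d → ℝ) :
    ∫ z in convexHull ℝ (Set.range x), f z ∂μHE[m] =
      (edgeMap x).normDet * ∫ y in corner m, f (param x y) := by
  have hm : MeasurableSet (convexHull ℝ (Set.range x)) :=
    ((Set.finite_range x).isCompact_convexHull ℝ).isClosed.measurableSet
  rw [← Set.inter_eq_left.2 (convexHull_subset_range_param (x := x)),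
    ← Measure.restrict_restrict hm, ← map_param hx,
    (measurableEmbedding_param hx).setIntegral_map, param_preimage_convexHull hx,
    Measure.restrict_smul, integral_smul_measure,
    ENNReal.toReal_ofReal (LinearMap.normDet_nonneg _), smul_eq_mul]

end Parametrization

end WG
end

noncomputable section

namespace WG

/-! ### Volumes, facet areas and the divergence theorem on a simplex -/

section SimplexMeasure

variable {n : ℕ} (s : Affine.Simplex ℝ (Pt (n + 1)) (n + 1))

/-- The volume of a simplex. -/
def bvol : ℝ := volume.real (body s)

/-- The area of a facet of a simplex. -/
def area (a : Fin (n + 1 + 1)) : ℝ := (μHE[n]).real (facet s a)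

theorem measurableSet_body : MeasurableSet (body s) := (isCompact_body s).isClosed.measurableSet

theorem measurableSet_facet (a : Fin (n + 1 + 1)) : MeasurableSet (facet s a) :=
  (isCompact_facet s a).isClosed.measurableSet

theorem euclideanHausdorffMeasure_top :
    (μHE[n + 1] : Measure (Pt (n + 1))) = volume :=
  EuclideanSpace.euclideanHausdorffMeasure_eq_volume (n + 1)

/-- The permutation allows any two vertices to be put first, so that a derivative along an edge
becomes a derivative in the first coordinate of the corner simplex. -/
theorem facet_perm (σ : Equiv.Perm (Fin (n + 1 + 1))) (c : Fin (n + 1 + 1)) :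
    facet s (σ c) = convexHull ℝ (Set.range (s.points ∘ σ ∘ c.succAbove)) := by
  rw [facet, facetVertices, Set.range_comp, Set.range_comp, Fin.range_succAbove,
    Set.image_compl_eq σ.bijective, Set.image_singleton]

theorem body_perm (σ : Equiv.Perm (Fin (n + 1 + 1))) :
    body s = convexHull ℝ (Set.range (s.points ∘ σ)) := by
  rw [body, EquivLike.range_comp]

theorem affineIndependent_perm (σ : Equiv.Perm (Fin (n + 1 + 1))) :
    AffineIndependent ℝ (s.points ∘ σ) :=
  s.independent.comp_embedding σ.toEmbedding

theorem affineIndependent_facet (σ : Equiv.Perm (Fin (n + 1 + 1))) (c : Fin (n + 1 + 1)) :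
    AffineIndependent ℝ (s.points ∘ σ ∘ c.succAbove) :=
  (affineIndependent_perm s σ).comp_embedding ⟨_, Fin.succAbove_right_injective⟩

theorem measure_facet_lt_top (a : Fin (n + 1 + 1)) : μHE[n] (facet s a) < ⊤ := by
  have := facet_perm s (Equiv.refl _) a
  rw [Equiv.refl_apply] at this
  rw [this]
  exact measure_convexHull_lt_top (affineIndependent_facet s (Equiv.refl _) a)

theorem area_pos (a : Fin (n + 1 + 1)) : 0 < area s a := by
  have := facet_perm s (Equiv.refl _) a
  rw [Equiv.refl_apply] at this
  rw [area, this, measureReal_convexHull (affineIndependent_facet s (Equiv.refl _) a)]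
  exact mul_pos (normDet_edgeMap_pos (affineIndependent_facet s (Equiv.refl _) a))
    (volume_corner_pos n)

theorem bvol_pos : 0 < bvol s := by
  rw [bvol, Measure.real, ENNReal.toReal_pos_iff]
  exact ⟨(isOpen_interior.measure_pos volume (interior_body_nonempty s)).trans_le
    (measure_mono interior_subset), (isCompact_body s).measure_lt_top⟩

theorem setIntegral_facet (σ : Equiv.Perm (Fin (n + 1 + 1))) (c : Fin (n + 1 + 1))
    (f : Pt (n + 1) → ℝ) :
    ∫ x in facet s (σ c), f x ∂μHE[n] = area s (σ c) / volume.real (corner n) *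
      ∫ y in corner n, f (param (s.points ∘ σ ∘ c.succAbove) y) := by
  have h := affineIndependent_facet s σ c
  rw [area, facet_perm, setIntegral_convexHull h, measureReal_convexHull h,
    mul_div_cancel_right₀ _ (volume_corner_pos n).ne']

theorem setIntegral_body (σ : Equiv.Perm (Fin (n + 1 + 1))) (f : Pt (n + 1) → ℝ) :
    ∫ x in body s, f x = bvol s / volume.real (corner (n + 1)) *
      ∫ y in corner (n + 1), f (param (s.points ∘ σ) y) := by
  have h := affineIndependent_perm s σ
  rw [bvol, body_perm s σ, ← euclideanHausdorffMeasure_top, setIntegral_convexHull h,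
    measureReal_convexHull h, mul_div_cancel_right₀ _ (volume_corner_pos _).ne']

theorem integrableOn_body {f : Pt (n + 1) → ℝ} (hf : Continuous f) :
    IntegrableOn f (body s) := hf.continuousOn.integrableOn_compact (isCompact_body s)

theorem integrableOn_facet (a : Fin (n + 1 + 1)) {f : Pt (n + 1) → ℝ} (hf : Continuous f) :
    IntegrableOn f (facet s a) μHE[n] := by
  obtain ⟨C, hC⟩ := (isCompact_facet s a).exists_bound_of_continuousOn hf.continuousOn
  refine IntegrableOn.of_bound (measure_facet_lt_top s a)
    hf.aestronglyMeasurable C ?_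
  exact (ae_restrict_iff' (measurableSet_facet s a)).2 (Filter.Eventually.of_forall hC)

/-- Integration of an edge derivative, up to normalization. -/
theorem setIntegral_body_edge_aux {f : Pt (n + 1) → ℝ} (hf : ContDiff ℝ 1 f)
    {a b : Fin (n + 1 + 1)} (hab : a ≠ b) :
    ∫ x in body s, fderiv ℝ f x (s.points b - s.points a) =
      volume.real (corner n) / volume.real (corner (n + 1)) * bvol s *
        ((area s a)⁻¹ * (∫ x in facet s a, f x ∂μHE[n]) -
          (area s b)⁻¹ * ∫ x in facet s b, f x ∂μHE[n]) := by
  -- Vertex `b` becomes the origin of the parametrization and `a` the end of its first axis.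
  obtain ⟨σ, hσ0, hσ1⟩ : ∃ σ : Equiv.Perm (Fin (n + 1 + 1)), σ 0 = b ∧ σ 1 = a := by
    refine ⟨Equiv.swap 1 (Equiv.swap 0 b a) |>.trans (Equiv.swap 0 b), ?_, ?_⟩
    · have h1 : (0 : Fin (n + 1 + 1)) ≠ Equiv.swap 0 b a := by
        intro h
        have := congrArg (Equiv.swap 0 b) h
        rw [Equiv.swap_apply_left, Equiv.swap_apply_self] at this
        exact hab this.symm
      rw [Equiv.trans_apply, Equiv.swap_apply_of_ne_of_ne (by simp) h1, Equiv.swap_apply_left]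
    · simp
  set x := s.points ∘ σ with hx
  set G : (Fin (n + 1) → ℝ) → ℝ := fun y => f (param x y) with hG
  have hGc : ContDiff ℝ 1 G := hf.comp (contDiff_param x)
  have hder : ∀ y, fderiv ℝ G y (Pi.single 0 1) =
      -fderiv ℝ f (param x y) (s.points b - s.points a) := by
    intro y
    have h1 : fderiv ℝ G y = (fderiv ℝ f (param x y)).comp (fderiv ℝ (param x) y) :=
      fderiv_comp y ((hf.differentiable (by simp)) _)
        (((contDiff_param (k := 1) x).differentiable (by simp)) y)
    rw [h1, ContinuousLinearMap.comp_apply, fderiv_param_single, ← map_neg, neg_sub]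
    simp [hx, hσ0, hσ1]
  -- The endpoint `0` gives weight zero to the vertex `a`, hence the facet opposite to `a`; the
  -- other endpoint removes the weight of `b`.
  have hFa : ∀ y : Fin n → ℝ, G (Fin.cons 0 y) =
      f (param (s.points ∘ σ ∘ (1 : Fin (n + 1 + 1)).succAbove) y) := by
    intro y
    simp only [hG]
    congr 1
    simp only [param, Fin.sum_univ_succ, Fin.cons_zero, Fin.cons_succ, zero_smul, zero_add, hx,
      Function.comp_apply]
    have h0 : (1 : Fin (n + 1 + 1)).succAbove 0 = 0 := by
      rw [Fin.succAbove_of_castSucc_lt _ _ (by simp)]; rfl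
    have h1 : ∀ l : Fin n, (1 : Fin (n + 1 + 1)).succAbove l.succ = l.succ.succ := fun l => by
      rw [Fin.succAbove_of_le_castSucc]
      simp [Fin.le_def]
    simp only [h0, h1]
  have hFb : ∀ y : Fin n → ℝ, G (Fin.cons (1 - ∑ i, y i) y) =
      f (param (s.points ∘ σ ∘ (0 : Fin (n + 1 + 1)).succAbove) y) := by
    intro y
    simp only [hG]
    congr 1
    simp only [param, Fin.sum_univ_succ, Fin.cons_zero, Fin.cons_succ, hx, Function.comp_apply,
      Fin.succAbove_zero, smul_sub, sub_smul, one_smul, Finset.sum_sub_distrib, Finset.sum_smul]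
    abel
  have hcn := (volume_corner_pos n).ne'
  have hIa := setIntegral_facet s σ 1 f
  have hIb := setIntegral_facet s σ 0 f
  rw [hσ1] at hIa
  rw [hσ0] at hIb
  have hintg : ∀ z : Fin (n + 1) → Pt (n + 1),
      IntegrableOn (fun y => f (param z y)) (corner n) := fun z =>
    (hf.continuous.comp (continuous_param z)).continuousOn.integrableOn_compact (isCompact_corner n)
  have key := integral_corner_fderiv hGc
  simp only [hder, hFa, hFb] at key
  rw [integral_neg, integral_sub (hintg _) (hintg _)] at key
  rw [setIntegral_body s σ, hIa, hIb]
  have ha := (area_pos s a).ne'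
  have hb := (area_pos s b).ne'
  have key' := (neg_eq_iff_eq_neg.1 key).trans (neg_sub _ _)
  rw [key']
  field_simp

/-- The ratio is read off from the edge formula itself. With `f = λ_a` along the edge from `a` to
`0` it says that the ratio times the mean of `λ_a` over facet `0` is `1`, for each of the `n + 1`
vertices `a ≠ 0`; these means add up to `1`. -/
theorem corner_ratio (s : Affine.Simplex ℝ (Pt (n + 1)) (n + 1)) :
    volume.real (corner n) / volume.real (corner (n + 1)) = n + 1 := by
  classical
  set κ := volume.real (corner n) / volume.real (corner (n + 1)) with hκ
  have hv := (bvol_pos s).ne'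
  have hb := (area_pos s 0).ne'
  have h : ∀ a : Fin (n + 1 + 1), a ≠ 0 →
      κ * ((area s 0)⁻¹ * ∫ x in facet s 0, bc s a x ∂μHE[n]) = 1 := by
    intro a ha
    have h1 := setIntegral_body_edge_aux s
      (contDiff_of_mem_polySpace (bc_mem_polySpace s a)) ha
    have h2 : ∫ x in facet s a, bc s a x ∂μHE[n] = 0 := by
      rw [setIntegral_congr_fun (g := fun _ => (0 : ℝ)) (measurableSet_facet s a)
        (fun x hx => ((mem_facet s).1 hx).1)]
      simp
    simp only [fderiv_bc_sub, bc_points_self, bc_points s a 0, if_neg ha, h2] at h1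
    rw [setIntegral_const, smul_eq_mul] at h1
    change bvol s * (0 - 1) = _ at h1
    have h3 : bvol s * (κ * ((area s 0)⁻¹ * ∫ x in facet s 0, bc s a x ∂μHE[n])) = bvol s * 1 := by
      linarith
    exact mul_left_cancel₀ hv h3
  have hsum : ∑ a ∈ Finset.univ.erase 0, ∫ x in facet s 0, bc s a x ∂μHE[n] = area s 0 := by
    rw [← integral_finsetSum _ fun a _ => integrableOn_facet s 0 (continuous_bc s a)]
    rw [setIntegral_congr_fun (g := fun _ => (1 : ℝ)) (measurableSet_facet s 0)]
    · simp [area]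
    · intro x hx
      have h1 := sum_bc s x
      rw [← Finset.add_sum_erase _ _ (Finset.mem_univ 0), ((mem_facet s).1 hx).1, zero_add] at h1
      exact h1
  have h4 := Finset.sum_congr rfl fun a (ha : a ∈ Finset.univ.erase 0) =>
    h a (Finset.ne_of_mem_erase ha)
  rw [← Finset.mul_sum, ← Finset.mul_sum, hsum, inv_mul_cancel₀ hb, mul_one] at h4
  rw [h4]
  simp [Finset.card_erase_of_mem]

/-- The hyperplane at distance `t · ht` from the vertex is the level set `λ_a = 1 - t`, so it cuts
out the facet shrunk by `t` towards the vertex. The excluded value `t = 0` is a null set of slices.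
-/
theorem body_inter_slice (a : Fin (n + 1 + 1)) {t : ℝ} (ht0 : t ≠ 0) :
    body s ∩ AffineSubspace.mk' (t • (ht s a • outwardNormal s a) +ᵥ s.points a)
      (Submodule.span ℝ {ht s a • outwardNormal s a})ᗮ =
      if t ∈ Set.Ioc (0 : ℝ) 1 then AffineMap.homothety (s.points a) t '' facet s a else ∅ := by
  have hpos := ht_pos s a
  have hmem : ∀ y, y ∈ AffineSubspace.mk' (t • (ht s a • outwardNormal s a) +ᵥ s.points a)
      (Submodule.span ℝ {ht s a • outwardNormal s a})ᗮ ↔ bc s a y = 1 - t := by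
    intro y
    rw [AffineSubspace.mem_mk', Submodule.mem_orthogonal_singleton_iff_inner_right,
      vsub_eq_sub, vadd_eq_add, sub_add_eq_sub_sub_swap, inner_sub_right, real_inner_smul_left,
      inner_outwardNormal_sub_vertex, real_inner_smul_right, real_inner_self_eq_norm_sq,
      norm_smul, norm_outwardNormal, Real.norm_of_nonneg hpos.le, sub_eq_zero]
    constructor
    · intro h
      have : ht s a ^ 2 * (1 - bc s a y) = ht s a ^ 2 * t := by linarith
      have := mul_left_cancel₀ (by positivity) this
      linarith
    · intro h
      rw [h]; ring
  ext y
  rw [Set.mem_inter_iff, SetLike.mem_coe, hmem, mem_body]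
  constructor
  · rintro ⟨h1, h2⟩
    have h3 := bc_le_one s ((mem_body s).2 h1) a
    have h4 := h1 a
    have hI : t ∈ Set.Ioc (0 : ℝ) 1 := ⟨lt_of_le_of_ne (by linarith) (Ne.symm ht0), by linarith⟩
    rw [if_pos hI]
    refine ⟨s.points a + t⁻¹ • (y - s.points a), (mem_facet s).2 ⟨?_, fun b => ?_⟩, ?_⟩
    · rw [bc_lineMap, bc_points_self, h2]; field_simp; ring
    · have h5 := hI.1
      by_cases hb : b = a
      · subst hb; rw [bc_lineMap, bc_points_self, h2]; field_simp; ring_nf; rfl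
      · rw [bc_lineMap, bc_points, if_neg hb, mul_zero, zero_add]
        have := h1 b
        positivity
    · rw [AffineMap.homothety_apply]
      simp [smul_smul, mul_inv_cancel₀ ht0]
  · intro hy
    split_ifs at hy with hI
    · obtain ⟨z, hz, rfl⟩ := hy
      have h0 : AffineMap.homothety (s.points a) t z = s.points a + t • (z - s.points a) := by
        rw [AffineMap.homothety_apply]; simp [add_comm]
      obtain ⟨hz1, hz2⟩ := (mem_facet s).1 hz
      rw [h0]
      refine ⟨fun b => ?_, ?_⟩
      · rw [bc_lineMap, bc_points]
        have := hz2 b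
        have := hI.1
        have h6 : 0 ≤ 1 - t := by linarith [hI.2]
        split_ifs <;> positivity
      · rw [bc_lineMap, bc_points_self, hz1]; ring
    · exact hy.elim

/-- The volume of a simplex in terms of a facet and the height over it. -/
theorem ht_mul_area (a : Fin (n + 1 + 1)) : ht s a * area s a = (n + 1) * bvol s := by
  have hpos := ht_pos s a
  have hne : ht s a • outwardNormal s a ≠ 0 := by
    rw [← norm_ne_zero_iff, norm_smul, norm_outwardNormal, Real.norm_of_nonneg hpos.le]
    simpa using hpos.ne'
  have h := EuclideanGeometry.euclideanHausdorffMeasure_eq_lintegral (s.points a) hne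
    (measurableSet_body s)
  rw [finrank_euclideanSpace_fin, euclideanHausdorffMeasure_top, Nat.add_sub_cancel] at h
  -- A slice has `t ^ n` times the area of the facet; integrating over `t` yields the factor `1 / (n
  -- + 1)`.
  have h2 : ∫⁻ t : ℝ, μHE[n] (body s ∩ AffineSubspace.mk'
      (t • (ht s a • outwardNormal s a) +ᵥ s.points a)
      (Submodule.span ℝ {ht s a • outwardNormal s a})ᗮ) =
      ∫⁻ t in Set.Ioc (0 : ℝ) 1, ENNReal.ofReal (t ^ n) * μHE[n] (facet s a) := by
    rw [← lintegral_indicator measurableSet_Ioc]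
    refine lintegral_congr_ae ?_
    filter_upwards [Measure.ae_ne volume (0 : ℝ)] with t ht0
    rw [body_inter_slice s a ht0]
    split_ifs with hI
    · rw [Set.indicator_of_mem hI, euclideanHausdorffMeasure_homothety_image n _ ht0,
        ENNReal.ofReal_pow hI.1.le, ENNReal.smul_def, smul_eq_mul, ENNReal.coe_pow,
        ← enorm_eq_nnnorm, Real.enorm_of_nonneg hI.1.le]
    · rw [Set.indicator_of_notMem hI, measure_empty]
  have h3 : ∫⁻ t in Set.Ioc (0 : ℝ) 1, ENNReal.ofReal (t ^ n) =
      ENNReal.ofReal ((n + 1 : ℝ)⁻¹) := by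
    rw [← ofReal_integral_eq_lintegral_ofReal]
    · rw [← intervalIntegral.integral_of_le zero_le_one, integral_pow]
      simp
    · exact (continuous_pow n).integrableOn_Ioc
    · exact (ae_restrict_iff' measurableSet_Ioc).2 (Filter.Eventually.of_forall fun t ht =>
        pow_nonneg ht.1.le n)
  rw [h2, lintegral_mul_const _ (by fun_prop), h3] at h
  have h4 := congrArg ENNReal.toReal h
  rw [ENNReal.toReal_mul, ENNReal.toReal_mul, ENNReal.toReal_ofReal (by positivity),
    toReal_enorm, norm_smul, norm_outwardNormal, Real.norm_of_nonneg hpos.le, mul_one] at h4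
  rw [bvol, area, Measure.real, Measure.real, h4]
  field_simp

/-- The normalizing factor `(n + 1) · bvol / area` of the auxiliary formula is the height over the
facet. -/
theorem setIntegral_body_edge {f : Pt (n + 1) → ℝ} (hf : ContDiff ℝ 1 f)
    {a b : Fin (n + 1 + 1)} (hab : a ≠ b) :
    ∫ x in body s, fderiv ℝ f x (s.points b - s.points a) =
      ht s a * (∫ x in facet s a, f x ∂μHE[n]) - ht s b * ∫ x in facet s b, f x ∂μHE[n] := by
  rw [setIntegral_body_edge_aux s hf hab, corner_ratio s, mul_sub]
  have ha := (area_pos s a).ne'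
  have hb := (area_pos s b).ne'
  conv_lhs => enter [1]; rw [← ht_mul_area s a]
  conv_lhs => enter [2]; rw [← ht_mul_area s b]
  field_simp

/-- The divergence theorem on a simplex. -/
theorem setIntegral_body_fderiv {f : Pt (n + 1) → ℝ} (hf : ContDiff ℝ 1 f) (u : Pt (n + 1)) :
    ∫ x in body s, fderiv ℝ f x u =
      ∑ a, inner ℝ u (outwardNormal s a) * ∫ x in facet s a, f x ∂μHE[n] := by
  classical
  -- Both sides are linear in `u`, and every direction is a combination of the edges leaving vertex
  -- `0`.
  have hu : u = ∑ b, fderiv ℝ (bc s b) 0 u • (s.points b - s.points 0) := by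
    have h1 := sum_bc_smul_sub s u (s.points 0)
    have h2 := sum_bc_smul_sub s 0 (s.points 0)
    have h3 : ∀ b, fderiv ℝ (bc s b) 0 u = bc s b u - bc s b 0 := fun b => by
      rw [← fderiv_bc_sub s b 0, sub_zero]
    simp only [h3, sub_smul, Finset.sum_sub_distrib, h1, h2]
    abel
  have hintg : ∀ v : Pt (n + 1), IntegrableOn (fun x => fderiv ℝ f x v) (body s) := fun v =>
    integrableOn_body s ((hf.continuous_fderiv (by simp)).clm_apply continuous_const)
  have hedge : ∀ b, ∫ x in body s, fderiv ℝ f x (s.points b - s.points 0) =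
      ∑ a, inner ℝ (s.points b - s.points 0) (outwardNormal s a) *
        ∫ x in facet s a, f x ∂μHE[n] := by
    intro b
    by_cases hb : b = 0
    · simp [hb]
    · rw [setIntegral_body_edge s hf (Ne.symm hb)]
      simp only [inner_edge_outwardNormal, mul_sub, sub_mul, Finset.sum_sub_distrib]
      simp
  conv_lhs => rw [hu]
  simp only [map_sum, map_smul, smul_eq_mul]
  rw [integral_finsetSum _ fun b _ => (hintg _).const_mul _]
  simp only [integral_const_mul, hedge, Finset.mul_sum]
  rw [Finset.sum_comm]
  refine Finset.sum_congr rfl fun a _ => ?_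
  conv_rhs => rw [hu]
  rw [sum_inner, Finset.sum_mul]
  exact Finset.sum_congr rfl fun b _ => by rw [real_inner_smul_left]; ring

end SimplexMeasure

end WG
end

noncomputable section

namespace WG

/-! ### Green's formula for polynomial fields -/

section Green

variable {n : ℕ} (s : Affine.Simplex ℝ (Pt (n + 1)) (n + 1))

/-- Green's formula on a simplex: `r` is the divergence of the field `q`. -/
structure Green (q : Pt (n + 1) → Pt (n + 1)) (r : Pt (n + 1) → ℝ) : Prop where
  continuous_field : Continuous q
  continuous_div : Continuous r
  formula : ∀ φ : Pt (n + 1) → ℝ, ContDiff ℝ 1 φ →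
    (∫ x in body s, fderiv ℝ φ x (q x)) + ∫ x in body s, r x * φ x =
      ∑ a, ∫ x in facet s a, φ x * inner ℝ (q x) (outwardNormal s a) ∂μHE[n]

variable {s}

theorem continuous_fderiv_apply {φ : Pt (n + 1) → ℝ} (hφ : ContDiff ℝ 1 φ)
    {q : Pt (n + 1) → Pt (n + 1)} (hq : Continuous q) : Continuous fun x => fderiv ℝ φ x (q x) :=
  (hφ.continuous_fderiv (by simp)).clm_apply hq

/-- The divergence theorem for the product `φ f` in the fixed direction `u`; every field used later
is a sum of such terms. -/
theorem Green.of_smul {f : Pt (n + 1) → ℝ} (hf : ContDiff ℝ 1 f) (u : Pt (n + 1)) :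
    Green s (fun x => f x • u) (fun x => fderiv ℝ f x u) where
  continuous_field := hf.continuous.smul continuous_const
  continuous_div := continuous_fderiv_apply hf continuous_const
  formula φ hφ := by
    have h := setIntegral_body_fderiv s (hφ.mul hf) u
    have h1 : ∀ x, fderiv ℝ (fun x => φ x * f x) x u =
        fderiv ℝ φ x (f x • u) + fderiv ℝ f x u * φ x := by
      intro x
      rw [fderiv_fun_mul ((hφ.differentiable (by simp)) x) ((hf.differentiable (by simp)) x)]
      simp only [add_apply, smul_apply, smul_eq_mul, map_smul]
      ring
    simp only [h1] at h
    rw [integral_add (integrableOn_body s (continuous_fderiv_apply (q := fun x => f x • u) hφ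
      (hf.continuous.smul continuous_const))) (integrableOn_body s
        (f := fun x => fderiv ℝ f x u * φ x)
        ((continuous_fderiv_apply hf continuous_const).mul hφ.continuous))] at h
    rw [h]
    refine Finset.sum_congr rfl fun a _ => ?_
    rw [← integral_const_mul]
    refine integral_congr_ae (Filter.Eventually.of_forall fun x => ?_)
    simp only [real_inner_smul_left]
    ring

theorem Green.zero : Green s (fun _ => 0) (fun _ => 0) where
  continuous_field := continuous_const
  continuous_div := continuous_const
  formula φ hφ := by simp

theorem Green.add {q q' : Pt (n + 1) → Pt (n + 1)} {r r' : Pt (n + 1) → ℝ} (h : Green s q r)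
    (h' : Green s q' r') : Green s (fun x => q x + q' x) (fun x => r x + r' x) where
  continuous_field := h.continuous_field.add h'.continuous_field
  continuous_div := h.continuous_div.add h'.continuous_div
  formula φ hφ := by
    have hc := hφ.continuous
    have c1 := h.continuous_field
    have c2 := h'.continuous_field
    have c3 := h.continuous_div
    have c4 := h'.continuous_div
    simp only [map_add, add_mul, inner_add_left, mul_add]
    rw [integral_add (integrableOn_body s (continuous_fderiv_apply hφ c1))
        (integrableOn_body s (continuous_fderiv_apply hφ c2)),
      integral_add (integrableOn_body s (f := fun x => r x * φ x) (c3.mul hc))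
        (integrableOn_body s (f := fun x => r' x * φ x) (c4.mul hc)),
      Finset.sum_congr rfl fun a _ => integral_add
        (integrableOn_facet s a (f := fun x => φ x * inner ℝ (q x) (outwardNormal s a))
          (hc.mul (c1.inner continuous_const)))
        (integrableOn_facet s a (f := fun x => φ x * inner ℝ (q' x) (outwardNormal s a))
          (hc.mul (c2.inner continuous_const))),
      Finset.sum_add_distrib, ← h.formula φ hφ, ← h'.formula φ hφ]
    ring

theorem Green.const_smul {q : Pt (n + 1) → Pt (n + 1)} {r : Pt (n + 1) → ℝ} (h : Green s q r)
    (c : ℝ) : Green s (fun x => c • q x) (fun x => c * r x) where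
  continuous_field := h.continuous_field.const_smul c
  continuous_div := h.continuous_div.const_mul c
  formula φ hφ := by
    simp only [map_smul, smul_eq_mul, mul_assoc, real_inner_smul_left, mul_left_comm _ c]
    simp only [integral_const_mul, ← Finset.mul_sum, ← h.formula φ hφ]
    ring

theorem Green.sum {ι : Type*} (t : Finset ι) {q : ι → Pt (n + 1) → Pt (n + 1)}
    {r : ι → Pt (n + 1) → ℝ} (h : ∀ i ∈ t, Green s (q i) (r i)) :
    Green s (fun x => ∑ i ∈ t, q i x) (fun x => ∑ i ∈ t, r i x) := by
  classical
  induction t using Finset.induction_on with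
  | empty => simpa using Green.zero
  | insert i t hi ih =>
    simp only [Finset.sum_insert hi]
    exact (h i (Finset.mem_insert_self i t)).add
      (ih fun j hj => h j (Finset.mem_insert_of_mem hj))

/-- Green's formula for polynomial fields. -/
theorem exists_green {m : ℕ} {q : Pt (n + 1) → Pt (n + 1)}
    (hq : ∀ l, (fun x => q x l) ∈ polySpace (n + 1) m) :
    ∃ r ∈ polySpace (n + 1) (m - 1), Green s q r := by
  refine ⟨fun x => ∑ l, fderiv ℝ (fun x => q x l) x (EuclideanSpace.basisFun _ ℝ l),
    sum_mem_polySpace _ fun l _ => fderiv_mem_polySpace (hq l) _, ?_⟩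
  have h := Green.sum (s := s) Finset.univ fun l _ =>
    Green.of_smul (contDiff_of_mem_polySpace (hq l)) (EuclideanSpace.basisFun _ ℝ l)
  convert h using 2 with x
  exact ((EuclideanSpace.basisFun (Fin (n + 1)) ℝ).sum_repr (q x)).symm

theorem Green.integral_div {q : Pt (n + 1) → Pt (n + 1)} {r : Pt (n + 1) → ℝ} (h : Green s q r) :
    ∫ x in body s, r x = ∑ a, ∫ x in facet s a, inner ℝ (q x) (outwardNormal s a) ∂μHE[n] := by
  have := h.formula (fun _ => 1) contDiff_const
  simpa using this

end Green

/-! ### Comparison of quadratic forms in finite dimension -/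

section FiniteDimensional

/-- The quotient of the two quadratic forms is homogeneous of degree zero and continuous on the unit
sphere, which is compact. -/
theorem exists_bound_of_posDef {E : Type*} [NormedAddCommGroup E] [NormedSpace ℝ E]
    [FiniteDimensional ℝ E] (B₁ B₂ : E →ₗ[ℝ] E →ₗ[ℝ] ℝ) (hpos : ∀ v, v ≠ 0 → 0 < B₂ v v) :
    ∃ C : ℝ, 0 < C ∧ ∀ v, B₁ v v ≤ C * B₂ v v := by
  have hc : ∀ B : E →ₗ[ℝ] E →ₗ[ℝ] ℝ, Continuous fun v => B v v := by
    intro B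
    have h1 : Continuous (LinearMap.toContinuousLinearMap (𝕜 := ℝ) (E := E) (F' := ℝ) ∘ B) :=
      LinearMap.continuous_of_finiteDimensional
        ((LinearMap.toContinuousLinearMap (𝕜 := ℝ) (E := E) (F' := ℝ)).toLinearMap.comp B)
    exact h1.clm_apply continuous_id
  have : ProperSpace E := FiniteDimensional.proper_real E
  have hS := isCompact_sphere (0 : E) 1
  have hq : ContinuousOn (fun v => B₁ v v / B₂ v v) (Metric.sphere (0 : E) 1) := by
    refine (hc B₁).continuousOn.div (hc B₂).continuousOn fun v hv => (hpos v ?_).ne'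
    rintro rfl
    simp at hv
  obtain ⟨C, hC⟩ := hS.exists_bound_of_continuousOn hq
  refine ⟨max C 1, by positivity, fun v => ?_⟩
  by_cases hv : v = 0
  · simp [hv]
  · have hvn : 0 < ‖v‖ := norm_pos_iff.2 hv
    have h1 := hC (‖v‖⁻¹ • v) (by simp [norm_smul, hvn.ne'])
    have h2 : B₁ (‖v‖⁻¹ • v) (‖v‖⁻¹ • v) / B₂ (‖v‖⁻¹ • v) (‖v‖⁻¹ • v) = B₁ v v / B₂ v v := by
      simp only [map_smul, LinearMap.smul_apply, smul_eq_mul]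
      have := (hpos v hv).ne'
      field_simp
    rw [h2] at h1
    have h3 : B₁ v v / B₂ v v ≤ max C 1 := ((le_abs_self _).trans h1).trans (le_max_left _ _)
    exact (div_le_iff₀ (hpos v hv)).1 h3

/-- On a finite-dimensional space every quadratic form is bounded by a positive semidefinite one,
modulo the kernel of the latter. -/
theorem exists_bound_mod_ker {V : Type*} [AddCommGroup V] [Module ℝ V] [FiniteDimensional ℝ V]
    (B₁ B₂ : V →ₗ[ℝ] V →ₗ[ℝ] ℝ) (hsymm : ∀ v w, B₂ v w = B₂ w v) (hnn : ∀ v, 0 ≤ B₂ v v) :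
    ∃ C : ℝ, 0 < C ∧ ∀ v, ∃ v', B₂ (v - v') (v - v') = 0 ∧ B₁ v' v' ≤ C * B₂ v v := by
  -- On a complement of its kernel the semidefinite form is definite, so the compactness bound
  -- applies there.
  obtain ⟨Y, hY⟩ := (LinearMap.ker B₂).exists_isCompl
  have hker : ∀ v, B₂ v v = 0 → v ∈ LinearMap.ker B₂ := by
    intro v hv
    rw [LinearMap.mem_ker]
    ext w
    rw [LinearMap.zero_apply]
    by_contra hne
    -- The form at `w + t v` equals `B₂ w w + 2 t B₂ v w`; this `t` makes it `-1`, contradicting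
    -- semidefiniteness.
    have h := hnn (w + (-(B₂ w w + 1) / (2 * B₂ v w)) • v)
    simp only [map_add, map_smul, LinearMap.add_apply, LinearMap.smul_apply, smul_eq_mul, hv,
      hsymm w v] at h
    have h2 : -(B₂ w w + 1) / (2 * B₂ v w) * B₂ v w = -(B₂ w w + 1) / 2 := by
      field_simp
    linarith
  let e := (Module.finBasis ℝ Y).equivFun
  let T : (Fin (Module.finrank ℝ Y) → ℝ) →ₗ[ℝ] V := Y.subtype.comp e.symm.toLinearMap
  obtain ⟨C, hC, h⟩ := exists_bound_of_posDef (B₁.compl₁₂ T T) (B₂.compl₁₂ T T) (by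
    intro c hc
    refine lt_of_le_of_ne (hnn _) fun h0 => hc ?_
    have h1 : T c ∈ LinearMap.ker B₂ := hker _ h0.symm
    have h2 : T c ∈ Y := (e.symm c).2
    have h3 : T c = 0 := (Submodule.disjoint_def.1 hY.disjoint) _ h1 h2
    have h4 : e.symm c = 0 := Subtype.ext h3
    simpa using h4)
  refine ⟨C, hC, fun v => ?_⟩
  obtain ⟨z, y, hz, hy, rfl⟩ := Submodule.codisjoint_iff_exists_add_eq.1 hY.codisjoint v
  refine ⟨y, ?_, ?_⟩
  · rw [add_sub_cancel_right, LinearMap.mem_ker.1 hz, LinearMap.zero_apply]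
  · have h1 := h (e ⟨y, hy⟩)
    have h2 : T (e ⟨y, hy⟩) = y := by simp [T]
    rw [LinearMap.compl₁₂_apply, LinearMap.compl₁₂_apply, h2] at h1
    have hz0 : B₂ z = 0 := LinearMap.mem_ker.1 hz
    have h3 : B₂ (z + y) (z + y) = B₂ y y := by
      simp only [map_add, LinearMap.add_apply, hz0, LinearMap.zero_apply, hsymm y z]
      ring
    rw [h3]
    exact h1

/-- The bilinear form `∫ wt (T v) (T w)`. -/
def weightedForm {V X : Type*} [AddCommGroup V] [Module ℝ V] [MeasurableSpace X]
    (μ : Measure X) (wt : X → ℝ) (T : V →ₗ[ℝ] (X → ℝ))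
    (hT : ∀ v w, Integrable (fun x => wt x * (T v x * T w x)) μ) : V →ₗ[ℝ] V →ₗ[ℝ] ℝ :=
  LinearMap.mk₂ ℝ (fun v w => ∫ x, wt x * (T v x * T w x) ∂μ)
    (fun v v' w => by
      rw [← integral_add (hT v w) (hT v' w)]
      exact integral_congr_ae (Filter.Eventually.of_forall fun x => by simp; ring))
    (fun c v w => by
      rw [smul_eq_mul, ← integral_const_mul]
      exact integral_congr_ae (Filter.Eventually.of_forall fun x => by simp; ring))
    (fun v w w' => by
      rw [← integral_add (hT v w) (hT v w')]
      exact integral_congr_ae (Filter.Eventually.of_forall fun x => by simp; ring))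
    (fun c v w => by
      rw [smul_eq_mul, ← integral_const_mul]
      exact integral_congr_ae (Filter.Eventually.of_forall fun x => by simp; ring))

theorem weightedForm_apply {V X : Type*} [AddCommGroup V] [Module ℝ V] [MeasurableSpace X]
    (μ : Measure X) (wt : X → ℝ) (T : V →ₗ[ℝ] (X → ℝ))
    (hT : ∀ v w, Integrable (fun x => wt x * (T v x * T w x)) μ) (v w : V) :
    weightedForm μ wt T hT v w = ∫ x, wt x * (T v x * T w x) ∂μ := rfl

theorem weightedForm_symm {V X : Type*} [AddCommGroup V] [Module ℝ V] [MeasurableSpace X]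
    (μ : Measure X) (wt : X → ℝ) (T : V →ₗ[ℝ] (X → ℝ))
    (hT : ∀ v w, Integrable (fun x => wt x * (T v x * T w x)) μ) (v w : V) :
    weightedForm μ wt T hT v w = weightedForm μ wt T hT w v := by
  simp only [weightedForm_apply, mul_comm (T v _)]

end FiniteDimensional

/-! ### Vanishing integrals of nonnegative functions -/

section Definiteness

variable {n : ℕ} (s : Affine.Simplex ℝ (Pt (n + 1)) (n + 1))

theorem convex_corner (m : ℕ) : Convex ℝ (corner m) := by
  rintro y hy z hz a b ha hb hab
  refine ⟨fun i => ?_, ?_⟩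
  · have := hy.1 i; have := hz.1 i
    simp only [Pi.add_apply, Pi.smul_apply, smul_eq_mul]; positivity
  · simp only [Pi.add_apply, Pi.smul_apply, smul_eq_mul, Finset.sum_add_distrib, ← Finset.mul_sum]
    nlinarith [hy.2, hz.2]

/-- Zero almost everywhere and continuity give zero on the interior, hence on its closure. The
interior is not empty: a convex set equal to its frontier would be null, while the corner has
positive volume. -/
theorem eqOn_zero_of_integral_corner_eq_zero {m : ℕ} {f : (Fin m → ℝ) → ℝ} (hf : Continuous f)
    (hnn : ∀ y ∈ corner m, 0 ≤ f y) (h : ∫ y in corner m, f y = 0) : ∀ y ∈ corner m, f y = 0 := by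
  have hintg : IntegrableOn f (corner m) := hf.continuousOn.integrableOn_compact (isCompact_corner m)
  have h1 := (setIntegral_eq_zero_iff_of_nonneg_ae ((ae_restrict_iff' (measurableSet_corner m)).2
    (Filter.Eventually.of_forall hnn)) hintg).1 h
  have h2 : Set.EqOn f 0 (interior (corner m)) :=
    Measure.eqOn_open_of_ae_eq (ae_restrict_of_ae_restrict_of_subset interior_subset h1)
      isOpen_interior hf.continuousOn continuousOn_const
  have hne : (interior (corner m)).Nonempty := by
    by_contra hcon
    have h3 := (convex_corner m).addHaar_frontier volume
    rw [frontier, Set.not_nonempty_iff_eq_empty.1 hcon, (isClosed_corner m).closure_eq,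
      Set.sdiff_empty] at h3
    have h4 := volume_corner_pos m
    rw [Measure.real, h3] at h4
    simp at h4
  have hcl : closure (interior (corner m)) = corner m := by
    rw [(convex_corner m).closure_interior_eq_closure_of_nonempty_interior hne,
      (isClosed_corner m).closure_eq]
  have h5 := h2.of_subset_closure hf.continuousOn continuousOn_const interior_subset hcl.ge
  exact h5

theorem eqOn_zero_of_integral_body_eq_zero {f : Pt (n + 1) → ℝ} (hf : Continuous f)
    (hnn : ∀ x ∈ body s, 0 ≤ f x) (h : ∫ x in body s, f x = 0) : ∀ x ∈ body s, f x = 0 := by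
  have hx := affineIndependent_perm s (Equiv.refl _)
  rw [setIntegral_body s (Equiv.refl _)] at h
  have hne : bvol s / volume.real (corner (n + 1)) ≠ 0 :=
    (div_pos (bvol_pos s) (volume_corner_pos _)).ne'
  have hpre := param_preimage_convexHull hx
  rw [← body_perm] at hpre
  have h1 := eqOn_zero_of_integral_corner_eq_zero (hf.comp (continuous_param _))
    (fun y hy => hnn _ (by rw [← hpre] at hy; exact hy)) ((mul_eq_zero.1 h).resolve_left hne)
  intro x hxb
  rw [body_perm s (Equiv.refl _)] at hxb
  obtain ⟨y, rfl⟩ := convexHull_subset_range_param hxb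
  rw [← body_perm] at hxb
  exact h1 y (hpre ▸ hxb)

/-- The facet has empty interior in the ambient space, so the argument is carried out in its
parameter domain. -/
theorem eqOn_zero_of_integral_facet_eq_zero (a : Fin (n + 1 + 1)) {f : Pt (n + 1) → ℝ}
    (hf : Continuous f) (hnn : ∀ x ∈ facet s a, 0 ≤ f x) (h : ∫ x in facet s a, f x ∂μHE[n] = 0) :
    ∀ x ∈ facet s a, f x = 0 := by
  have hx := affineIndependent_facet s (Equiv.refl _) a
  have h' := setIntegral_facet s (Equiv.refl _) a f
  have hfac := facet_perm s (Equiv.refl _) a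
  rw [Equiv.refl_apply] at h' hfac
  rw [h'] at h
  have hne : area s a / volume.real (corner n) ≠ 0 :=
    (div_pos (area_pos s a) (volume_corner_pos _)).ne'
  have hpre := param_preimage_convexHull hx
  rw [← hfac] at hpre
  have h1 := eqOn_zero_of_integral_corner_eq_zero (hf.comp (continuous_param _))
    (fun y hy => hnn _ (by rw [← hpre] at hy; exact hy)) ((mul_eq_zero.1 h).resolve_left hne)
  intro x hxb
  have hxb' := hxb
  rw [hfac] at hxb'
  obtain ⟨y, rfl⟩ := convexHull_subset_range_param hxb'
  exact h1 y (hpre ▸ hxb)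

theorem eq_zero_of_integral_body_sq_eq_zero {m : ℕ} {f : Pt (n + 1) → ℝ}
    (hf : f ∈ polySpace (n + 1) m) (h : ∫ x in body s, f x ^ 2 = 0) : f = 0 := by
  have h1 := eqOn_zero_of_integral_body_eq_zero s ((continuous_of_mem_polySpace hf).pow 2)
    (fun x _ => sq_nonneg _) h
  exact eq_zero_of_eqOn_open hf isOpen_interior (interior_body_nonempty s)
    fun x hx => pow_eq_zero_iff (two_ne_zero) |>.1 (h1 x (interior_subset hx))

end Definiteness

/-! ### Affine transfer between two simplices -/

section Transfer

variable {n : ℕ} (s₀ s : Affine.Simplex ℝ (Pt (n + 1)) (n + 1))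

/-- The affine map that takes the vertices of `s₀` to those of `s`. -/
def transfer (x : Pt (n + 1)) : Pt (n + 1) := ∑ a, bc s₀ a x • s.points a

theorem bc_transfer (a : Fin (n + 1 + 1)) (x : Pt (n + 1)) :
    bc s a (transfer s₀ s x) = bc s₀ a x :=
  bc_sum_smul s (fun a => bc s₀ a x) (sum_bc s₀ x) a

theorem transfer_transfer (x : Pt (n + 1)) : transfer s s₀ (transfer s₀ s x) = x :=
  ext_bc s₀ fun a => by rw [bc_transfer, bc_transfer]

theorem transfer_sum (w : Fin (n + 1 + 1) → ℝ) (hw : ∑ a, w a = 1) :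
    transfer s₀ s (∑ a, w a • s₀.points a) = ∑ a, w a • s.points a := by
  simp only [transfer, bc_sum_smul s₀ w hw]

theorem comp_transfer_mem_polySpace {m : ℕ} {f : Pt (n + 1) → ℝ} (hf : f ∈ polySpace (n + 1) m) :
    (fun x => f (transfer s₀ s x)) ∈ polySpace (n + 1) m := by
  refine comp_mem_polySpace hf fun l => ?_
  have : (fun x => transfer s₀ s x l) = fun x => ∑ a, s.points a l * bc s₀ a x := by
    ext x
    simp [transfer, mul_comm]
  rw [this]
  exact sum_mem_polySpace _ fun a _ => const_mul_mem_polySpace _ (bc_mem_polySpace s₀ a)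

/-- The affine map takes edges to edges, so edge derivatives carry over without any factor.
Estimates are therefore stated with edge derivatives before they are turned into gradients. -/
theorem fderiv_comp_transfer {f : Pt (n + 1) → ℝ} (hf : Differentiable ℝ f)
    (a b : Fin (n + 1 + 1)) (x : Pt (n + 1)) :
    fderiv ℝ (fun x => f (transfer s₀ s x)) x (s₀.points b - s₀.points a) =
      fderiv ℝ f (transfer s₀ s x) (s.points b - s.points a) := by
  have h : HasFDerivAt (transfer s₀ s)
      (∑ a, (fderiv ℝ (bc s₀ a) x).smulRight (s.points a)) x := by
    unfold transfer
    refine HasFDerivAt.fun_sum fun a _ => ?_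
    exact ((differentiable_bc s₀ a) x).hasFDerivAt.smul_const _
  have h2 := (hf (transfer s₀ s x)).hasFDerivAt.comp x h
  rw [show (fun x => f (transfer s₀ s x)) = f ∘ transfer s₀ s from rfl, h2.fderiv,
    ContinuousLinearMap.comp_apply]
  congr 1
  simp [fderiv_bc_sub, bc_points, sub_smul, ite_smul, Finset.sum_sub_distrib]

/-- Both sides are the same mean over the corner simplex; mean values are affine invariants and no
Jacobian has to be computed. -/
theorem setIntegral_body_transfer (f : Pt (n + 1) → ℝ) :
    (bvol s)⁻¹ * ∫ x in body s, f x = (bvol s₀)⁻¹ * ∫ x in body s₀, f (transfer s₀ s x) := by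
  rw [setIntegral_body s (Equiv.refl _), setIntegral_body s₀ (Equiv.refl _)]
  have h : ∀ y, transfer s₀ s (param (s₀.points ∘ Equiv.refl _) y) =
      param (s.points ∘ Equiv.refl _) y := fun y => by
    rw [param_eq_sum, param_eq_sum]
    exact transfer_sum s₀ s _ (sum_cons_one_sub y)
  simp only [h]
  have := (bvol_pos s).ne'
  have := (bvol_pos s₀).ne'
  field_simp

theorem setIntegral_facet_transfer (a : Fin (n + 1 + 1)) (f : Pt (n + 1) → ℝ) :
    (area s a)⁻¹ * ∫ x in facet s a, f x ∂μHE[n] =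
      (area s₀ a)⁻¹ * ∫ x in facet s₀ a, f (transfer s₀ s x) ∂μHE[n] := by
  have h1 := setIntegral_facet s (Equiv.refl _) a f
  have h2 := setIntegral_facet s₀ (Equiv.refl _) a fun x => f (transfer s₀ s x)
  rw [Equiv.refl_apply] at h1 h2
  rw [h1, h2]
  have h : ∀ y, transfer s₀ s (param (s₀.points ∘ Equiv.refl _ ∘ a.succAbove) y) =
      param (s.points ∘ Equiv.refl _ ∘ a.succAbove) y := fun y => by
    have h3 : ∀ (s : Affine.Simplex ℝ (Pt (n + 1)) (n + 1)) (w : Fin (n + 1) → ℝ),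
        ∑ i, w i • (s.points ∘ Equiv.refl _ ∘ a.succAbove) i =
          ∑ i, (Fin.insertNth a 0 w : Fin (n + 1 + 1) → ℝ) i • s.points i := by
      intro s w
      rw [Fin.sum_univ_succAbove _ a]
      simp
    rw [param_eq_sum, param_eq_sum, h3, h3]
    refine transfer_sum s₀ s _ ?_
    rw [Fin.sum_univ_succAbove _ a]
    simp [sum_cons_one_sub y]
  simp only [h]
  have := (area_pos s a).ne'
  have := (area_pos s₀ a).ne'
  field_simp

end Transfer

end WG
end

noncomputable section

namespace WG

/-! ### Trace inequality and facet lift, from one reference simplex to all -/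

section ReferenceEstimates

variable {n : ℕ}

/-- Polynomials as functions. -/
def polyFun (n m : ℕ) : polySpace (n + 1) m →ₗ[ℝ] (Pt (n + 1) → ℝ) := (polySpace (n + 1) m).subtype

theorem setIntegral_body_transfer' (s₀ s : Affine.Simplex ℝ (Pt (n + 1)) (n + 1))
    (f : Pt (n + 1) → ℝ) :
    ∫ x in body s₀, f (transfer s₀ s x) = bvol s₀ / bvol s * ∫ x in body s, f x := by
  have h := setIntegral_body_transfer s₀ s f
  have h1 := (bvol_pos s).ne'
  have h2 := (bvol_pos s₀).ne'
  field_simp at h ⊢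
  linarith

theorem setIntegral_facet_transfer' (s₀ s : Affine.Simplex ℝ (Pt (n + 1)) (n + 1))
    (a : Fin (n + 1 + 1)) (f : Pt (n + 1) → ℝ) :
    ∫ x in facet s₀ a, f (transfer s₀ s x) ∂μHE[n] =
      area s₀ a / area s a * ∫ x in facet s a, f x ∂μHE[n] := by
  have h := setIntegral_facet_transfer s₀ s a f
  have h1 := (area_pos s a).ne'
  have h2 := (area_pos s₀ a).ne'
  field_simp at h ⊢
  linarith

/-- The `L²` norm on the body is definite on polynomials, so its kernel is trivial and it dominates
the facet norm in finite dimension. -/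
theorem trace_inequality_reference (s₀ : Affine.Simplex ℝ (Pt (n + 1)) (n + 1)) (m : ℕ)
    (a : Fin (n + 1 + 1)) : ∃ C : ℝ, 0 < C ∧ ∀ p ∈ polySpace (n + 1) m,
      ∫ x in facet s₀ a, p x ^ 2 ∂μHE[n] ≤ C * ∫ x in body s₀, p x ^ 2 := by
  have hc : ∀ v : polySpace (n + 1) m, Continuous (polyFun n m v) := fun v =>
    continuous_of_mem_polySpace v.2
  have hT₁ : ∀ v w : polySpace (n + 1) m,
      Integrable (fun x => (1 : ℝ) * (polyFun n m v x * polyFun n m w x))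
        ((μHE[n]).restrict (facet s₀ a)) := fun v w =>
    integrableOn_facet s₀ a (continuous_const.mul ((hc v).mul (hc w)))
  have hT₂ : ∀ v w : polySpace (n + 1) m,
      Integrable (fun x => (1 : ℝ) * (polyFun n m v x * polyFun n m w x))
        (volume.restrict (body s₀)) := fun v w =>
    integrableOn_body s₀ (continuous_const.mul ((hc v).mul (hc w)))
  obtain ⟨C, hC, h⟩ := exists_bound_mod_ker
    (weightedForm ((μHE[n]).restrict (facet s₀ a)) (fun _ => 1) (polyFun n m) hT₁)
    (weightedForm (volume.restrict (body s₀)) (fun _ => 1) (polyFun n m) hT₂)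
    (weightedForm_symm _ _ _ _) (fun v => by
      rw [weightedForm_apply]
      exact integral_nonneg fun x => by simpa using mul_self_nonneg _)
  refine ⟨C, hC, fun p hp => ?_⟩
  obtain ⟨v', h1, h2⟩ := h ⟨p, hp⟩
  simp only [weightedForm_apply, one_mul, ← sq] at h1 h2
  have h3 : p - v'.1 = 0 := eq_zero_of_integral_body_sq_eq_zero s₀
    (Submodule.sub_mem _ hp v'.2) h1
  have h4 : p = v'.1 := sub_eq_zero.1 h3
  have h5 : (⟨p, hp⟩ : polySpace (n + 1) m) = v' := Subtype.ext h4
  rw [← h5] at h2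
  exact h2

/-- The trace inequality for polynomials on a simplex. -/
theorem trace_inequality (n m : ℕ) : ∃ C : ℝ, 0 < C ∧
    ∀ (s : Affine.Simplex ℝ (Pt (n + 1)) (n + 1)) (a : Fin (n + 1 + 1)),
      ∀ p ∈ polySpace (n + 1) m,
        ht s a * ∫ x in facet s a, p x ^ 2 ∂μHE[n] ≤ C * ∫ x in body s, p x ^ 2 := by
  -- Any simplex serves as reference; if there were none, the claim would be vacuous.
  by_cases hne : Nonempty (Affine.Simplex ℝ (Pt (n + 1)) (n + 1))
  swap
  · exact ⟨1, one_pos, fun s => (hne ⟨s⟩).elim⟩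
  obtain ⟨s₀⟩ := hne
  choose C hC h using trace_inequality_reference s₀ m
  have hnn : ∀ a, 0 ≤ (n + 1) * (C a * bvol s₀ / area s₀ a) := fun a => by
    have := hC a; have := bvol_pos s₀; have := area_pos s₀ a
    positivity
  refine ⟨(∑ a, (n + 1) * (C a * bvol s₀ / area s₀ a)) + 1,
    add_pos_of_nonneg_of_pos (Finset.sum_nonneg fun a _ => hnn a) one_pos, fun s a p hp => ?_⟩
  have h1 := h a _ (comp_transfer_mem_polySpace s₀ s hp)
  rw [setIntegral_body_transfer' s₀ s fun x => p x ^ 2,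
    setIntegral_facet_transfer' s₀ s a fun x => p x ^ 2] at h1
  have hI : 0 ≤ ∫ x in body s, p x ^ 2 := integral_nonneg fun x => sq_nonneg _
  have e1 := area_pos s a
  have e2 := area_pos s₀ a
  have e3 := bvol_pos s
  have e4 := bvol_pos s₀
  have h2 : ht s a * ∫ x in facet s a, p x ^ 2 ∂μHE[n] ≤
      (n + 1) * (C a * bvol s₀ / area s₀ a) * ∫ x in body s, p x ^ 2 := by
    -- The volume and area factors of the transfer combine to the height, up to `n + 1`.
    have h3 : ht s a = (n + 1) * bvol s / area s a := by
      rw [← ht_mul_area s a]; field_simp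
    rw [h3]
    calc (n + 1) * bvol s / area s a * ∫ x in facet s a, p x ^ 2 ∂μHE[n]
        = (n + 1) * bvol s / area s₀ a *
          (area s₀ a / area s a * ∫ x in facet s a, p x ^ 2 ∂μHE[n]) := by field_simp
      _ ≤ (n + 1) * bvol s / area s₀ a *
          (C a * (bvol s₀ / bvol s * ∫ x in body s, p x ^ 2)) := by gcongr
      _ = _ := by field_simp
  refine h2.trans (mul_le_mul_of_nonneg_right ?_ hI)
  have := Finset.single_le_sum (fun a _ => hnn a) (Finset.mem_univ a)
  linarith

/-- The combination `∑ λ_b v_b` of polynomials with barycentric coordinates as coefficients. -/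
def bcComb (s : Affine.Simplex ℝ (Pt (n + 1)) (n + 1)) (m : ℕ) :
    (Fin (n + 1 + 1) → polySpace (n + 1) m) →ₗ[ℝ] (Pt (n + 1) → ℝ) where
  toFun v x := ∑ b, bc s b x * (v b).1 x
  map_add' v w := by ext x; simp [mul_add, Finset.sum_add_distrib]
  map_smul' c v := by ext x; simp [Finset.mul_sum, mul_left_comm]

/-- The divergence of the field `∑ λ_b v_b (x_b - x_a)`. -/
def bcDiv (s : Affine.Simplex ℝ (Pt (n + 1)) (n + 1)) (m : ℕ) (a : Fin (n + 1 + 1)) :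
    (Fin (n + 1 + 1) → polySpace (n + 1) m) →ₗ[ℝ] (Pt (n + 1) → ℝ) where
  toFun v x := ∑ b, fderiv ℝ (fun x => bc s b x * (v b).1 x) x (s.points b - s.points a)
  map_add' v w := by
    ext x
    rw [Pi.add_apply, ← Finset.sum_add_distrib]
    refine Finset.sum_congr rfl fun b _ => ?_
    have h : ∀ v : Fin (n + 1 + 1) → polySpace (n + 1) m,
        DifferentiableAt ℝ (fun x => bc s b x * (v b).1 x) x := fun v =>
      ((differentiable_bc s b) x).fun_mul (differentiable_of_mem_polySpace (v b).2 x)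
    rw [← add_apply, ← fderiv_fun_add (h v) (h w)]
    simp [mul_add]
  map_smul' c v := by
    ext x
    rw [Pi.smul_apply, RingHom.id_apply, Finset.smul_sum]
    refine Finset.sum_congr rfl fun b _ => ?_
    have h : DifferentiableAt ℝ (fun x => bc s b x * (v b).1 x) x :=
      ((differentiable_bc s b) x).fun_mul (differentiable_of_mem_polySpace (v b).2 x)
    rw [← smul_apply, ← fderiv_fun_const_smul h]
    simp [mul_left_comm]

theorem bcComb_apply (s : Affine.Simplex ℝ (Pt (n + 1)) (n + 1)) (m : ℕ)
    (v : Fin (n + 1 + 1) → polySpace (n + 1) m) (x : Pt (n + 1)) :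
    bcComb s m v x = ∑ b, bc s b x * (v b).1 x := rfl

theorem bcDiv_apply (s : Affine.Simplex ℝ (Pt (n + 1)) (n + 1)) (m : ℕ) (a : Fin (n + 1 + 1))
    (v : Fin (n + 1 + 1) → polySpace (n + 1) m) (x : Pt (n + 1)) :
    bcDiv s m a v x =
      ∑ b, fderiv ℝ (fun x => bc s b x * (v b).1 x) x (s.points b - s.points a) := rfl

theorem bc_mul_mem_polySpace (s : Affine.Simplex ℝ (Pt (n + 1)) (n + 1)) {m : ℕ}
    (b : Fin (n + 1 + 1)) {f : Pt (n + 1) → ℝ} (hf : f ∈ polySpace (n + 1) m) :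
    (fun x => bc s b x * f x) ∈ polySpace (n + 1) (m + 1) := by
  have := mul_mem_polySpace (bc_mem_polySpace s b) hf
  rwa [add_comm 1 m] at this

theorem bcComb_mem (s : Affine.Simplex ℝ (Pt (n + 1)) (n + 1)) {m : ℕ}
    (v : Fin (n + 1 + 1) → polySpace (n + 1) m) : bcComb s m v ∈ polySpace (n + 1) (m + 1) :=
  sum_mem_polySpace Finset.univ fun b _ => bc_mul_mem_polySpace s b (v b).2

theorem bcDiv_mem (s : Affine.Simplex ℝ (Pt (n + 1)) (n + 1)) {m : ℕ} (a : Fin (n + 1 + 1))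
    (v : Fin (n + 1 + 1) → polySpace (n + 1) m) : bcDiv s m a v ∈ polySpace (n + 1) m :=
  sum_mem_polySpace Finset.univ fun b _ => fderiv_mem_polySpace (m := m + 1)
    (bc_mul_mem_polySpace s b (v b).2) (s.points b - s.points a)

/-- Write `g = c + ∑ x_l f_l` and replace the coordinates by `x = ∑ λ_b x_b`. The coefficient of
`λ_b` is `c + ∑ x_{b,l} f_l`, one degree lower than `g`. -/
theorem exists_bcComb_eq (s : Affine.Simplex ℝ (Pt (n + 1)) (n + 1)) {m : ℕ}
    {g : Pt (n + 1) → ℝ} (hg : g ∈ polySpace (n + 1) (m + 1)) :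
    ∃ v : Fin (n + 1 + 1) → polySpace (n + 1) m, bcComb s m v = g := by
  obtain ⟨c, f, hf, rfl⟩ := exists_decomp_polySpace_succ hg
  refine ⟨fun b => ⟨fun x => c + ∑ l, s.points b l * f l x, add_mem_polySpace
    (const_mem_polySpace c) (sum_mem_polySpace _ fun l _ => const_mul_mem_polySpace _ (hf l))⟩, ?_⟩
  ext x
  change ∑ b, bc s b x * (c + ∑ l, s.points b l * f l x) = _
  simp only [mul_add, Finset.sum_add_distrib, ← Finset.sum_mul, sum_bc, one_mul, Finset.mul_sum]
  rw [Finset.sum_comm]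
  congr 1
  refine Finset.sum_congr rfl fun l _ => ?_
  have h := congrArg (fun z : Pt (n + 1) => z l) (sum_bc_smul s x)
  simp only [WithLp.ofLp_sum, WithLp.ofLp_smul, Finset.sum_apply, Pi.smul_apply,
    smul_eq_mul] at h
  rw [← h, Finset.sum_mul]
  exact Finset.sum_congr rfl fun b _ => by ring

/-- Coefficients are sought only up to those whose combination vanishes on the facet; modulo this
kernel every quadratic quantity is bounded by the facet norm. The divergence is included in that
quantity because it transfers exactly as the coefficients do. -/
theorem facet_lift_reference (s₀ : Affine.Simplex ℝ (Pt (n + 1)) (n + 1)) (k : ℕ)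
    (a : Fin (n + 1 + 1)) : ∃ C : ℝ, 0 < C ∧ ∀ g ∈ polySpace (n + 1) (k + 1),
      ∃ v : Fin (n + 1 + 1) → polySpace (n + 1) k, (∀ x ∈ facet s₀ a, bcComb s₀ k v x = g x) ∧
        (∑ b, ∫ x in body s₀, (v b).1 x ^ 2) + (∫ x in body s₀, bcDiv s₀ k a v x ^ 2) ≤
          C * ∫ x in facet s₀ a, g x ^ 2 ∂μHE[n] := by
  let V := Fin (n + 1 + 1) → polySpace (n + 1) k
  let T : Fin (n + 1 + 1) → V →ₗ[ℝ] (Pt (n + 1) → ℝ) := fun b =>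
    (polyFun n k).comp (LinearMap.proj b)
  have hcT : ∀ b (v : V), Continuous (T b v) := fun b v => continuous_of_mem_polySpace (v b).2
  have hcD : ∀ v : V, Continuous (bcDiv s₀ k a v) := fun v =>
    continuous_of_mem_polySpace (bcDiv_mem s₀ a v)
  have hcC : ∀ v : V, Continuous (bcComb s₀ k v) := fun v =>
    continuous_of_mem_polySpace (bcComb_mem s₀ v)
  have hT : ∀ b (v w : V), Integrable (fun x => (1 : ℝ) * (T b v x * T b w x))
      (volume.restrict (body s₀)) := fun b v w =>
    integrableOn_body s₀ (continuous_const.mul ((hcT b v).mul (hcT b w)))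
  have hD : ∀ v w : V, Integrable (fun x => (1 : ℝ) * (bcDiv s₀ k a v x * bcDiv s₀ k a w x))
      (volume.restrict (body s₀)) := fun v w =>
    integrableOn_body s₀ (continuous_const.mul ((hcD v).mul (hcD w)))
  have hF : ∀ v w : V, Integrable (fun x => (1 : ℝ) * (bcComb s₀ k v x * bcComb s₀ k w x))
      ((μHE[n]).restrict (facet s₀ a)) := fun v w =>
    integrableOn_facet s₀ a (continuous_const.mul ((hcC v).mul (hcC w)))
  obtain ⟨C, hC, h⟩ := exists_bound_mod_ker
    ((∑ b, weightedForm (volume.restrict (body s₀)) (fun _ => 1) (T b) (hT b)) +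
      weightedForm (volume.restrict (body s₀)) (fun _ => 1) (bcDiv s₀ k a) hD)
    (weightedForm ((μHE[n]).restrict (facet s₀ a)) (fun _ => 1) (bcComb s₀ k) hF)
    (weightedForm_symm _ _ _ _) (fun v => by
      rw [weightedForm_apply]
      exact integral_nonneg fun x => by simpa using mul_self_nonneg _)
  refine ⟨C, hC, fun g hg => ?_⟩
  obtain ⟨v, rfl⟩ := exists_bcComb_eq s₀ hg
  obtain ⟨v', h1, h2⟩ := h v
  simp only [LinearMap.add_apply, LinearMap.sum_apply, weightedForm_apply, one_mul, ← sq] at h1 h2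
  refine ⟨v', fun x hx => ?_, h2⟩
  have h3 := eqOn_zero_of_integral_facet_eq_zero s₀ a ((hcC (v - v')).pow 2)
    (fun x _ => sq_nonneg _) h1 x hx
  have h4 := pow_eq_zero_iff two_ne_zero |>.1 h3
  rw [map_sub, Pi.sub_apply] at h4
  linarith

theorem norm_sum_smul_sq_le {ι E : Type*} [NormedAddCommGroup E] [NormedSpace ℝ E] (t : Finset ι)
    (f : ι → ℝ) (u : ι → E) {h : ℝ} (hu : ∀ i ∈ t, ‖u i‖ ≤ h) :
    ‖∑ i ∈ t, f i • u i‖ ^ 2 ≤ t.card * h ^ 2 * ∑ i ∈ t, f i ^ 2 := by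
  have h1 : ‖∑ i ∈ t, f i • u i‖ ≤ ∑ i ∈ t, |f i| * h :=
    (norm_sum_le _ _).trans (Finset.sum_le_sum fun i hi => by
      rw [norm_smul, Real.norm_eq_abs]
      exact mul_le_mul_of_nonneg_left (hu i hi) (abs_nonneg _))
  calc ‖∑ i ∈ t, f i • u i‖ ^ 2 ≤ (∑ i ∈ t, |f i| * h) ^ 2 := by gcongr
    _ ≤ t.card * ∑ i ∈ t, (|f i| * h) ^ 2 := sq_sum_le_card_mul_sum_sq
    _ = t.card * h ^ 2 * ∑ i ∈ t, f i ^ 2 := by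
      simp only [mul_pow, sq_abs, ← Finset.sum_mul]; ring

/-- A polynomial field with prescribed normal component on one facet of a simplex and vanishing
normal component on the others. -/
theorem exists_facet_lift (n k : ℕ) : ∃ C : ℝ, 0 < C ∧
    ∀ (s : Affine.Simplex ℝ (Pt (n + 1)) (n + 1)) (a : Fin (n + 1 + 1)) (h : ℝ),
      (∀ b c, ‖s.points b - s.points c‖ ≤ h) → ∀ g ∈ polySpace (n + 1) (k + 1),
      ∃ (q : Pt (n + 1) → Pt (n + 1)) (r : Pt (n + 1) → ℝ),
        (∀ l, (fun x => q x l) ∈ polySpace (n + 1) (k + 1)) ∧ r ∈ polySpace (n + 1) k ∧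
        Green s q r ∧ (∀ x ∈ facet s a, inner ℝ (q x) (outwardNormal s a) = g x) ∧
        (∀ b, b ≠ a → ∀ x ∈ facet s b, inner ℝ (q x) (outwardNormal s b) = 0) ∧
        ht s a * (∫ x in body s, ‖q x‖ ^ 2) ≤ C * h ^ 2 * (∫ x in facet s a, g x ^ 2 ∂μHE[n]) ∧
        ht s a * (∫ x in body s, r x ^ 2) ≤ C * ∫ x in facet s a, g x ^ 2 ∂μHE[n] := by
  by_cases hne : Nonempty (Affine.Simplex ℝ (Pt (n + 1)) (n + 1))
  swap
  · exact ⟨1, one_pos, fun s => (hne ⟨s⟩).elim⟩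
  obtain ⟨s₀⟩ := hne
  choose C hC H using facet_lift_reference s₀ k
  -- The reference constant after the volume and area factors of `s₀` have been collected; those of
  -- `s` become its height.
  set D : Fin (n + 1 + 1) → ℝ := fun a => C a * area s₀ a / ((n + 1) * bvol s₀) with hD
  have hDpos : ∀ a, 0 < D a := fun a => by
    have := hC a; have := bvol_pos s₀; have := area_pos s₀ a
    positivity
  refine ⟨(n + 2) * ∑ a, D a, mul_pos (by positivity) (Finset.sum_pos (fun a _ => hDpos a)
    Finset.univ_nonempty), fun s a h hh g hg => ?_⟩
  obtain ⟨v₀, hv1, hv2⟩ := H a _ (comp_transfer_mem_polySpace s₀ s hg)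
  let v : Fin (n + 1 + 1) → polySpace (n + 1) k := fun b =>
    ⟨fun x => (v₀ b).1 (transfer s s₀ x), comp_transfer_mem_polySpace s s₀ (v₀ b).2⟩
  have hvv : ∀ b x, (v b).1 (transfer s₀ s x) = (v₀ b).1 x := fun b x => by
    simp only [v, transfer_transfer]
  have hpos := ht_pos s a
  have e1 := area_pos s a
  have e2 := area_pos s₀ a
  have e3 := bvol_pos s
  have e4 := bvol_pos s₀
  have hG0 : 0 ≤ ∫ x in facet s a, g x ^ 2 ∂μHE[n] := integral_nonneg fun x => sq_nonneg _
  have hDa0 := (hDpos a).le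
  have hDa : D a ≤ ∑ a, D a := Finset.single_le_sum (fun a _ => (hDpos a).le) (Finset.mem_univ a)
  have hdiv : ∀ x, bcDiv s k a v (transfer s₀ s x) = bcDiv s₀ k a v₀ x := by
    intro x
    rw [bcDiv_apply, bcDiv_apply]
    refine Finset.sum_congr rfl fun b _ => ?_
    rw [← fderiv_comp_transfer s₀ s (differentiable_of_mem_polySpace
      (bc_mul_mem_polySpace s b (v b).2))]
    simp only [bc_transfer, hvv]
  have hcv : ∀ b, Continuous fun x => (v b).1 x ^ 2 := fun b =>
    (continuous_of_mem_polySpace (v b).2).pow 2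
  -- The factor `ht ^ 2` on the right cancels the normalization `(ht)⁻¹` of the field and of its
  -- divergence, squared.
  have hbound : ht s a * ((∑ b, ∫ x in body s, (v b).1 x ^ 2) +
      ∫ x in body s, bcDiv s k a v x ^ 2) ≤
        ht s a ^ 2 * (D a * ∫ x in facet s a, g x ^ 2 ∂μHE[n]) := by
    have h1 : ∀ b, ∫ x in body s₀, (v₀ b).1 x ^ 2 =
        bvol s₀ / bvol s * ∫ x in body s, (v b).1 x ^ 2 := fun b => by
      rw [← setIntegral_body_transfer' s₀ s fun x => (v b).1 x ^ 2]
      simp only [hvv]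
    have h2 : ∫ x in body s₀, bcDiv s₀ k a v₀ x ^ 2 =
        bvol s₀ / bvol s * ∫ x in body s, bcDiv s k a v x ^ 2 := by
      rw [← setIntegral_body_transfer' s₀ s fun x => bcDiv s k a v x ^ 2]
      simp only [hdiv]
    rw [h2, Finset.sum_congr rfl fun b _ => h1 b, ← Finset.mul_sum, ← mul_add,
      setIntegral_facet_transfer' s₀ s a fun x => g x ^ 2] at hv2
    have h3 : bvol s = ht s a * area s a / (n + 1) := by rw [ht_mul_area]; field_simp
    set X := (∑ b, ∫ x in body s, (v b).1 x ^ 2) + ∫ x in body s, bcDiv s k a v x ^ 2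
    set G := ∫ x in facet s a, g x ^ 2 ∂μHE[n]
    calc ht s a * X = ht s a * (bvol s / bvol s₀) * (bvol s₀ / bvol s * X) := by field_simp
      _ ≤ ht s a * (bvol s / bvol s₀) * (C a * (area s₀ a / area s a * G)) := by gcongr
      _ = ht s a ^ 2 * (D a * G) := by rw [h3, hD]; field_simp
  have hn2 : (1 : ℝ) ≤ n + 2 := by
    have : (0 : ℝ) ≤ n := Nat.cast_nonneg n
    linarith
  have hlin : ∀ x, ∑ b, ((ht s a)⁻¹ * (bc s b x * (v b).1 x)) • (s.points b - s.points a) =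
      (ht s a)⁻¹ • ∑ b, (bc s b x * (v b).1 x) • (s.points b - s.points a) := fun x => by
    rw [Finset.smul_sum]
    exact Finset.sum_congr rfl fun b _ => mul_smul _ _ _
  have hS : ∀ b, 0 ≤ ∫ x in body s, (v b).1 x ^ 2 := fun b => integral_nonneg fun x => sq_nonneg _
  have hR : 0 ≤ ∫ x in body s, bcDiv s k a v x ^ 2 := integral_nonneg fun x => sq_nonneg _
  refine ⟨fun x => (ht s a)⁻¹ • ∑ b, (bc s b x * (v b).1 x) • (s.points b - s.points a),
    fun x => (ht s a)⁻¹ * bcDiv s k a v x, fun l => ?_, const_mul_mem_polySpace _ (bcDiv_mem s a v),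
    (Green.sum _ fun b _ => Green.of_smul (contDiff_of_mem_polySpace
      (bc_mul_mem_polySpace s b (v b).2)) _).const_smul _, fun x hx => ?_, fun c hc x hx => ?_,
    ?_, ?_⟩
  · have : (fun x => ((ht s a)⁻¹ • ∑ b, (bc s b x * (v b).1 x) • (s.points b - s.points a)) l) =
        fun x => ∑ b, ((ht s a)⁻¹ * (s.points b - s.points a) l) * (bc s b x * (v b).1 x) := by
      ext x
      rw [← hlin]
      simp only [WithLp.ofLp_sum, WithLp.ofLp_smul, Finset.sum_apply, Pi.smul_apply, smul_eq_mul]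
      exact Finset.sum_congr rfl fun b _ => by ring
    rw [this]
    exact sum_mem_polySpace _ fun b _ => const_mul_mem_polySpace _
      (bc_mul_mem_polySpace s b (v b).2)
  -- On the facet opposite to `a` every edge leaving `a` has normal component `ht`, which the
  -- normalization removes; what remains is the combination equal to `g`.
  · obtain ⟨hx0, hxp⟩ := (mem_facet s).1 hx
    rw [real_inner_smul_left, sum_inner]
    have h1 : ∀ b, inner ℝ ((bc s b x * (v b).1 x) • (s.points b - s.points a))
        (outwardNormal s a) = ht s a * (bc s b x * (v b).1 x) := by
      intro b
      rw [real_inner_smul_left, inner_edge_outwardNormal]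
      by_cases hb : a = b
      · subst hb; simp [hx0]
      · simp [hb]; ring
    rw [Finset.sum_congr rfl fun b _ => h1 b, ← Finset.mul_sum, inv_mul_cancel_left₀ hpos.ne']
    have h2 := hv1 (transfer s s₀ x) ((mem_facet s₀).2
      ⟨by rw [bc_transfer, hx0], fun b => by rw [bc_transfer]; exact hxp b⟩)
    rw [transfer_transfer] at h2
    rw [← h2, bcComb_apply]
    simp only [v, bc_transfer]
  -- On another facet only the edge to its opposite vertex has a normal component, and its
  -- coefficient contains the barycentric coordinate that is zero there.
  · obtain ⟨hx0, hxp⟩ := (mem_facet s).1 hx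
    rw [real_inner_smul_left, sum_inner]
    refine mul_eq_zero_of_right _ (Finset.sum_eq_zero fun b _ => ?_)
    rw [real_inner_smul_left, inner_edge_outwardNormal]
    by_cases hb : c = b
    · subst hb; simp [hx0]
    · simp [hb, hc]
  · have h1 : ∫ x in body s,
        ‖(ht s a)⁻¹ • ∑ b, (bc s b x * (v b).1 x) • (s.points b - s.points a)‖ ^ 2 ≤
        ∫ x in body s, ((ht s a)⁻¹ ^ 2 * ((n + 2) * h ^ 2)) * ∑ b, (v b).1 x ^ 2 := by
      refine setIntegral_mono_on (integrableOn_body s ?_) (integrableOn_body s ?_)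
        (measurableSet_body s) fun x hx => ?_
      · have hcb : ∀ b, Continuous fun x => bc s b x * (v b).1 x := fun b =>
          continuous_of_mem_polySpace (bc_mul_mem_polySpace s b (v b).2)
        fun_prop
      · exact (continuous_finsetSum _ fun b _ => hcv b).const_mul _
      · rw [norm_smul, mul_pow, norm_inv, Real.norm_of_nonneg hpos.le, mul_assoc]
        gcongr
        refine (norm_sum_smul_sq_le _ _ _ fun b _ => hh b a).trans ?_
        rw [Finset.card_univ, Fintype.card_fin]
        push_cast
        rw [show (n : ℝ) + 1 + 1 = n + 2 by ring]
        refine mul_le_mul_of_nonneg_left (Finset.sum_le_sum fun b _ => ?_) (by positivity)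
        rw [mul_pow]
        have h3 := bc_le_one s hx b
        have h4 := (mem_body s).1 hx b
        have h5 : bc s b x ^ 2 ≤ 1 := by nlinarith
        nlinarith [sq_nonneg ((v b).1 x)]
    rw [integral_const_mul, integral_finsetSum _ fun b _ => integrableOn_body s (hcv b)] at h1
    set X := ∑ b, ∫ x in body s, (v b).1 x ^ 2
    set G := ∫ x in facet s a, g x ^ 2 ∂μHE[n]
    have hX : ht s a * X ≤ ht s a ^ 2 * (D a * G) :=
      (mul_le_mul_of_nonneg_left (le_add_of_nonneg_right hR) hpos.le).trans hbound
    calc _ ≤ ht s a * ((ht s a)⁻¹ ^ 2 * ((n + 2) * h ^ 2) * X) := by gcongr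
      _ = ((ht s a)⁻¹ ^ 2 * ((n + 2) * h ^ 2)) * (ht s a * X) := by ring
      _ ≤ ((ht s a)⁻¹ ^ 2 * ((n + 2) * h ^ 2)) * (ht s a ^ 2 * (D a * G)) := by gcongr
      _ = (n + 2) * D a * h ^ 2 * G := by field_simp
      _ ≤ _ := by gcongr
  · simp only [mul_pow]
    rw [integral_const_mul]
    set X := ∫ x in body s, bcDiv s k a v x ^ 2
    set G := ∫ x in facet s a, g x ^ 2 ∂μHE[n]
    have hX : ht s a * X ≤ ht s a ^ 2 * (D a * G) :=
      (mul_le_mul_of_nonneg_left (le_add_of_nonneg_left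
        (Finset.sum_nonneg fun b _ => hS b)) hpos.le).trans hbound
    calc ht s a * ((ht s a)⁻¹ ^ 2 * X) = (ht s a)⁻¹ ^ 2 * (ht s a * X) := by ring
      _ ≤ (ht s a)⁻¹ ^ 2 * (ht s a ^ 2 * (D a * G)) := by gcongr
      _ = 1 * D a * G := by field_simp
      _ ≤ _ := by gcongr

end ReferenceEstimates

end WG
end

noncomputable section

namespace WG

/-! ### Bubble fields: prescribed divergence without normal component -/

section Bubble

variable {n : ℕ}

/-- The derivative of polynomials along an edge of a simplex. -/
def edgeDeriv (s : Affine.Simplex ℝ (Pt (n + 1)) (n + 1)) (m : ℕ)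
    (e : Fin (n + 1 + 1) × Fin (n + 1 + 1)) : polySpace (n + 1) m →ₗ[ℝ] (Pt (n + 1) → ℝ) where
  toFun w x := fderiv ℝ w.1 x (s.points e.2 - s.points e.1)
  map_add' v w := by
    ext x
    rw [Submodule.coe_add, fderiv_add (differentiable_of_mem_polySpace v.2 x)
      (differentiable_of_mem_polySpace w.2 x)]
    rfl
  map_smul' c v := by
    ext x
    rw [Submodule.coe_smul, fderiv_const_smul (differentiable_of_mem_polySpace v.2 x)]
    rfl

theorem edgeDeriv_apply (s : Affine.Simplex ℝ (Pt (n + 1)) (n + 1)) (m : ℕ)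
    (e : Fin (n + 1 + 1) × Fin (n + 1 + 1)) (w : polySpace (n + 1) m) (x : Pt (n + 1)) :
    edgeDeriv s m e w x = fderiv ℝ w.1 x (s.points e.2 - s.points e.1) := rfl

theorem edgeDeriv_mem (s : Affine.Simplex ℝ (Pt (n + 1)) (n + 1)) {m : ℕ}
    (e : Fin (n + 1 + 1) × Fin (n + 1 + 1)) (w : polySpace (n + 1) m) :
    edgeDeriv s m e w ∈ polySpace (n + 1) (m - 1) := fderiv_mem_polySpace w.2 _

theorem continuous_edgeDeriv (s : Affine.Simplex ℝ (Pt (n + 1)) (n + 1)) {m : ℕ}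
    (e : Fin (n + 1 + 1) × Fin (n + 1 + 1)) (w : polySpace (n + 1) m) :
    Continuous (edgeDeriv s m e w) := continuous_of_mem_polySpace (edgeDeriv_mem s e w)

/-- The bubble weight `λ_a λ_b` of an edge. -/
def edgeBubble (s : Affine.Simplex ℝ (Pt (n + 1)) (n + 1))
    (e : Fin (n + 1 + 1) × Fin (n + 1 + 1)) (x : Pt (n + 1)) : ℝ := bc s e.1 x * bc s e.2 x

@[fun_prop]
theorem continuous_edgeBubble (s : Affine.Simplex ℝ (Pt (n + 1)) (n + 1))
    (e : Fin (n + 1 + 1) × Fin (n + 1 + 1)) : Continuous (edgeBubble s e) :=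
  (continuous_bc s e.1).mul (continuous_bc s e.2)

theorem edgeBubble_nonneg (s : Affine.Simplex ℝ (Pt (n + 1)) (n + 1))
    (e : Fin (n + 1 + 1) × Fin (n + 1 + 1)) {x : Pt (n + 1)} (hx : x ∈ body s) :
    0 ≤ edgeBubble s e x := mul_nonneg ((mem_body s).1 hx _) ((mem_body s).1 hx _)

theorem edgeBubble_le_one (s : Affine.Simplex ℝ (Pt (n + 1)) (n + 1))
    (e : Fin (n + 1 + 1) × Fin (n + 1 + 1)) {x : Pt (n + 1)} (hx : x ∈ body s) :
    edgeBubble s e x ≤ 1 :=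
  mul_le_one₀ (bc_le_one s hx _) ((mem_body s).1 hx _) (bc_le_one s hx _)

/-- The energy `∑ ∫ λ_a λ_b (∂_{ab} w)²`. -/
def bubbleEnergy (s : Affine.Simplex ℝ (Pt (n + 1)) (n + 1)) (m : ℕ)
    (w : polySpace (n + 1) m) : ℝ :=
  ∑ e, ∫ x in body s, edgeBubble s e x * edgeDeriv s m e w x ^ 2

theorem bubbleEnergy_nonneg (s : Affine.Simplex ℝ (Pt (n + 1)) (n + 1)) (m : ℕ)
    (w : polySpace (n + 1) m) : 0 ≤ bubbleEnergy s m w :=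
  Finset.sum_nonneg fun e _ => setIntegral_nonneg (measurableSet_body s) fun _ hx =>
    mul_nonneg (edgeBubble_nonneg s e hx) (sq_nonneg _)

/-- The mean value over a simplex. -/
def mean (s : Affine.Simplex ℝ (Pt (n + 1)) (n + 1)) (f : Pt (n + 1) → ℝ) : ℝ :=
  (bvol s)⁻¹ * ∫ x in body s, f x

theorem mean_add (s : Affine.Simplex ℝ (Pt (n + 1)) (n + 1)) {f g : Pt (n + 1) → ℝ}
    (hf : Continuous f) (hg : Continuous g) : mean s (f + g) = mean s f + mean s g := by
  simp only [mean, Pi.add_apply]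
  rw [integral_add (integrableOn_body s hf) (integrableOn_body s hg), mul_add]

theorem mean_smul (s : Affine.Simplex ℝ (Pt (n + 1)) (n + 1)) (c : ℝ) (f : Pt (n + 1) → ℝ) :
    mean s (c • f) = c * mean s f := by
  simp only [mean, Pi.smul_apply, smul_eq_mul, integral_const_mul]
  ring

theorem mean_const (s : Affine.Simplex ℝ (Pt (n + 1)) (n + 1)) (c : ℝ) :
    mean s (fun _ => c) = c := by
  rw [mean, setIntegral_const, smul_eq_mul]
  exact inv_mul_cancel_left₀ (bvol_pos s).ne' c

/-- The deviation of a polynomial from its mean value. -/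
def deviation (s : Affine.Simplex ℝ (Pt (n + 1)) (n + 1)) (m : ℕ) :
    polySpace (n + 1) m →ₗ[ℝ] (Pt (n + 1) → ℝ) where
  toFun w x := w.1 x - mean s w.1
  map_add' v w := by
    ext x
    rw [Submodule.coe_add, mean_add s (continuous_of_mem_polySpace v.2)
      (continuous_of_mem_polySpace w.2)]
    simp only [Pi.add_apply]
    ring
  map_smul' c v := by
    ext x
    rw [Submodule.coe_smul, mean_smul]
    simp only [Pi.smul_apply, RingHom.id_apply, smul_eq_mul]
    ring

theorem deviation_apply (s : Affine.Simplex ℝ (Pt (n + 1)) (n + 1)) (m : ℕ)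
    (w : polySpace (n + 1) m) (x : Pt (n + 1)) : deviation s m w x = w.1 x - mean s w.1 := rfl

theorem continuous_deviation (s : Affine.Simplex ℝ (Pt (n + 1)) (n + 1)) {m : ℕ}
    (w : polySpace (n + 1) m) : Continuous (deviation s m w) :=
  (continuous_of_mem_polySpace w.2).sub continuous_const

/-- The weights `λ_a λ_b` are positive inside the simplex, so zero energy kills all edge
derivatives; the edges span, hence the polynomial is constant. -/
theorem deviation_eq_zero_of_bubbleEnergy (s : Affine.Simplex ℝ (Pt (n + 1)) (n + 1)) {m : ℕ}
    (w : polySpace (n + 1) m) (h : bubbleEnergy s m w = 0) : deviation s m w = 0 := by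
  have h1 : ∀ e, edgeDeriv s m e w = 0 := by
    intro e
    have h2 := (Finset.sum_eq_zero_iff_of_nonneg fun e _ =>
      setIntegral_nonneg (measurableSet_body s) fun _ hx =>
        mul_nonneg (edgeBubble_nonneg s e hx) (sq_nonneg _)).1 h e (Finset.mem_univ e)
    have h3 := eqOn_zero_of_integral_body_eq_zero s
      ((continuous_edgeBubble s e).mul ((continuous_edgeDeriv s e w).pow 2))
      (fun x hx => mul_nonneg (edgeBubble_nonneg s e hx) (sq_nonneg _)) h2
    refine eq_zero_of_eqOn_open (edgeDeriv_mem s e w) isOpen_interior (interior_body_nonempty s)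
      fun x hx => ?_
    have h4 := (mem_interior_body s).1 hx
    have h5 := (mul_eq_zero.1 (h3 x (interior_subset hx))).resolve_left
      (mul_pos (h4 e.1) (h4 e.2)).ne'
    exact pow_eq_zero_iff two_ne_zero |>.1 h5
  have hd := differentiable_of_mem_polySpace w.2
  have h6 : ∀ x, fderiv ℝ w.1 x = 0 := by
    intro x
    ext u
    have hu : u = ∑ b, (bc s b u - bc s b 0) • (s.points b - s.points 0) := by
      simp only [sub_smul, Finset.sum_sub_distrib, sum_bc_smul_sub]
      abel
    rw [hu, map_sum]
    simp only [map_smul]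
    refine Finset.sum_eq_zero fun b _ => ?_
    have := congrFun (h1 (0, b)) x
    rw [edgeDeriv_apply] at this
    rw [this]
    simp
  have h7 : ∀ x, w.1 x = w.1 0 := fun x => is_const_of_fderiv_eq_zero hd h6 x 0
  ext x
  rw [deviation_apply, funext h7, mean_const]
  simp

theorem poincare_reference (s₀ : Affine.Simplex ℝ (Pt (n + 1)) (n + 1)) (m : ℕ) :
    ∃ C : ℝ, 0 < C ∧ ∀ w : polySpace (n + 1) m,
      ∫ x in body s₀, deviation s₀ m w x ^ 2 ≤ C * bubbleEnergy s₀ m w := by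
  have hD : ∀ v w : polySpace (n + 1) m,
      Integrable (fun x => (1 : ℝ) * (deviation s₀ m v x * deviation s₀ m w x))
        (volume.restrict (body s₀)) := fun v w => integrableOn_body s₀
    (continuous_const.mul ((continuous_deviation s₀ v).mul (continuous_deviation s₀ w)))
  have hE : ∀ e, ∀ v w : polySpace (n + 1) m,
      Integrable (fun x => edgeBubble s₀ e x * (edgeDeriv s₀ m e v x * edgeDeriv s₀ m e w x))
        (volume.restrict (body s₀)) := fun e v w => integrableOn_body s₀
    ((continuous_edgeBubble s₀ e).mul ((continuous_edgeDeriv s₀ e v).mul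
      (continuous_edgeDeriv s₀ e w)))
  have hB : ∀ w, (∑ e, weightedForm (volume.restrict (body s₀)) (edgeBubble s₀ e)
      (edgeDeriv s₀ m e) (hE e)) w w = bubbleEnergy s₀ m w := fun w => by
    simp only [LinearMap.sum_apply, weightedForm_apply, ← sq, bubbleEnergy]
  obtain ⟨C, hC, h⟩ := exists_bound_mod_ker
    (weightedForm (volume.restrict (body s₀)) (fun _ => 1) (deviation s₀ m) hD)
    (∑ e, weightedForm (volume.restrict (body s₀)) (edgeBubble s₀ e) (edgeDeriv s₀ m e) (hE e))
    (fun v w => by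
      simp only [LinearMap.sum_apply]
      exact Finset.sum_congr rfl fun e _ => weightedForm_symm _ _ _ _ _ _)
    (fun w => by rw [hB]; exact bubbleEnergy_nonneg s₀ m w)
  refine ⟨C, hC, fun w => ?_⟩
  obtain ⟨w', h1, h2⟩ := h w
  rw [hB] at h1 h2
  have h3 := deviation_eq_zero_of_bubbleEnergy s₀ _ h1
  rw [map_sub, sub_eq_zero] at h3
  simp only [weightedForm_apply, one_mul, ← sq] at h2
  rw [h3]
  exact h2

/-- A Poincaré inequality for polynomials, uniform over all simplices. -/
theorem poincare_inequality (n m : ℕ) : ∃ C : ℝ, 0 < C ∧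
    ∀ (s : Affine.Simplex ℝ (Pt (n + 1)) (n + 1)) (w : polySpace (n + 1) m),
      ∫ x in body s, deviation s m w x ^ 2 ≤ C * bubbleEnergy s m w := by
  by_cases hne : Nonempty (Affine.Simplex ℝ (Pt (n + 1)) (n + 1))
  swap
  · exact ⟨1, one_pos, fun s => (hne ⟨s⟩).elim⟩
  obtain ⟨s₀⟩ := hne
  obtain ⟨C, hC, h⟩ := poincare_reference s₀ m
  refine ⟨C, hC, fun s w => ?_⟩
  let w₀ : polySpace (n + 1) m := ⟨fun x => w.1 (transfer s₀ s x),
    comp_transfer_mem_polySpace s₀ s w.2⟩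
  have h1 := h w₀
  have h2 : ∀ x, deviation s₀ m w₀ x = deviation s m w (transfer s₀ s x) := fun x => by
    rw [deviation_apply, deviation_apply, mean, mean, setIntegral_body_transfer s₀ s]
  have h3 : ∀ e x, edgeDeriv s₀ m e w₀ x = edgeDeriv s m e w (transfer s₀ s x) := fun e x =>
    fderiv_comp_transfer s₀ s (differentiable_of_mem_polySpace w.2) e.1 e.2 x
  have h4 : ∀ e x, edgeBubble s₀ e x = edgeBubble s e (transfer s₀ s x) := fun e x => by
    simp only [edgeBubble, bc_transfer]
  have e3 := bvol_pos s
  have e4 := bvol_pos s₀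
  have h5 : bubbleEnergy s₀ m w₀ = bvol s₀ / bvol s * bubbleEnergy s m w := by
    rw [bubbleEnergy, bubbleEnergy, Finset.mul_sum]
    refine Finset.sum_congr rfl fun e _ => ?_
    simp only [h3, h4]
    exact setIntegral_body_transfer' s₀ s fun x => edgeBubble s e x * edgeDeriv s m e w x ^ 2
  simp only [h2] at h1
  rw [h5, setIntegral_body_transfer' s₀ s fun x => deviation s m w x ^ 2, mul_left_comm] at h1
  exact le_of_mul_le_mul_left h1 (div_pos e4 e3)

/-- The bubble field `∑ λ_a λ_b (∂_{ab} w) (x_b - x_a)`. -/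
def bubbleField (s : Affine.Simplex ℝ (Pt (n + 1)) (n + 1)) (m : ℕ)
    (w : polySpace (n + 1) m) (x : Pt (n + 1)) : Pt (n + 1) :=
  ∑ e : Fin (n + 1 + 1) × Fin (n + 1 + 1),
    (edgeBubble s e x * edgeDeriv s m e w x) • (s.points e.2 - s.points e.1)

/-- Two degrees from the bubble and one lost in the derivative. For `m = 0` the truncated `m - 1`
would spoil this count, but then the derivative is zero. -/
theorem edgeBubble_mul_mem (s : Affine.Simplex ℝ (Pt (n + 1)) (n + 1)) {m : ℕ}
    (e : Fin (n + 1 + 1) × Fin (n + 1 + 1)) (w : polySpace (n + 1) m) :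
    (fun x => edgeBubble s e x * edgeDeriv s m e w x) ∈ polySpace (n + 1) (m + 1) := by
  rcases Nat.eq_zero_or_pos m with rfl | hm
  · obtain ⟨c, hc⟩ := polySpace_zero_eq_const w.2
    have : ∀ x, edgeDeriv s 0 e w x = 0 := fun x => by
      rw [edgeDeriv_apply, hc]
      simp
    simp only [this, mul_zero]
    exact const_mem_polySpace 0
  · have h := mul_mem_polySpace (mul_mem_polySpace (bc_mem_polySpace s e.1)
      (bc_mem_polySpace s e.2)) (edgeDeriv_mem s e w)
    rwa [show 1 + 1 + (m - 1) = m + 1 by omega] at h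

/-- The divergence of the bubble field. -/
def bubbleDiv (s : Affine.Simplex ℝ (Pt (n + 1)) (n + 1)) (m : ℕ) :
    polySpace (n + 1) m →ₗ[ℝ] polySpace (n + 1) m where
  toFun w := ⟨fun x => ∑ e : Fin (n + 1 + 1) × Fin (n + 1 + 1),
    fderiv ℝ (fun x => edgeBubble s e x * edgeDeriv s m e w x) x (s.points e.2 - s.points e.1),
    sum_mem_polySpace Finset.univ fun e _ => fderiv_mem_polySpace (m := m + 1)
      (edgeBubble_mul_mem s e w) _⟩
  map_add' v w := by
    ext x
    simp only [Submodule.coe_add, Pi.add_apply]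
    rw [← Finset.sum_add_distrib]
    refine Finset.sum_congr rfl fun e _ => ?_
    rw [← add_apply, ← fderiv_fun_add
      (differentiable_of_mem_polySpace (edgeBubble_mul_mem s e v) x)
      (differentiable_of_mem_polySpace (edgeBubble_mul_mem s e w) x)]
    simp [mul_add]
  map_smul' c v := by
    ext x
    simp only [Submodule.coe_smul, Pi.smul_apply, RingHom.id_apply]
    rw [Finset.smul_sum]
    refine Finset.sum_congr rfl fun e _ => ?_
    rw [← smul_apply, ← fderiv_fun_const_smul
      (differentiable_of_mem_polySpace (edgeBubble_mul_mem s e v) x)]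
    simp [mul_left_comm]

theorem green_bubbleField (s : Affine.Simplex ℝ (Pt (n + 1)) (n + 1)) (m : ℕ)
    (w : polySpace (n + 1) m) : Green s (bubbleField s m w) (bubbleDiv s m w).1 :=
  Green.sum Finset.univ fun e _ => Green.of_smul (contDiff_of_mem_polySpace
    (edgeBubble_mul_mem s e w)) (s.points e.2 - s.points e.1)

/-- On a facet, either the weight of an edge vanishes or the edge is parallel to the facet. -/
theorem inner_bubbleField_outwardNormal (s : Affine.Simplex ℝ (Pt (n + 1)) (n + 1)) (m : ℕ)
    (w : polySpace (n + 1) m) {a : Fin (n + 1 + 1)} {x : Pt (n + 1)} (hx : x ∈ facet s a) :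
    inner ℝ (bubbleField s m w x) (outwardNormal s a) = 0 := by
  have hx0 := ((mem_facet s).1 hx).1
  rw [bubbleField, sum_inner]
  refine Finset.sum_eq_zero fun e _ => ?_
  rw [real_inner_smul_left, inner_edge_outwardNormal, edgeBubble]
  by_cases h1 : a = e.1
  · rw [← h1, hx0]; simp
  · by_cases h2 : a = e.2
    · rw [← h2, hx0]; simp
    · simp [h1, h2]

/-- Green's formula tested with `w` itself has no boundary term. Minus the divergence of the bubble
field is thus the symmetric operator belonging to the bubble energy. -/
theorem integral_bubbleDiv_mul (s : Affine.Simplex ℝ (Pt (n + 1)) (n + 1)) (m : ℕ)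
    (w : polySpace (n + 1) m) :
    ∫ x in body s, (bubbleDiv s m w).1 x * w.1 x = -bubbleEnergy s m w := by
  have h := (green_bubbleField s m w).formula w.1 (contDiff_of_mem_polySpace w.2)
  have h1 : ∀ a, ∫ x in facet s a, w.1 x * inner ℝ (bubbleField s m w x) (outwardNormal s a)
      ∂μHE[n] = 0 := fun a => by
    rw [setIntegral_congr_fun (g := fun _ => (0 : ℝ)) (measurableSet_facet s a) fun x hx => by
      simp only [inner_bubbleField_outwardNormal s m w hx, mul_zero]]
    simp
  rw [Finset.sum_eq_zero fun a _ => h1 a] at h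
  have h2 : ∫ x in body s, fderiv ℝ w.1 x (bubbleField s m w x) = bubbleEnergy s m w := by
    rw [bubbleEnergy, ← integral_finsetSum _ fun e _ => integrableOn_body s
      (f := fun x => edgeBubble s e x * edgeDeriv s m e w x ^ 2)
      ((continuous_edgeBubble s e).mul ((continuous_edgeDeriv s e w).pow 2))]
    refine integral_congr_ae (Filter.Eventually.of_forall fun x => ?_)
    simp only [bubbleField, map_sum, map_smul, smul_eq_mul, edgeDeriv_apply]
    exact Finset.sum_congr rfl fun e _ => by ring
  rw [h2] at h
  linarith

theorem mean_bubbleDiv (s : Affine.Simplex ℝ (Pt (n + 1)) (n + 1)) (m : ℕ)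
    (w : polySpace (n + 1) m) : mean s (bubbleDiv s m w).1 = 0 := by
  rw [mean, (green_bubbleField s m w).integral_div, Finset.sum_eq_zero, mul_zero]
  intro a _
  rw [setIntegral_congr_fun (g := fun _ => (0 : ℝ)) (measurableSet_facet s a) fun x hx => by
    simp only [inner_bubbleField_outwardNormal s m w hx]]
  simp

/-- Adding the mean value, as a constant, to the divergence operator gives an endomorphism of `P_m`.
It preserves means, and zero energy together with zero mean gives zero, so it is injective and hence
surjective; on data of zero mean the added term disappears. -/
theorem exists_bubbleDiv_eq (s : Affine.Simplex ℝ (Pt (n + 1)) (n + 1)) (m : ℕ)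
    (r : polySpace (n + 1) m) (hr : mean s r.1 = 0) :
    ∃ w : polySpace (n + 1) m, bubbleDiv s m w = r ∧ mean s w.1 = 0 := by
  obtain ⟨C, hC, hP⟩ := poincare_inequality n m
  let one : polySpace (n + 1) m := ⟨fun _ => 1, const_mem_polySpace 1⟩
  let meanL : polySpace (n + 1) m →ₗ[ℝ] ℝ :=
    { toFun := fun w => mean s w.1
      map_add' := fun v w => mean_add s (continuous_of_mem_polySpace v.2)
        (continuous_of_mem_polySpace w.2)
      map_smul' := fun c v => mean_smul s c v.1 }
  have hone : meanL one = 1 := mean_const s 1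
  let L : polySpace (n + 1) m →ₗ[ℝ] polySpace (n + 1) m :=
    bubbleDiv s m + meanL.smulRight one
  have hmL : ∀ w, meanL (L w) = meanL w := fun w => by
    simp only [L, LinearMap.add_apply, map_add, LinearMap.smulRight_apply, map_smul, hone,
      smul_eq_mul, mul_one]
    rw [show meanL (bubbleDiv s m w) = 0 from mean_bubbleDiv s m w, zero_add]
  have hinj : Function.Injective L := by
    rw [← LinearMap.ker_eq_bot, LinearMap.ker_eq_bot']
    intro w hw
    have h1 : meanL w = 0 := by rw [← hmL, hw, map_zero]
    have h2 : bubbleDiv s m w = 0 := by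
      simpa [L, h1] using hw
    have h3 := integral_bubbleDiv_mul s m w
    rw [h2] at h3
    simp only [Submodule.coe_zero, Pi.zero_apply, zero_mul, integral_zero] at h3
    have h4 := deviation_eq_zero_of_bubbleEnergy s w (by linarith)
    ext x
    have h5 := congrFun h4 x
    rw [deviation_apply, show mean s w.1 = 0 from h1, sub_zero] at h5
    exact h5
  obtain ⟨w, hw⟩ := (LinearMap.injective_iff_surjective.1 hinj) r
  have h1 : meanL w = 0 := by rw [← hmL, hw]; exact hr
  exact ⟨w, by simpa [L, h1] using hw, h1⟩

/-- A polynomial field with prescribed divergence of zero mean and vanishing normal component. -/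
theorem exists_bubble_lift (n k : ℕ) : ∃ C : ℝ, 0 < C ∧
    ∀ (s : Affine.Simplex ℝ (Pt (n + 1)) (n + 1)) (h : ℝ),
      (∀ b c, ‖s.points b - s.points c‖ ≤ h) → ∀ r ∈ polySpace (n + 1) k,
      ∫ x in body s, r x = 0 → ∃ q : Pt (n + 1) → Pt (n + 1),
        (∀ l, (fun x => q x l) ∈ polySpace (n + 1) (k + 1)) ∧ Green s q r ∧
        (∀ a, ∀ x ∈ facet s a, inner ℝ (q x) (outwardNormal s a) = 0) ∧
        ∫ x in body s, ‖q x‖ ^ 2 ≤ C * h ^ 2 * ∫ x in body s, r x ^ 2 := by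
  obtain ⟨C, hC, hP⟩ := poincare_inequality n k
  refine ⟨(n + 2) ^ 2 * C, by positivity, fun s h hh r hr hr0 => ?_⟩
  obtain ⟨w, hw, hw0⟩ := exists_bubbleDiv_eq s k ⟨r, hr⟩ (by rw [mean, hr0, mul_zero])
  have hwr : (bubbleDiv s k w).1 = r := by rw [hw]
  have hcw := continuous_of_mem_polySpace w.2
  have hcr := continuous_of_mem_polySpace hr
  refine ⟨bubbleField s k w, fun l => ?_, hwr ▸ green_bubbleField s k w,
    fun a x hx => inner_bubbleField_outwardNormal s k w hx, ?_⟩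
  · have : (fun x => bubbleField s k w x l) = fun x =>
        ∑ e : Fin (n + 1 + 1) × Fin (n + 1 + 1), (s.points e.2 - s.points e.1) l *
          (edgeBubble s e x * edgeDeriv s k e w x) := by
      ext x
      simp only [bubbleField, WithLp.ofLp_sum, WithLp.ofLp_smul, Finset.sum_apply, Pi.smul_apply,
        smul_eq_mul]
      exact Finset.sum_congr rfl fun b _ => by ring
    rw [this]
    exact sum_mem_polySpace _ fun e _ => const_mul_mem_polySpace _ (edgeBubble_mul_mem s e w)
  · have hE : bubbleEnergy s k w ≤ C * ∫ x in body s, r x ^ 2 := by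
      have h1 := integral_bubbleDiv_mul s k w
      rw [hwr] at h1
      have h2 := hP s w
      simp only [deviation_apply, hw0, sub_zero] at h2
      -- Young's inequality with weight `C`: by the Poincaré inequality the term in `w` is at most
      -- half of the energy and can be absorbed.
      have h3 : ∫ x in body s, -(r x * w.1 x) ≤
          ∫ x in body s, (C / 2 * r x ^ 2 + (2 * C)⁻¹ * w.1 x ^ 2) := by
        refine setIntegral_mono_on (integrableOn_body s (hcr.mul hcw).neg)
          (integrableOn_body s (by fun_prop)) (measurableSet_body s) fun x _ => ?_
        have : 0 ≤ (2 * C)⁻¹ * (C * r x + w.1 x) ^ 2 := by positivity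
        have h4 : (2 * C)⁻¹ * (C * r x + w.1 x) ^ 2 =
          C / 2 * r x ^ 2 + (2 * C)⁻¹ * w.1 x ^ 2 + r x * w.1 x := by field_simp; ring
        linarith
      rw [integral_neg, h1, integral_add (integrableOn_body s (by fun_prop))
        (integrableOn_body s (by fun_prop)), integral_const_mul, integral_const_mul] at h3
      have h5 : (2 * C)⁻¹ * ∫ x in body s, w.1 x ^ 2 ≤ (2 * C)⁻¹ * (C * bubbleEnergy s k w) := by
        gcongr
      have h6 : (2 * C)⁻¹ * (C * bubbleEnergy s k w) = bubbleEnergy s k w / 2 := by field_simp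
      linarith
    have hcont : ∀ e, Continuous fun x => edgeBubble s e x * edgeDeriv s k e w x ^ 2 := fun e =>
      (continuous_edgeBubble s e).mul ((continuous_edgeDeriv s e w).pow 2)
    have h1 : ∫ x in body s, ‖bubbleField s k w x‖ ^ 2 ≤
        ∫ x in body s, ((n + 2) ^ 2 * h ^ 2) *
          ∑ e, edgeBubble s e x * edgeDeriv s k e w x ^ 2 := by
      refine setIntegral_mono_on (integrableOn_body s
        ((green_bubbleField s k w).continuous_field.norm.pow 2))
        (integrableOn_body s ((continuous_finsetSum _ fun e _ => hcont e).const_mul _))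
        (measurableSet_body s) fun x hx => ?_
      refine (norm_sum_smul_sq_le _ _ _ fun e _ => hh e.2 e.1).trans ?_
      rw [Finset.card_univ, Fintype.card_prod, Fintype.card_fin]
      push_cast
      rw [show ((n : ℝ) + 1 + 1) * (n + 1 + 1) = (n + 2) ^ 2 by ring]
      refine mul_le_mul_of_nonneg_left (Finset.sum_le_sum fun e _ => ?_) (by positivity)
      have h3 := edgeBubble_le_one s e hx
      have h4 := edgeBubble_nonneg s e hx
      rw [mul_pow]
      -- The weight lies in `[0, 1]`, so the squared field is bounded by the weighted energy
      -- density.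
      have h5 : edgeBubble s e x ^ 2 ≤ edgeBubble s e x := by nlinarith
      exact mul_le_mul_of_nonneg_right h5 (sq_nonneg _)
    rw [integral_const_mul, integral_finsetSum _ fun e _ => integrableOn_body s (hcont e)] at h1
    calc _ ≤ (n + 2) ^ 2 * h ^ 2 * bubbleEnergy s k w := h1
      _ ≤ (n + 2) ^ 2 * h ^ 2 * (C * ∫ x in body s, r x ^ 2) := by gcongr
      _ = _ := by ring

end Bubble

end WG
end

noncomputable section

namespace WG

variable {n : ℕ}

/-! ### Relative interior of a facet -/

section RelativeBoundary

variable (s : Affine.Simplex ℝ (Pt (n + 1)) (n + 1))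

/-- In the parameters of the facet the condition `λ_b = 0` defines an affine subspace; it is proper
because `λ_b = 1` at the vertex `b`, hence null. -/
theorem measure_facet_inter_zero {a b : Fin (n + 1 + 1)} (hb : b ≠ a) :
    μHE[n] (facet s a ∩ {x | bc s b x = 0}) = 0 := by
  have hx := affineIndependent_facet s (Equiv.refl _) a
  have hfac := facet_perm s (Equiv.refl _) a
  rw [Equiv.refl_apply] at hfac
  set x : Fin (n + 1) → Pt (n + 1) := s.points ∘ Equiv.refl _ ∘ a.succAbove with hxdef
  have hsub : facet s a ⊆ Set.range (param x) := hfac ▸ convexHull_subset_range_param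
  have hlin : ∀ y, bc s b (param x y) = bc s b (x 0) +
      ∑ l, y l * fderiv ℝ (bc s b) 0 (x l.succ - x 0) := fun y => by
    rw [param, bc_add]; simp
  let A : AffineSubspace ℝ (Fin n → ℝ) :=
    { carrier := {y | bc s b (param x y) = 0}
      smul_vsub_vadd_mem' := by
        intro c p₁ p₂ p₃ h₁ h₂ h₃
        simp only [Set.mem_ofPred_eq, hlin, vsub_eq_sub, vadd_eq_add, Pi.add_apply, Pi.smul_apply,
          Pi.sub_apply, smul_eq_mul] at h₁ h₂ h₃ ⊢
        simp only [add_mul, sub_mul, mul_assoc, Finset.sum_add_distrib, ← Finset.mul_sum,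
          Finset.sum_sub_distrib]
        linear_combination c * (h₁ - h₂) + h₃ }
  have hA : A ≠ ⊤ := by
    intro h
    obtain ⟨y, hy⟩ := hsub (facetVertices_subset_facet s a ⟨b, hb, rfl⟩)
    have h1 : y ∈ A := h ▸ AffineSubspace.mem_top ℝ _ y
    have h2 : bc s b (param x y) = 0 := h1
    rw [hy, bc_points_self] at h2
    exact one_ne_zero h2
  have hS : MeasurableSet {z | bc s b z = 0} :=
    (isClosed_eq (continuous_bc s b) continuous_const).measurableSet
  have h := congrArg (fun μ => μ {z | bc s b z = 0}) (map_param hx)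
  simp only at h
  rw [Measure.map_apply (measurableEmbedding_param hx).measurable hS,
    Measure.restrict_apply hS, Measure.smul_apply] at h
  have h0 : volume (param x ⁻¹' {z | bc s b z = 0}) = 0 := Measure.addHaar_affineSubspace volume A hA
  rw [h0, smul_zero] at h
  exact measure_mono_null (t := {z | bc s b z = 0} ∩ Set.range (param x))
    (fun z hz => ⟨hz.2, hsub hz.1⟩) h.symm

/-- Almost every point of a facet is in its relative interior. -/
theorem ae_facet_pos (a : Fin (n + 1 + 1)) :
    ∀ᵐ x ∂((μHE[n]).restrict (facet s a)), x ∈ facet s a ∧ ∀ b, b ≠ a → 0 < bc s b x := by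
  have h1 : ∀ᵐ x ∂((μHE[n]).restrict (facet s a)), x ∈ facet s a :=
    ae_restrict_mem (measurableSet_facet s a)
  have h2 : ∀ b, b ≠ a → ∀ᵐ x ∂((μHE[n]).restrict (facet s a)), bc s b x ≠ 0 := by
    intro b hb
    have hm : MeasurableSet {z | bc s b z = 0} :=
      (isClosed_eq (continuous_bc s b) continuous_const).measurableSet
    rw [ae_iff]
    simp only [not_not]
    rw [Measure.restrict_apply hm, Set.inter_comm]
    exact measure_facet_inter_zero s hb
  have h3 : ∀ᵐ x ∂((μHE[n]).restrict (facet s a)), ∀ b, b ≠ a → bc s b x ≠ 0 := by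
    rw [ae_all_iff]
    intro b
    by_cases hb : b = a
    · exact Filter.Eventually.of_forall fun x hx => (hx hb).elim
    · exact (h2 b hb).mono fun x hx _ => hx
  filter_upwards [h1, h3] with x hx1 hx3
  exact ⟨hx1, fun b hb => lt_of_le_of_ne (((mem_facet s).1 hx1).2 b) (hx3 b hb).symm⟩

theorem facet_subset_closure (a : Fin (n + 1 + 1)) :
    facet s a ⊆ closure {x | bc s a x = 0 ∧ ∀ b, b ≠ a → 0 < bc s b x} := by
  intro y hy
  obtain ⟨x, hx0, hx⟩ := exists_relint_facet s a
  obtain ⟨hy0, hy1⟩ := (mem_facet s).1 hy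
  have hlim : Filter.Tendsto (fun t : ℝ => y + t • (x - y)) (nhdsWithin 0 (Set.Ioo 0 1))
      (nhds y) := by
    have : Continuous fun t : ℝ => y + t • (x - y) := by fun_prop
    simpa using (this.tendsto 0).mono_left nhdsWithin_le_nhds
  have hne : (nhdsWithin (0 : ℝ) (Set.Ioo 0 1)).NeBot := by
    rw [← mem_closure_iff_nhdsWithin_neBot, closure_Ioo (by norm_num)]
    simp
  refine mem_closure_of_tendsto hlim ?_
  filter_upwards [self_mem_nhdsWithin] with t ht
  refine ⟨by rw [bc_lineMap, hx0, hy0]; simp, fun b hb => ?_⟩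
  rw [bc_lineMap]
  have h1 := mul_nonneg (sub_nonneg.2 ht.2.le) (hy1 b)
  have h2 := mul_pos ht.1 (hx b hb)
  linarith

end RelativeBoundary

/-! ### Two simplices with a common facet or a common hyperplane -/

section CommonFacet

variable {s t : Affine.Simplex ℝ (Pt (n + 1)) (n + 1)} {a b : Fin (n + 1 + 1)}

theorem facet_congr (h : facetVertices s a = facetVertices t b) : facet s a = facet t b := by
  rw [facet, facet, h]

theorem bc_eq_sum (s t : Affine.Simplex ℝ (Pt (n + 1)) (n + 1)) (b : Fin (n + 1 + 1))
    (x : Pt (n + 1)) : bc t b x = ∑ c, bc s c x * bc t b (s.points c) := by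
  have h := fderiv_bc_sub t b 0 x 0
  have h1 : x - 0 = ∑ c, bc s c x • (s.points c - 0) := (sum_bc_smul_sub s x 0).symm
  rw [h1, map_sum] at h
  simp only [map_smul, smul_eq_mul, fderiv_bc_sub, mul_sub, Finset.sum_sub_distrib,
    ← Finset.sum_mul, sum_bc, one_mul] at h
  linarith

/-- Expand `λ_b` of `t` over the vertices of `s`: all of them except `a` lie on the common facet,
where it vanishes. -/
theorem bc_eq_mul_of_facetVertices_eq (h : facetVertices s a = facetVertices t b)
    (x : Pt (n + 1)) : bc t b x = bc t b (s.points a) * bc s a x := by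
  rw [bc_eq_sum s t b x, Finset.sum_eq_single a, mul_comm]
  · intro c _ hc
    have : s.points c ∈ facet t b :=
      facetVertices_subset_facet t b (h ▸ ⟨c, hc, rfl⟩)
    rw [((mem_facet t).1 this).1, mul_zero]
  · simp

theorem bc_pos_of_facetVertices_eq (h : facetVertices s a = facetVertices t b)
    {x : Pt (n + 1)} (hx0 : bc s a x = 0) (hx : ∀ c, c ≠ a → 0 < bc s c x)
    {c : Fin (n + 1 + 1)} (hc : c ≠ b) : 0 < bc t c x := by
  have hmem : t.points c ∈ facetVertices s a := h ▸ ⟨c, hc, rfl⟩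
  obtain ⟨c', hc', hcc'⟩ := hmem
  rw [bc_eq_sum s t c x]
  refine Finset.sum_pos' (fun e _ => ?_) ⟨c', Finset.mem_univ _, ?_⟩
  · by_cases he : e = a
    · rw [he, hx0, zero_mul]
    · have : s.points e ∈ facet t b := facetVertices_subset_facet t b (h ▸ ⟨e, he, rfl⟩)
      exact mul_nonneg (hx e he).le (((mem_facet t).1 this).2 c)
  · rw [hcc', bc_points_self, mul_one]
    exact hx c' hc'

/-- Two simplices on the same side of a common hyperplane overlap. -/
theorem ratio_neg {κ : ℝ} (h : ∀ y, bc t b y = κ * bc s a y) {x : Pt (n + 1)}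
    (hx0 : bc s a x = 0) (hx : ∀ c, c ≠ a → 0 < bc s c x) (hxt : ∀ c, c ≠ b → 0 < bc t c x)
    (hd : Disjoint (interior (body s)) (interior (body t))) : κ < 0 := by
  by_contra! hge
  have hne : κ ≠ 0 := fun h0 => by
    have := h (t.points b)
    rw [h0, zero_mul, bc_points_self] at this
    exact one_ne_zero this
  have hpos := lt_of_le_of_ne hge hne.symm
  have hcont : Continuous fun r : ℝ => x + r • (s.points a - x) := by fun_prop
  -- If the ratio were positive, a small step from `x` towards the vertex `a` would make all
  -- barycentric coordinates of both simplices positive.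
  have hev : ∀ᶠ r in nhdsWithin (0 : ℝ) (Set.Ioo 0 1), x + r • (s.points a - x) ∈
      interior (body s) ∩ interior (body t) := by
    have h2 : ∀ c, c ≠ b → ∀ᶠ r in nhds (0 : ℝ), 0 < bc t c (x + r • (s.points a - x)) := by
      intro c hc
      refine ((continuous_bc t c).comp hcont).continuousAt.eventually
        (lt_mem_nhds ?_)
      simpa using hxt c hc
    have h3 : ∀ᶠ r in nhds (0 : ℝ), ∀ c, c ≠ b → 0 < bc t c (x + r • (s.points a - x)) := by
      rw [Filter.eventually_all]
      intro c
      by_cases hc : c = b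
      · exact Filter.Eventually.of_forall fun r hr => (hr hc).elim
      · exact (h2 c hc).mono fun r hr _ => hr
    filter_upwards [h3.filter_mono nhdsWithin_le_nhds, self_mem_nhdsWithin] with r hr hr01
    have hbc : bc s a (x + r • (s.points a - x)) = r := by
      rw [bc_lineMap, hx0, bc_points_self]; ring
    refine ⟨(mem_interior_body s).2 fun c => ?_, (mem_interior_body t).2 fun c => ?_⟩
    · by_cases hc : c = a
      · rw [hc, hbc]; exact hr01.1
      · rw [bc_lineMap, bc_points, if_neg hc, mul_zero, add_zero]
        exact mul_pos (sub_pos.2 hr01.2) (hx c hc)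
    · by_cases hc : c = b
      · rw [hc, h, hbc]; exact mul_pos hpos hr01.1
      · exact hr c hc
  have hneb : (nhdsWithin (0 : ℝ) (Set.Ioo 0 1)).NeBot := by
    rw [← mem_closure_iff_nhdsWithin_neBot, closure_Ioo (by norm_num)]
    simp
  obtain ⟨r, hr⟩ := hev.exists
  exact Set.disjoint_left.1 hd hr.1 hr.2

/-- The normals are negative gradients of the two coordinates, scaled by the heights. They are
negative multiples of each other and both have length one. -/
theorem outwardNormal_eq_neg_of_ratio {κ : ℝ} (h : ∀ y, bc t b y = κ * bc s a y) (hκ : κ < 0) :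
    outwardNormal t b = -outwardNormal s a := by
  have h1 : outwardNormal t b = (ht t b * κ / ht s a) • outwardNormal s a := by
    refine ext_inner_right ℝ fun u => ?_
    have e1 := inner_outwardNormal_sub' t b u 0
    have e2 := inner_outwardNormal_sub' s a u 0
    rw [sub_zero] at e1 e2
    rw [real_inner_smul_left, e1, e2, h u, h 0]
    have := (ht_pos s a).ne'
    field_simp
  have h2 := congrArg norm h1
  have hneg : ht t b * κ / ht s a < 0 :=
    div_neg_of_neg_of_pos (mul_neg_of_pos_of_neg (ht_pos t b) hκ) (ht_pos s a)
  rw [norm_smul, norm_outwardNormal, norm_outwardNormal, mul_one, Real.norm_eq_abs,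
    abs_of_neg hneg] at h2
  rw [h1, show ht t b * κ / ht s a = -1 by linarith]
  simp

theorem bc_opposite_neg (h : facetVertices s a = facetVertices t b)
    (hd : Disjoint (interior (body s)) (interior (body t))) : bc t b (s.points a) < 0 := by
  obtain ⟨x, hx0, hx⟩ := exists_relint_facet s a
  exact ratio_neg (bc_eq_mul_of_facetVertices_eq h) hx0 hx
    (fun c hc => bc_pos_of_facetVertices_eq h hx0 hx hc) hd

theorem outwardNormal_eq_neg (h : facetVertices s a = facetVertices t b)
    (hd : Disjoint (interior (body s)) (interior (body t))) :
    outwardNormal t b = -outwardNormal s a :=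
  outwardNormal_eq_neg_of_ratio (bc_eq_mul_of_facetVertices_eq h) (bc_opposite_neg h hd)

/-- An affine function that vanishes on a facet is a multiple of a barycentric coordinate. -/
theorem inner_sub_eq_mul_bc (s : Affine.Simplex ℝ (Pt (n + 1)) (n + 1)) (a : Fin (n + 1 + 1))
    {ν : Pt (n + 1)} {c : ℝ} (h : ∀ x ∈ facet s a, inner ℝ ν x = c) (y : Pt (n + 1)) :
    inner ℝ ν y - c = (inner ℝ ν (s.points a) - c) * bc s a y := by
  have h1 : inner ℝ ν y - c = ∑ b, bc s b y * (inner ℝ ν (s.points b) - c) := by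
    simp only [mul_sub, Finset.sum_sub_distrib, ← Finset.sum_mul, sum_bc, one_mul]
    conv_lhs => rw [← sum_bc_smul s y, inner_sum]
    simp only [real_inner_smul_right]
  rw [h1, Finset.sum_eq_single a, mul_comm]
  · intro b _ hb
    rw [h _ (facetVertices_subset_facet s a ⟨b, hb, rfl⟩), sub_self, mul_zero]
  · simp

/-- The outward normals of two simplices on the opposite sides of a common hyperplane. -/
theorem outwardNormal_eq_neg_of_flat {ν : Pt (n + 1)} {c : ℝ} (hν : ν ≠ 0)
    (hs : ∀ x ∈ facet s a, inner ℝ ν x = c) (ht : ∀ x ∈ facet t b, inner ℝ ν x = c)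
    {x : Pt (n + 1)} (hx0 : bc s a x = 0) (hx : ∀ c, c ≠ a → 0 < bc s c x)
    (hxt : ∀ c, c ≠ b → 0 < bc t c x)
    (hd : Disjoint (interior (body s)) (interior (body t))) :
    outwardNormal t b = -outwardNormal s a := by
  -- Both coordinates are multiples of the same affine function `⟨ν, ·⟩ - c`, so no matching of
  -- vertices is required; this covers hanging nodes.
  have e1 := inner_sub_eq_mul_bc s a hs
  have e2 := inner_sub_eq_mul_bc t b ht
  have hne : inner ℝ ν (t.points b) - c ≠ 0 := by
    intro h0
    simp only [h0, zero_mul] at e2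
    have h1 := e2 (ν + 0)
    have h2 := e2 0
    rw [add_zero, real_inner_self_eq_norm_sq] at h1
    rw [inner_zero_right] at h2
    have : ‖ν‖ ^ 2 = 0 := by linarith
    exact hν (norm_eq_zero.1 (pow_eq_zero_iff two_ne_zero |>.1 this))
  have h : ∀ y, bc t b y =
      ((inner ℝ ν (s.points a) - c) / (inner ℝ ν (t.points b) - c)) * bc s a y := fun y => by
    have := (e2 y).symm.trans (e1 y)
    rw [div_mul_eq_mul_div, eq_div_iff hne]
    linarith
  exact outwardNormal_eq_neg_of_ratio h (ratio_neg h hx0 hx hxt hd)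

/-- Near such a point all other coordinates of both simplices stay positive, and the sign of `λ_a`
alone decides which simplex contains the point. -/
theorem mem_interior_union_of_facetVertices_eq (h : facetVertices s a = facetVertices t b)
    (hd : Disjoint (interior (body s)) (interior (body t))) {x : Pt (n + 1)}
    (hx0 : bc s a x = 0) (hx : ∀ c, c ≠ a → 0 < bc s c x) :
    x ∈ interior (body s ∪ body t) := by
  rw [mem_interior_iff_mem_nhds]
  have hev : ∀ (u : Affine.Simplex ℝ (Pt (n + 1)) (n + 1)) (e : Fin (n + 1 + 1)),
      (∀ c, c ≠ e → 0 < bc u c x) → ∀ᶠ y in nhds x, ∀ c, c ≠ e → 0 < bc u c y := by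
    intro u e hu
    rw [Filter.eventually_all]
    intro c
    by_cases hc : c = e
    · exact Filter.Eventually.of_forall fun r hr => (hr hc).elim
    · exact ((continuous_bc u c).continuousAt.eventually (lt_mem_nhds (hu c hc))).mono
        fun r hr _ => hr
  filter_upwards [hev s a hx, hev t b fun c hc => bc_pos_of_facetVertices_eq h hx0 hx hc]
    with y hy1 hy2
  rcases le_or_gt 0 (bc s a y) with h0 | h0
  · refine Or.inl ((mem_body s).2 fun c => ?_)
    by_cases hc : c = a
    · rw [hc]; exact h0
    · exact (hy1 c hc).le
  · refine Or.inr ((mem_body t).2 fun c => ?_)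
    by_cases hc : c = b
    · rw [hc, bc_eq_mul_of_facetVertices_eq h]
      exact (mul_pos_of_neg_of_neg (bc_opposite_neg h hd) h0).le
    · exact (hy2 c hc).le

theorem facetVertices_injective (s : Affine.Simplex ℝ (Pt (n + 1)) (n + 1)) :
    Function.Injective (facetVertices s) := by
  intro a b h
  have := (Set.image_injective.2 s.independent.injective) h
  simpa using this

/-- A relative interior point of a facet that lies in another simplex of a conforming family lies
in a common facet. -/
theorem exists_facetVertices_eq (hconf : body s ∩ body t =
      convexHull ℝ (Set.range s.points ∩ Set.range t.points))
    {x : Pt (n + 1)} (hx0 : bc s a x = 0) (hx : ∀ c, c ≠ a → 0 < bc s c x) (hxt : x ∈ body t) :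
    ∃ b, facetVertices s a = facetVertices t b := by
  classical
  have hxs : x ∈ body s := (mem_body s).2 fun c => by
    by_cases hc : c = a
    · rw [hc, hx0]
    · exact (hx c hc).le
  have hmem : x ∈ convexHull ℝ (s.points '' {c | s.points c ∈ Set.range t.points}) := by
    have : x ∈ body s ∩ body t := ⟨hxs, hxt⟩
    rw [hconf] at this
    convert this using 2
    ext y
    constructor
    · rintro ⟨c, hc, rfl⟩; exact ⟨⟨c, rfl⟩, hc⟩
    · rintro ⟨⟨c, rfl⟩, hc⟩; exact ⟨c, hc, rfl⟩
  -- The point lies in the hull of the common vertices, so a vertex that is not common would have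
  -- weight zero; all weights with `c ≠ a` are positive.
  have hall : ∀ c, c ≠ a → s.points c ∈ Set.range t.points := by
    intro c hc
    by_contra hn
    exact (hx c hc).ne' (((mem_convexHull_image s).1 hmem).1 c hn)
  choose! f hf using hall
  have hinj : Set.InjOn f {a}ᶜ := fun c hc c' hc' hcc' =>
    s.independent.injective (by rw [← hf c hc, ← hf c' hc', hcc'])
  -- The `n + 1` vertices of the facet are distinct vertices of `t`, which leaves exactly one vertex
  -- `b` of `t`.
  have hcard : (Finset.image f {a}ᶜ)ᶜ.card = 1 := by
    rw [Finset.card_compl, Finset.card_image_of_injOn (by simpa using hinj), Finset.card_compl]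
    simp
  obtain ⟨b, hb⟩ := Finset.card_eq_one.1 hcard
  refine ⟨b, ?_⟩
  have hb' : f '' {a}ᶜ = {b}ᶜ := by
    have h1 : Finset.image f {a}ᶜ = {b}ᶜ := by rw [← hb, compl_compl]
    simpa using congrArg (fun S : Finset (Fin (n + 1 + 1)) => (S : Set (Fin (n + 1 + 1)))) h1
  rw [facetVertices, facetVertices, ← hb', Set.image_image]
  exact Set.image_congr fun c hc => (hf c hc).symm

end CommonFacet

end WG

end

/-! ### Interior and boundary facets of a cell -/

noncomputable section

namespace WG

variable {n : ℕ}

namespace PolytopalMesh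

variable {Ω : Set (Pt (n + 1))} (M : PolytopalMesh (n + 1) Ω) (T : M.Cell)

/-- Two simplices of the subdivision of a cell have a common facet. -/
def Shared (p q : M.Sub T × Fin (n + 1 + 1)) : Prop :=
  p.1 ≠ q.1 ∧ facetVertices (M.simplex T p.1) p.2 = facetVertices (M.simplex T q.1) q.2

open scoped Classical in
/-- The facets on the boundary of a cell. -/
def bdryFacets : Finset (M.Sub T × Fin (n + 1 + 1)) :=
  Finset.univ.filter fun p => ¬∃ q, M.Shared T p q

variable {M T}

theorem mem_bdryFacets {p : M.Sub T × Fin (n + 1 + 1)} :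
    p ∈ M.bdryFacets T ↔ ¬∃ q, M.Shared T p q := by simp [bdryFacets]

theorem mem_faces {e : M.Face} : e ∈ M.faces T ↔ M.face e ⊆ frontier (M.cell T) := by
  simp [faces]

theorem mem_facets {e : M.Face} {p : M.Sub T × Fin (n + 1 + 1)} :
    p ∈ M.facets T e ↔ facet (M.simplex T p.1) p.2 ⊆ M.face e := by
  simp [facets]

namespace Shared

variable {p q q' : M.Sub T × Fin (n + 1 + 1)}

theorem symm (h : M.Shared T p q) : M.Shared T q p := ⟨h.1.symm, h.2.symm⟩

theorem outwardNormal_eq (h : M.Shared T p q) :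
    outwardNormal (M.simplex T q.1) q.2 = -outwardNormal (M.simplex T p.1) p.2 :=
  outwardNormal_eq_neg h.2 (M.sub_disjoint T _ _ h.1)

theorem facet_eq (h : M.Shared T p q) :
    facet (M.simplex T p.1) p.2 = facet (M.simplex T q.1) q.2 := facet_congr h.2

/-- Two different partners would both have normal `-n`, yet, sharing the same facet, they would also
have opposite normals. -/
theorem unique (h : M.Shared T p q) (h' : M.Shared T p q') : q = q' := by
  have h2 := h.2.symm.trans h'.2
  by_cases hq : q.1 = q'.1
  · obtain ⟨j, b⟩ := q
    obtain ⟨j', b'⟩ := q'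
    simp only at hq
    subst hq
    exact congrArg (Prod.mk j) (facetVertices_injective _ h2)
  · exfalso
    have e1 := h.outwardNormal_eq
    have e2 := h'.outwardNormal_eq
    have e3 := outwardNormal_eq_neg h2 (M.sub_disjoint T _ _ hq)
    rw [e1, e2, neg_neg] at e3
    have h0 := congrArg (inner ℝ (outwardNormal (M.simplex T p.1) p.2)) e3
    rw [inner_neg_right, real_inner_self_eq_norm_sq, norm_outwardNormal] at h0
    norm_num at h0

theorem mem_interior (h : M.Shared T p q) {x : Pt (n + 1)}
    (hx0 : bc (M.simplex T p.1) p.2 x = 0)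
    (hx : ∀ c, c ≠ p.2 → 0 < bc (M.simplex T p.1) c x) : x ∈ interior (M.cell T) := by
  refine interior_mono ?_
    (mem_interior_union_of_facetVertices_eq h.2 (M.sub_disjoint T _ _ h.1) hx0 hx)
  rw [M.cell_eq]
  exact Set.union_subset (Set.subset_iUnion_of_subset p.1 subset_rfl)
    (Set.subset_iUnion_of_subset q.1 subset_rfl)

end Shared

variable (M T)

theorem body_subset_cell (i : M.Sub T) : body (M.simplex T i) ⊆ M.cell T := by
  rw [M.cell_eq]
  exact Set.subset_iUnion_of_subset i subset_rfl

theorem isCompact_cell : IsCompact (M.cell T) := by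
  rw [M.cell_eq]
  exact isCompact_iUnion fun i => isCompact_body _

variable {M T}

theorem exists_shared_of_mem_body {p : M.Sub T × Fin (n + 1 + 1)} {x : Pt (n + 1)}
    (hx0 : bc (M.simplex T p.1) p.2 x = 0)
    (hx : ∀ c, c ≠ p.2 → 0 < bc (M.simplex T p.1) c x) {j : M.Sub T} (hj : j ≠ p.1)
    (hxj : x ∈ body (M.simplex T j)) : ∃ q, M.Shared T p q := by
  obtain ⟨b, hb⟩ := exists_facetVertices_eq (M.sub_conforming T p.1 j) hx0 hx hxj
  exact ⟨(j, b), hj.symm, hb⟩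

/-- By conformity no other simplex contains a relative interior point of an unshared facet. Were
that point interior to the cell, it would be interior to its own simplex, where `λ_a > 0`. The whole
facet follows by closure. -/
theorem facet_subset_frontier {p : M.Sub T × Fin (n + 1 + 1)} (hp : p ∈ M.bdryFacets T) :
    facet (M.simplex T p.1) p.2 ⊆ frontier (M.cell T) := by
  refine (facet_subset_closure _ _).trans (closure_minimal ?_ isClosed_frontier)
  rintro x ⟨hx0, hx⟩
  have hxF : x ∈ facet (M.simplex T p.1) p.2 := (mem_facet _).2 ⟨hx0, fun c => by
    by_cases hc : c = p.2
    · rw [hc, hx0]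
    · exact (hx c hc).le⟩
  have hxC : x ∈ M.cell T := M.body_subset_cell T p.1 (facet_subset_body _ _ hxF)
  refine ⟨subset_closure hxC, fun hintg => ?_⟩
  have hev : ∀ᶠ y in nhds x, ∀ j, j ≠ p.1 → y ∉ body (M.simplex T j) := by
    rw [Filter.eventually_all]
    intro j
    by_cases hj : j = p.1
    · exact Filter.Eventually.of_forall fun r hr => (hr hj).elim
    · have : x ∉ body (M.simplex T j) := fun hxj =>
        mem_bdryFacets.1 hp (exists_shared_of_mem_body hx0 hx hj hxj)
      exact Filter.Eventually.mono ((isCompact_body _).isClosed.isOpen_compl.mem_nhds this)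
        fun r hr _ => hr
  have hev2 : ∀ᶠ y in nhds x, y ∈ body (M.simplex T p.1) := by
    filter_upwards [hev, mem_interior_iff_mem_nhds.1 hintg] with y hy hyC
    rw [M.cell_eq] at hyC
    obtain ⟨j, hj⟩ := Set.mem_iUnion.1 hyC
    by_cases hjp : j = p.1
    · exact hjp ▸ hj
    · exact (hy j hjp hj).elim
  have := (mem_interior_body _).1 (mem_interior_iff_mem_nhds.2 hev2) p.2
  exact this.ne' hx0

theorem mem_bdryFacets_of_subset_frontier {p : M.Sub T × Fin (n + 1 + 1)}
    (hp : facet (M.simplex T p.1) p.2 ⊆ frontier (M.cell T)) : p ∈ M.bdryFacets T := by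
  rw [mem_bdryFacets]
  rintro ⟨q, hq⟩
  obtain ⟨x, hx0, hx⟩ := exists_relint_facet (M.simplex T p.1) p.2
  have hxF : x ∈ facet (M.simplex T p.1) p.2 := (mem_facet _).2 ⟨hx0, fun c => by
    by_cases hc : c = p.2
    · rw [hc, hx0]
    · exact (hx c hc).le⟩
  exact (hp hxF).2 (hq.mem_interior hx0 hx)

theorem facets_subset_bdryFacets {e : M.Face} (he : e ∈ M.faces T) :
    M.facets T e ⊆ M.bdryFacets T := fun _ hp =>
  mem_bdryFacets_of_subset_frontier ((mem_facets.1 hp).trans (mem_faces.1 he))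

/-- Boundary facets do not overlap. -/
theorem eq_of_mem_facet {p q : M.Sub T × Fin (n + 1 + 1)} (hp : p ∈ M.bdryFacets T)
    {x : Pt (n + 1)} (hx0 : bc (M.simplex T p.1) p.2 x = 0)
    (hx : ∀ c, c ≠ p.2 → 0 < bc (M.simplex T p.1) c x)
    (hxq : x ∈ facet (M.simplex T q.1) q.2) : p = q := by
  by_cases h1 : q.1 = p.1
  · obtain ⟨i, a⟩ := p
    obtain ⟨j, b⟩ := q
    simp only at h1
    subst h1
    by_cases hb : b = a
    · rw [hb]
    · exact ((hx b hb).ne' ((mem_facet _).1 hxq).1).elim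
  · exact (mem_bdryFacets.1 hp
      (exists_shared_of_mem_body hx0 hx h1 (facet_subset_body _ _ hxq))).elim

theorem mem_iUnion_facets {e : M.Face} (he : e ∈ M.faces T) {x : Pt (n + 1)} :
    x ∈ M.face e ↔ ∃ p ∈ M.facets T e, x ∈ facet (M.simplex T p.1) p.2 := by
  constructor
  · intro hx
    rw [M.face_eq T e (mem_faces.1 he)] at hx
    obtain ⟨p, hp⟩ := Set.mem_iUnion.1 hx
    obtain ⟨hp', hxp⟩ := Set.mem_iUnion.1 hp
    exact ⟨p, mem_facets.2 hp', hxp⟩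
  · rintro ⟨p, hp, hx⟩
    exact mem_facets.1 hp hx

/-- A relative interior point of the facet lies in some face, hence in one of the facets composing
that face; boundary facets do not overlap, so this is the facet itself. -/
theorem exists_face_of_mem_bdryFacets {p : M.Sub T × Fin (n + 1 + 1)} (hp : p ∈ M.bdryFacets T) :
    ∃ e ∈ M.faces T, p ∈ M.facets T e := by
  obtain ⟨x, hx0, hx⟩ := exists_relint_facet (M.simplex T p.1) p.2
  have hxF : x ∈ facet (M.simplex T p.1) p.2 := (mem_facet _).2 ⟨hx0, fun c => by
    by_cases hc : c = p.2
    · rw [hc, hx0]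
    · exact (hx c hc).le⟩
  have h1 := facet_subset_frontier hp hxF
  rw [M.frontier_eq] at h1
  obtain ⟨e, he⟩ := Set.mem_iUnion.1 h1
  obtain ⟨he', hxe⟩ := Set.mem_iUnion.1 he
  have heT : e ∈ M.faces T := mem_faces.2 he'
  obtain ⟨q, hq, hxq⟩ := (mem_iUnion_facets heT).1 hxe
  exact ⟨e, heT, eq_of_mem_facet hp hx0 hx hxq ▸ hq⟩

/-- Two faces containing the same facet would overlap in positive area. -/
theorem face_unique {p : M.Sub T × Fin (n + 1 + 1)} {e e' : M.Face} (h : p ∈ M.facets T e)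
    (h' : p ∈ M.facets T e') : e = e' := by
  by_contra hne
  have h0 := M.face_overlap e e' hne
  rw [Nat.add_sub_cancel] at h0
  have h1 := measure_mono_null
    (Set.subset_inter (mem_facets.1 h) (mem_facets.1 h')) h0
  have := area_pos (M.simplex T p.1) p.2
  rw [area, Measure.real, h1] at this
  simp at this

theorem sum_faces_facets (F : M.Sub T × Fin (n + 1 + 1) → ℝ) :
    ∑ e ∈ M.faces T, ∑ p ∈ M.facets T e, F p = ∑ p ∈ M.bdryFacets T, F p := by
  classical
  have hU : M.bdryFacets T = (M.faces T).biUnion fun e => M.facets T e := by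
    ext p
    rw [Finset.mem_biUnion]
    exact ⟨exists_face_of_mem_bdryFacets, fun ⟨e, he, hp⟩ => facets_subset_bdryFacets he hp⟩
  rw [hU, Finset.sum_biUnion]
  intro e _ e' _ hne
  exact Finset.disjoint_left.2 fun p hp hp' => hne (face_unique hp hp')

open scoped Classical in
/-- The face function seen from a boundary facet. -/
def traceFun (vb : M.Face → Pt (n + 1) → ℝ) (p : M.Sub T × Fin (n + 1 + 1)) : Pt (n + 1) → ℝ :=
  if h : ∃ e, p ∈ M.facets T e then vb h.choose else 0

theorem traceFun_eq (vb : M.Face → Pt (n + 1) → ℝ) {p : M.Sub T × Fin (n + 1 + 1)} {e : M.Face}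
    (h : p ∈ M.facets T e) : traceFun vb p = vb e := by
  have h' : ∃ e, p ∈ M.facets T e := ⟨e, h⟩
  rw [traceFun, dif_pos h', face_unique h h'.choose_spec]

/-- Each facet off the boundary has exactly one partner, so sharing is an involution without fixed
points under which the terms cancel. -/
theorem sum_shared_cancel (F : M.Sub T × Fin (n + 1 + 1) → ℝ)
    (hF : ∀ p q, M.Shared T p q → F p + F q = 0) :
    ∑ p, F p = ∑ p ∈ M.bdryFacets T, F p := by
  classical
  rw [← Finset.sum_filter_add_sum_filter_not Finset.univ (fun p => ¬∃ q, M.Shared T p q) F,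
    bdryFacets]
  simp only [not_not, add_eq_left]
  have hch : ∀ p ∈ Finset.univ.filter fun p => ∃ q, M.Shared T p q, ∃ q, M.Shared T p q :=
    fun p hp => (Finset.mem_filter.1 hp).2
  refine Finset.sum_involution (fun p hp => (hch p hp).choose)
    (fun p hp => hF _ _ (hch p hp).choose_spec) (fun p hp _ h => ?_) (fun p hp => ?_)
    (fun p hp => ?_)
  · exact (hch p hp).choose_spec.1 (by rw [h])
  · exact Finset.mem_filter.2 ⟨Finset.mem_univ _, p, (hch p hp).choose_spec.symm⟩
  · have hq : ∃ q', M.Shared T (hch p hp).choose q' := ⟨p, (hch p hp).choose_spec.symm⟩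
    exact hq.choose_spec.unique (hch p hp).choose_spec.symm

theorem ae_disjoint_body {i j : M.Sub T} (hij : i ≠ j) :
    volume (body (M.simplex T i) ∩ body (M.simplex T j)) = 0 := by
  have hsub : body (M.simplex T i) ∩ body (M.simplex T j) ⊆
      frontier (body (M.simplex T i)) ∪ frontier (body (M.simplex T j)) := by
    rintro x ⟨h1, h2⟩
    by_cases hx : x ∈ interior (body (M.simplex T i))
    · refine Or.inr ⟨subset_closure h2, fun h => ?_⟩
      exact Set.disjoint_left.1 (M.sub_disjoint T i j hij) hx h
    · exact Or.inl ⟨subset_closure h1, hx⟩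
  exact measure_mono_null hsub (measure_union_null ((convex_body _).addHaar_frontier volume)
    ((convex_body _).addHaar_frontier volume))

theorem setIntegral_cell {f : Pt (n + 1) → ℝ} (hf : IntegrableOn f (M.cell T)) :
    ∫ x in M.cell T, f x = ∑ i, ∫ x in body (M.simplex T i), f x := by
  rw [M.cell_eq] at hf ⊢
  rw [integral_iUnion_ae (fun i => (measurableSet_body _).nullMeasurableSet)
    (fun i j hij => ae_disjoint_body hij) hf, tsum_fintype]

theorem integrableOn_cell {f : Pt (n + 1) → ℝ} (hf : Continuous f) : IntegrableOn f (M.cell T) :=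
  hf.continuousOn.integrableOn_compact (M.isCompact_cell T)

theorem aedisjoint_facet {p q : M.Sub T × Fin (n + 1 + 1)} (hp : p ∈ M.bdryFacets T)
    (hpq : p ≠ q) :
    μHE[n] (facet (M.simplex T p.1) p.2 ∩ facet (M.simplex T q.1) q.2) = 0 := by
  have h := ae_facet_pos (M.simplex T p.1) p.2
  have h2 : ∀ᵐ x ∂((μHE[n]).restrict (facet (M.simplex T p.1) p.2)),
      x ∉ facet (M.simplex T q.1) q.2 := by
    filter_upwards [h] with x hx hxq
    exact hpq (eq_of_mem_facet hp ((mem_facet _).1 hx.1).1 hx.2 hxq)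
  rw [ae_iff] at h2
  simp only [not_not] at h2
  rw [Set.inter_comm]
  rwa [← Measure.restrict_apply (measurableSet_facet _ _)]

theorem setIntegral_face {e : M.Face} (he : e ∈ M.faces T) {f : Pt (n + 1) → ℝ}
    (hf : ∀ p ∈ M.facets T e, IntegrableOn f (facet (M.simplex T p.1) p.2) μHE[n]) :
    ∫ x in M.face e, f x ∂μHE[n] =
      ∑ p ∈ M.facets T e, ∫ x in facet (M.simplex T p.1) p.2, f x ∂μHE[n] := by
  have hE : M.face e = ⋃ p : M.facets T e, facet (M.simplex T p.1.1) p.1.2 := by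
    ext x
    rw [mem_iUnion_facets he, Set.mem_iUnion]
    simp
  rw [hE, integral_iUnion_ae (fun p => (measurableSet_facet _ _).nullMeasurableSet)
    (fun p q hpq => ?_) ?_, tsum_fintype, Finset.univ_eq_attach,
    Finset.sum_attach (M.facets T e) fun p => ∫ x in facet (M.simplex T p.1) p.2, f x ∂μHE[n]]
  · rw [integrableOn_finite_iUnion]
    exact fun p => hf p.1 p.2
  · exact aedisjoint_facet (facets_subset_bdryFacets he p.2) fun h => hpq (Subtype.ext h)

end PolytopalMesh

end WG

end

/-! ### Weak divergence and integration by parts on a cell -/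

noncomputable section

namespace WG

variable {n : ℕ}

/-- Take a smooth `ψ ≥ 0` whose support is exactly `U` and compose `N ψ - 1` with a smooth step: the
result is zero where `N ψ ≤ 1` and one where `N ψ ≥ 2`. -/
theorem exists_cutoff {U : Set (Pt (n + 1))} (hU : IsOpen U) (hK : ∃ K, IsCompact K ∧ U ⊆ K) :
    ∃ χ : ℕ → Pt (n + 1) → ℝ, (∀ N, ContDiff ℝ ∞ (χ N)) ∧ (∀ N, HasCompactSupport (χ N)) ∧
      (∀ N, tsupport (χ N) ⊆ U) ∧ (∀ N x, |χ N x| ≤ 1) ∧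
      ∀ x ∈ U, Filter.Tendsto (fun N => χ N x) Filter.atTop (nhds 1) := by
  obtain ⟨ψ, hψs, hψ, hψr⟩ := hU.exists_contDiff_support_eq (n := ⊤)
  have hts : ∀ N : ℕ, tsupport (fun x => Real.smoothTransition (N * ψ x - 1)) ⊆ U := by
    intro N
    have h1 : tsupport (fun x => Real.smoothTransition (N * ψ x - 1)) ⊆ {x | 1 ≤ N * ψ x} := by
      refine closure_minimal (fun x hx => ?_)
        (isClosed_le continuous_const (continuous_const.mul hψ.continuous))
      by_contra hlt
      simp only [Set.mem_ofPred_eq, not_le] at hlt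
      exact hx (Real.smoothTransition.zero_of_nonpos (by linarith))
    refine h1.trans fun x hx => ?_
    rw [← hψs, Function.mem_support]
    intro h0
    simp only [Set.mem_ofPred_eq, h0, mul_zero] at hx
    linarith
  refine ⟨fun N x => Real.smoothTransition (N * ψ x - 1), fun N => ?_, fun N => ?_, hts,
    fun N x => ?_, fun x hx => ?_⟩
  · exact Real.smoothTransition.contDiff.comp ((contDiff_const.mul hψ).sub contDiff_const)
  · obtain ⟨K, hK, hUK⟩ := hK
    exact hK.of_isClosed_subset (isClosed_tsupport _) ((hts N).trans hUK)
  · rw [abs_of_nonneg (Real.smoothTransition.nonneg _)]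
    exact Real.smoothTransition.le_one _
  · have hpos : 0 < ψ x := by
      have h0 : ψ x ≠ 0 := by rw [← Function.mem_support, hψs]; exact hx
      exact lt_of_le_of_ne (hψr ⟨x, rfl⟩).1 h0.symm
    obtain ⟨N₀, hN₀⟩ := exists_nat_gt (2 / ψ x)
    refine tendsto_const_nhds.congr' ?_
    filter_upwards [Filter.eventually_ge_atTop N₀] with N hN
    refine (Real.smoothTransition.one_of_one_le ?_).symm
    have h1 : (N₀ : ℝ) ≤ N := by exact_mod_cast hN
    have h2 := (div_lt_iff₀ hpos).1 (hN₀.trans_le h1)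
    linarith

/-- Definiteness makes the map into the dual space injective, and equal finite dimensions make it
surjective. -/
theorem existsUnique_of_posDef {V : Type*} [AddCommGroup V] [Module ℝ V] [FiniteDimensional ℝ V]
    (B : V →ₗ[ℝ] V →ₗ[ℝ] ℝ) (hpos : ∀ v, B v v = 0 → v = 0) (L : V →ₗ[ℝ] ℝ) :
    ∃! u, ∀ v, B u v = L v := by
  have hinj : Function.Injective B := by
    rw [← LinearMap.ker_eq_bot, LinearMap.ker_eq_bot']
    intro u hu
    exact hpos u (by rw [hu]; rfl)
  have hsurj : Function.Surjective B :=
    (LinearMap.injective_iff_surjective_of_finrank_eq_finrank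
      (Subspace.dual_finrank_eq (K := ℝ) (V := V)).symm).1 hinj
  obtain ⟨u, hu⟩ := hsurj L
  refine ⟨u, fun v => by rw [hu], fun u' hu' => hinj ?_⟩
  rw [hu]
  exact LinearMap.ext hu'

theorem continuous_of_components {m : ℕ} {q : Pt (n + 1) → Pt (n + 1)}
    (hq : ∀ l, (fun x => q x l) ∈ polySpace (n + 1) m) : Continuous q := by
  refine (PiLp.continuous_toLp 2 _).comp (continuous_pi fun l => ?_)
  exact continuous_of_mem_polySpace (hq l)

theorem inner_gradient_eq (φ : Pt (n + 1) → ℝ) (x u : Pt (n + 1)) :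
    inner ℝ u (gradient φ x) = fderiv ℝ φ x u := by
  rw [real_inner_comm, inner_gradient_left]

namespace PolytopalMesh

variable {Ω : Set (Pt (n + 1))} {M : PolytopalMesh (n + 1) Ω} {T : M.Cell}

theorem ae_mem_interior_cell (i : M.Sub T) :
    ∀ᵐ x ∂(volume.restrict (body (M.simplex T i))), x ∈ interior (M.cell T) := by
  have h1 : ∀ᵐ x ∂(volume.restrict (body (M.simplex T i))), x ∈ body (M.simplex T i) :=
    ae_restrict_mem (measurableSet_body _)
  have h2 : ∀ᵐ x ∂(volume.restrict (body (M.simplex T i))),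
      x ∉ frontier (body (M.simplex T i)) := by
    refine ae_restrict_of_ae ?_
    rw [ae_iff]
    simp only [not_not]
    exact (convex_body _).addHaar_frontier volume
  filter_upwards [h1, h2] with x hx1 hx2
  refine interior_mono (M.body_subset_cell T i) ?_
  by_contra h
  exact hx2 ⟨subset_closure hx1, h⟩

theorem sum_sub_vertex (F : M.Sub T × Fin (n + 1 + 1) → ℝ) : ∑ p, F p = ∑ i, ∑ a, F (i, a) :=
  Fintype.sum_prod_type F

/-- Integration by parts on a cell for a piecewise polynomial field with a weak divergence. -/
theorem IsWeakDiv.integral_by_parts {m : ℕ} {q : M.PwField T} {p : Pt (n + 1) → ℝ}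
    (h : M.IsWeakDiv T q p) (hq : ∀ i, ∀ l, (fun x => q i x l) ∈ polySpace (n + 1) m)
    (hp : Continuous p) {w : Pt (n + 1) → ℝ} (hw : ContDiff ℝ ∞ w) :
    (∑ i, ∫ x in body (M.simplex T i), fderiv ℝ w x (q i x)) + ∫ x in M.cell T, p x * w x =
      ∑ b ∈ M.bdryFacets T, ∫ x in facet (M.simplex T b.1) b.2,
        w x * inner ℝ (q b.1 x) (outwardNormal (M.simplex T b.1) b.2) ∂μHE[n] := by
  classical
  obtain ⟨χ, hχ, hχc, hχs, hχ1, hχlim⟩ := exists_cutoff (isOpen_interior (s := M.cell T))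
    ⟨_, M.isCompact_cell T, interior_subset⟩
  choose r _ hr using fun i => exists_green (s := M.simplex T i) (hq i)
  have hqc : ∀ i, Continuous (q i) := fun i => (hr i).continuous_field
  have hwc := hw.continuous
  set N₁ : M.Sub T × Fin (n + 1 + 1) → (Pt (n + 1) → ℝ) → ℝ := fun b φ =>
    ∫ x in facet (M.simplex T b.1) b.2,
      φ x * inner ℝ (q b.1 x) (outwardNormal (M.simplex T b.1) b.2) ∂μHE[n] with hN₁
  have hgreen : ∀ φ : Pt (n + 1) → ℝ, ContDiff ℝ 1 φ →
      (∑ i, ∫ x in body (M.simplex T i), fderiv ℝ φ x (q i x)) +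
        (∑ i, ∫ x in body (M.simplex T i), r i x * φ x) = ∑ b, N₁ b φ := by
    intro φ hφ
    rw [← Finset.sum_add_distrib, sum_sub_vertex]
    exact Finset.sum_congr rfl fun i _ => (hr i).formula φ hφ
  have hle1 : (1 : WithTop ℕ∞) ≤ (∞ : WithTop ℕ∞) := by exact_mod_cast le_top
  have hcell : ∀ φ : Pt (n + 1) → ℝ, Continuous φ → ∫ x in M.cell T, p x * φ x =
      ∑ i, ∫ x in body (M.simplex T i), p x * φ x := fun φ hφ =>
    setIntegral_cell (integrableOn_cell (hp.mul hφ))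
  have hsplit : ∀ φ : Pt (n + 1) → ℝ, ∑ b, N₁ b φ = (∑ b ∈ M.bdryFacets T, N₁ b φ) +
      ∑ b ∈ (M.bdryFacets T)ᶜ, N₁ b φ := fun φ => (Finset.sum_add_sum_compl _ _).symm
  -- Subtract the weak divergence identity from Green's formulas, both tested with `χ_N w`. The
  -- gradient terms cancel, so the gradients of the cut-offs, which need not stay bounded, never
  -- have to be estimated.
  have hχw : ∀ N, (∑ i, ∫ x in body (M.simplex T i), r i x * (χ N x * w x)) -
      (∑ i, ∫ x in body (M.simplex T i), p x * (χ N x * w x)) =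
        ∑ b ∈ (M.bdryFacets T)ᶜ, N₁ b (fun x => χ N x * w x) := by
    intro N
    have hsm : ContDiff ℝ ∞ fun x => χ N x * w x := (hχ N).mul hw
    have h1 := hgreen _ (hsm.of_le hle1)
    have hsub : tsupport (fun x => χ N x * w x) ⊆ interior (M.cell T) :=
      (closure_mono (Function.support_mul_subset_left _ _)).trans (hχs N)
    have h2 := h _ hsm ((hχc N).mul_right) hsub
    simp only [inner_gradient_eq] at h2
    rw [h2, hcell _ hsm.continuous, hsplit, Finset.sum_eq_zero (s := M.bdryFacets T)] at h1
    · linarith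
    · intro b hb
      rw [hN₁]
      refine setIntegral_eq_zero_of_forall_eq_zero fun x hx => ?_
      have : x ∉ tsupport (fun x => χ N x * w x) := fun hx' =>
        (facet_subset_frontier hb hx).2 (hsub hx')
      have h0 := image_eq_zero_of_notMem_tsupport this
      simp only at h0 ⊢
      rw [h0, zero_mul]
  have hlim1 : ∀ f : Pt (n + 1) → ℝ, Continuous f → ∀ i, Filter.Tendsto
      (fun N => ∫ x in body (M.simplex T i), f x * (χ N x * w x)) Filter.atTop
      (nhds (∫ x in body (M.simplex T i), f x * w x)) := by
    intro f hf i
    refine tendsto_integral_of_dominated_convergence (fun x => |f x * w x|)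
      (fun N => ((hf.mul ((hχ N).continuous.mul hwc))).aestronglyMeasurable)
      (integrableOn_body _ (hf.mul hwc)).abs (fun N => ?_) ?_
    · refine Filter.Eventually.of_forall fun x => ?_
      rw [Real.norm_eq_abs, abs_mul, abs_mul, abs_mul]
      have := hχ1 N x
      gcongr
      exact mul_le_of_le_one_left (abs_nonneg _) this
    · filter_upwards [ae_mem_interior_cell i] with x hx
      simpa using ((hχlim x hx).mul_const (w x)).const_mul (f x)
  -- Almost every point of a shared facet is interior to the cell, so the cut-offs tend to one
  -- there.
  have hlim2 : ∀ b ∈ (M.bdryFacets T)ᶜ, Filter.Tendsto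
      (fun N => N₁ b (fun x => χ N x * w x)) Filter.atTop (nhds (N₁ b w)) := by
    intro b hb
    obtain ⟨c, hc⟩ : ∃ c, M.Shared T b c := by
      by_contra hn
      exact Finset.mem_compl.1 hb (mem_bdryFacets.2 hn)
    have hic : Continuous fun x => inner ℝ (q b.1 x) (outwardNormal (M.simplex T b.1) b.2) :=
      (hqc b.1).inner continuous_const
    refine tendsto_integral_of_dominated_convergence
      (fun x => |w x * inner ℝ (q b.1 x) (outwardNormal (M.simplex T b.1) b.2)|)
      (fun N => ((((hχ N).continuous.mul hwc)).mul hic).aestronglyMeasurable)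
      (integrableOn_facet _ _ (hwc.mul hic)).abs (fun N => ?_) ?_
    · refine Filter.Eventually.of_forall fun x => ?_
      rw [Real.norm_eq_abs, abs_mul, abs_mul, abs_mul]
      have := hχ1 N x
      gcongr
      exact mul_le_of_le_one_left (abs_nonneg _) this
    · filter_upwards [ae_facet_pos (M.simplex T b.1) b.2] with x hx
      have hx' := hc.mem_interior ((mem_facet _).1 hx.1).1 hx.2
      simpa using ((hχlim x hx').mul_const (w x)).mul_const _
  have hL := (tendsto_finsetSum Finset.univ fun i _ => hlim1 (r i) (hr i).continuous_div i).sub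
    (tendsto_finsetSum Finset.univ fun i _ => hlim1 p hp i)
  have hR := tendsto_finsetSum _ hlim2
  have heq := tendsto_nhds_unique (hL.congr hχw) hR
  -- The limit compares the elementwise divergences with `p` and the flux jumps; inserting it into
  -- Green's formula for `w` leaves only the boundary facets.
  have hw1 := hgreen w (hw.of_le hle1)
  rw [hsplit] at hw1
  rw [hcell w hwc]
  change _ = ∑ b ∈ M.bdryFacets T, N₁ b w
  linarith

/-- Subtract the two integrations by parts and test with `p - p'`. -/
theorem IsWeakDiv.unique {m k : ℕ} {q : M.PwField T} {p p' : Pt (n + 1) → ℝ}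
    (h : M.IsWeakDiv T q p) (h' : M.IsWeakDiv T q p')
    (hq : ∀ i, ∀ l, (fun x => q i x l) ∈ polySpace (n + 1) m)
    (hp : p ∈ polySpace (n + 1) k) (hp' : p' ∈ polySpace (n + 1) k) : p = p' := by
  have hw : (fun x => p x - p' x) ∈ polySpace (n + 1) k := sub_mem_polySpace hp hp'
  have hc := continuous_of_mem_polySpace hp
  have hc' := continuous_of_mem_polySpace hp'
  have hwc := continuous_of_mem_polySpace hw
  have e1 := h.integral_by_parts hq hc (contDiff_of_mem_polySpace hw)
  have e2 := h'.integral_by_parts hq hc' (contDiff_of_mem_polySpace hw)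
  have e3 : ∫ x in M.cell T, (p x - p' x) ^ 2 = 0 := by
    have : ∫ x in M.cell T, (p x - p' x) ^ 2 = (∫ x in M.cell T, p x * (p x - p' x)) -
        ∫ x in M.cell T, p' x * (p x - p' x) := by
      rw [← integral_sub (f := fun x => p x * (p x - p' x)) (g := fun x => p' x * (p x - p' x))
        (integrableOn_cell (hc.mul hwc)) (integrableOn_cell (hc'.mul hwc))]
      congr 1
      ext x
      ring
    rw [this]; linarith
  rw [setIntegral_cell (integrableOn_cell (f := fun x => (p x - p' x) ^ 2) (hwc.pow 2))] at e3
  have i := Classical.arbitrary (M.Sub T)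
  have e4 := (Finset.sum_eq_zero_iff_of_nonneg fun i _ =>
    integral_nonneg fun x => sq_nonneg (p x - p' x)).1 e3 i (Finset.mem_univ i)
  have e5 := eq_zero_of_integral_body_sq_eq_zero (M.simplex T i) hw e4
  ext x
  exact sub_eq_zero.1 (congrFun e5 x)

/-- A piecewise field whose normal components match on common facets has a weak divergence. -/
theorem isWeakDiv_of_green {q : M.PwField T} {p : Pt (n + 1) → ℝ}
    (h : ∀ i, Green (M.simplex T i) (q i) p)
    (hm : ∀ b c, M.Shared T b c → ∀ x ∈ facet (M.simplex T b.1) b.2,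
      inner ℝ (q b.1 x) (outwardNormal (M.simplex T b.1) b.2) +
        inner ℝ (q c.1 x) (outwardNormal (M.simplex T c.1) c.2) = 0) : M.IsWeakDiv T q p := by
  intro φ hφ _ hsupp
  have hle1 : (1 : WithTop ℕ∞) ≤ (∞ : WithTop ℕ∞) := by exact_mod_cast le_top
  obtain ⟨i₀⟩ := M.subNonempty T
  have hp := (h i₀).continuous_div
  simp only [inner_gradient_eq]
  rw [setIntegral_cell (f := fun x => p x * φ x) (integrableOn_cell (hp.mul hφ.continuous)),
    eq_neg_iff_add_eq_zero,
    ← Finset.sum_add_distrib,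
    Finset.sum_congr rfl fun i _ => (h i).formula φ (hφ.of_le hle1),
    ← sum_sub_vertex (fun b => ∫ x in facet (M.simplex T b.1) b.2,
      φ x * inner ℝ (q b.1 x) (outwardNormal (M.simplex T b.1) b.2) ∂μHE[n]),
    -- Matching normal components cancel on shared facets, and on boundary facets the test function
    -- is zero.
    sum_shared_cancel]
  · refine Finset.sum_eq_zero fun b hb => setIntegral_eq_zero_of_forall_eq_zero fun x hx => ?_
    have : x ∉ tsupport φ := fun hx' => (facet_subset_frontier hb hx).2 (hsupp hx')
    rw [image_eq_zero_of_notMem_tsupport this, zero_mul]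
  · intro b c hbc
    have hic : ∀ b : M.Sub T × Fin (n + 1 + 1), Continuous fun x =>
        φ x * inner ℝ (q b.1 x) (outwardNormal (M.simplex T b.1) b.2) := fun b =>
      hφ.continuous.mul ((h b.1).continuous_field.inner continuous_const)
    have hf := hbc.facet_eq
    rw [← hf, ← integral_add (integrableOn_facet _ _ (hic b)) (by
      have := integrableOn_facet (M.simplex T c.1) c.2 (hic c)
      rwa [← hf] at this)]
    refine setIntegral_eq_zero_of_forall_eq_zero fun x hx => ?_
    rw [← mul_add, hm b c hbc x hx, mul_zero]

end PolytopalMesh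

end WG

end

/-! ### The weak gradient: existence, uniqueness, linearity -/

noncomputable section

namespace WG

variable {n : ℕ}

theorem continuous_gradient {φ : Pt (n + 1) → ℝ} (hφ : ContDiff ℝ 1 φ) : Continuous (gradient φ) :=
  (InnerProductSpace.toDual ℝ (Pt (n + 1))).symm.continuous.comp
    (hφ.continuous_fderiv (by simp))

namespace PolytopalMesh

variable {Ω : Set (Pt (n + 1))} {M : PolytopalMesh (n + 1) Ω} {T : M.Cell}

theorem pwInner_comm (g q : M.PwField T) : M.pwInner T g q = M.pwInner T q g := by
  simp only [pwInner, real_inner_comm]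

theorem pwInner_add_left {g g' q : M.PwField T} (hg : ∀ i, Continuous (g i))
    (hg' : ∀ i, Continuous (g' i)) (hq : ∀ i, Continuous (q i)) :
    M.pwInner T (g + g') q = M.pwInner T g q + M.pwInner T g' q := by
  simp only [pwInner]
  rw [← Finset.sum_add_distrib]
  refine Finset.sum_congr rfl fun i _ => ?_
  rw [← integral_add (integrableOn_body _ ((hg i).inner (hq i)))
    (integrableOn_body _ ((hg' i).inner (hq i)))]
  simp only [Pi.add_apply, inner_add_left]

theorem pwInner_smul_left (c : ℝ) (g q : M.PwField T) :
    M.pwInner T (c • g) q = c * M.pwInner T g q := by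
  simp only [pwInner, Finset.mul_sum, Pi.smul_apply, real_inner_smul_left, integral_const_mul]

theorem pwInner_self (g : M.PwField T) :
    M.pwInner T g g = ∑ i, ∫ x in body (M.simplex T i), ‖g i x‖ ^ 2 := by
  simp only [pwInner, real_inner_self_eq_norm_sq]

theorem eq_zero_of_pwInner_self {m : ℕ} {g : M.PwField T}
    (hg : ∀ i, ∀ l, (fun x => g i x l) ∈ polySpace (n + 1) m) (h : M.pwInner T g g = 0) :
    g = 0 := by
  rw [pwInner_self] at h
  have h1 := (Finset.sum_eq_zero_iff_of_nonneg fun i _ =>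
    integral_nonneg fun x => sq_nonneg ‖g i x‖).1 h
  ext i x l
  have h2 := eqOn_zero_of_integral_body_eq_zero _ (f := fun x => ‖g i x‖ ^ 2)
    ((continuous_of_components (hg i)).norm.pow 2)
    (fun x _ => sq_nonneg _) (h1 i (Finset.mem_univ i))
  have h3 := eq_zero_of_eqOn_open (hg i l) isOpen_interior (interior_body_nonempty (M.simplex T i))
    fun x hx => by
      have h4 := h2 x (interior_subset hx)
      rw [pow_eq_zero_iff two_ne_zero, norm_eq_zero] at h4
      simp [h4]
  exact congrFun h3 x

theorem IsWeakDiv.add {q q' : M.PwField T} {p p' : Pt (n + 1) → ℝ} (h : M.IsWeakDiv T q p)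
    (h' : M.IsWeakDiv T q' p') (hq : ∀ i, Continuous (q i)) (hq' : ∀ i, Continuous (q' i))
    (hp : Continuous p) (hp' : Continuous p') : M.IsWeakDiv T (q + q') (p + p') := by
  intro φ hφ hc hs
  have hle1 : (1 : WithTop ℕ∞) ≤ (∞ : WithTop ℕ∞) := by exact_mod_cast le_top
  have hgc := continuous_gradient (hφ.of_le hle1)
  have h1 := pwInner_add_left hq hq' (M := M) (T := T) (q := fun _ => gradient φ) fun _ => hgc
  simp only [pwInner] at h1
  rw [h1, h φ hφ hc hs, h' φ hφ hc hs]
  have h2 : ∫ x in M.cell T, (p + p') x * φ x =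
      (∫ x in M.cell T, p x * φ x) + ∫ x in M.cell T, p' x * φ x := by
    rw [← integral_add (f := fun x => p x * φ x) (g := fun x => p' x * φ x)
      (integrableOn_cell (hp.mul hφ.continuous)) (integrableOn_cell (hp'.mul hφ.continuous))]
    simp only [Pi.add_apply, add_mul]
  rw [h2]; ring

theorem IsWeakDiv.smul {q : M.PwField T} {p : Pt (n + 1) → ℝ} (h : M.IsWeakDiv T q p) (c : ℝ) :
    M.IsWeakDiv T (c • q) (c • p) := by
  intro φ hφ hc hs
  have h1 := pwInner_smul_left (M := M) (T := T) c q fun _ => gradient φ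
  simp only [pwInner] at h1
  rw [h1, h φ hφ hc hs]
  simp only [Pi.smul_apply, smul_eq_mul, mul_assoc, integral_const_mul]
  ring

theorem isWeakDiv_zero : M.IsWeakDiv T 0 0 := by
  intro φ _ _ _
  simp

theorem continuous_of_mem_Lam {k : ℕ} {q : M.PwField T} (hq : q ∈ M.Lam k T) (i : M.Sub T) :
    Continuous (q i) := continuous_of_components (hq.1 i)

variable (M T) in
/-- `Λ_k(T)` as a vector space. -/
def lamSubmodule (k : ℕ) : Submodule ℝ (M.PwField T) where
  carrier := M.Lam k T
  zero_mem' := ⟨fun i l => Submodule.zero_mem _, ⟨0, Submodule.zero_mem _, isWeakDiv_zero⟩,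
    fun e _ => ⟨0, Submodule.zero_mem _, fun _ _ _ _ => by simp⟩⟩
  add_mem' := by
    intro q q' hq hq'
    have hc := fun i => continuous_of_mem_Lam hq i
    have hc' := fun i => continuous_of_mem_Lam hq' i
    obtain ⟨h1, ⟨p, hp, h2⟩, h3⟩ := hq
    obtain ⟨h1', ⟨p', hp', h2'⟩, h3'⟩ := hq'
    refine ⟨fun i l => add_mem_polySpace (h1 i l) (h1' i l), ⟨p + p', Submodule.add_mem _ hp hp',
      h2.add h2' hc hc' (continuous_of_mem_polySpace hp) (continuous_of_mem_polySpace hp')⟩,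
      fun e he => ?_⟩
    obtain ⟨g, hg, h4⟩ := h3 e he
    obtain ⟨g', hg', h4'⟩ := h3' e he
    refine ⟨g + g', Submodule.add_mem _ hg hg', fun ia hia x hx => ?_⟩
    simp only [Pi.add_apply, inner_add_left, h4 ia hia x hx, h4' ia hia x hx]
  smul_mem' := by
    rintro c q ⟨h1, ⟨p, hp, h2⟩, h3⟩
    refine ⟨fun i l => const_mul_mem_polySpace c (h1 i l), ⟨c • p, Submodule.smul_mem _ c hp,
      h2.smul c⟩, fun e he => ?_⟩
    obtain ⟨g, hg, h4⟩ := h3 e he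
    refine ⟨c • g, Submodule.smul_mem _ c hg, fun ia hia x hx => ?_⟩
    simp only [Pi.smul_apply, real_inner_smul_left, h4 ia hia x hx, smul_eq_mul]

instance finiteDimensional_lamSubmodule (k : ℕ) : FiniteDimensional ℝ (M.lamSubmodule T k) := by
  let F : M.lamSubmodule T k →ₗ[ℝ] (M.Sub T → Fin (n + 1) → polySpace (n + 1) (k + 1)) :=
    { toFun := fun q i l => ⟨fun x => q.1 i x l, q.2.1 i l⟩
      map_add' := fun _ _ => rfl
      map_smul' := fun _ _ => rfl }
  refine FiniteDimensional.of_injective F fun q q' h => ?_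
  ext i x l
  exact congrFun (congrArg Subtype.val (congrFun (congrFun h i) l)) x

/-- The `L²` inner product on `Λ_k(T)`. -/
def lamInner (k : ℕ) : M.lamSubmodule T k →ₗ[ℝ] M.lamSubmodule T k →ₗ[ℝ] ℝ :=
  LinearMap.mk₂ ℝ (fun g q => M.pwInner T g.1 q.1)
    (fun g g' q => pwInner_add_left (continuous_of_mem_Lam g.2) (continuous_of_mem_Lam g'.2)
      (continuous_of_mem_Lam q.2))
    (fun c g q => pwInner_smul_left c g.1 q.1)
    (fun g q q' => by
      rw [pwInner_comm, pwInner_comm g.1 q.1, pwInner_comm g.1 q'.1]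
      exact pwInner_add_left (continuous_of_mem_Lam q.2) (continuous_of_mem_Lam q'.2)
        (continuous_of_mem_Lam g.2))
    (fun c g q => by
      rw [pwInner_comm, pwInner_comm g.1 q.1]
      exact pwInner_smul_left c q.1 g.1)

/-- Every boundary facet belongs to exactly one face, so the double sum is a single sum, with
`traceFun` supplying the face function. -/
theorem bdryPairing_eq (vb : M.Face → Pt (n + 1) → ℝ) (q : M.PwField T) :
    M.bdryPairing T vb q = ∑ b ∈ M.bdryFacets T, ∫ x in facet (M.simplex T b.1) b.2,
      traceFun vb b x * inner ℝ (q b.1 x) (outwardNormal (M.simplex T b.1) b.2) ∂μHE[n] := by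
  rw [← sum_faces_facets, bdryPairing]
  refine Finset.sum_congr rfl fun e _ => Finset.sum_congr rfl fun b hb => ?_
  rw [traceFun_eq vb hb]
  rfl

theorem mem_Vh {k : ℕ} {v : M.WeakFun} : v ∈ M.Vh k ↔
    (∀ T, v.1 T ∈ polySpace (n + 1) k) ∧ ∀ e, v.2 e ∈ polySpaceOn (M.face e) (k + 1) := by
  simp [Vh, Submodule.mem_prod, Submodule.mem_pi]

/-- The face functions of `v` are polynomials on the boundary facets of a cell. -/
theorem exists_poly_traceFun {k : ℕ} {v : M.WeakFun} (hv : v ∈ M.Vh k)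
    {b : M.Sub T × Fin (n + 1 + 1)} (hb : b ∈ M.bdryFacets T) :
    ∃ g ∈ polySpace (n + 1) (k + 1), ∀ x ∈ facet (M.simplex T b.1) b.2,
      traceFun v.2 b x = g x := by
  obtain ⟨e, _, hbe⟩ := exists_face_of_mem_bdryFacets hb
  obtain ⟨g, hg, hve⟩ := (mem_Vh.1 hv).2 e
  refine ⟨g, hg, fun x hx => ?_⟩
  rw [traceFun_eq _ hbe, hve, Set.indicator_of_mem (mem_facets.1 hbe hx)]

/-- A face function is extended by zero and need not be continuous on the whole space, but on each
facet it agrees with a polynomial. -/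
theorem integrableOn_traceFun_mul {k : ℕ} {v : M.WeakFun} (hv : v ∈ M.Vh k)
    {b : M.Sub T × Fin (n + 1 + 1)} (hb : b ∈ M.bdryFacets T) {f : Pt (n + 1) → ℝ}
    (hf : Continuous f) :
    IntegrableOn (fun x => traceFun v.2 b x * f x) (facet (M.simplex T b.1) b.2) μHE[n] := by
  obtain ⟨g, hg, h⟩ := exists_poly_traceFun hv hb
  refine (integrableOn_congr_fun (fun x hx => ?_) (measurableSet_facet _ _)).2
    (integrableOn_facet _ _ ((continuous_of_mem_polySpace hg).mul hf))
  simp [h x hx]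

theorem bdryPairing_add_right {k : ℕ} {v : M.WeakFun} (hv : v ∈ M.Vh k) {q q' : M.PwField T}
    (hq : ∀ i, Continuous (q i)) (hq' : ∀ i, Continuous (q' i)) :
    M.bdryPairing T v.2 (q + q') = M.bdryPairing T v.2 q + M.bdryPairing T v.2 q' := by
  rw [bdryPairing_eq, bdryPairing_eq, bdryPairing_eq, ← Finset.sum_add_distrib]
  refine Finset.sum_congr rfl fun b hb => ?_
  rw [← integral_add (integrableOn_traceFun_mul hv hb ((hq b.1).inner continuous_const))
    (integrableOn_traceFun_mul hv hb ((hq' b.1).inner continuous_const))]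
  simp only [Pi.add_apply, inner_add_left, mul_add]

theorem bdryPairing_smul_right (vb : M.Face → Pt (n + 1) → ℝ) (c : ℝ) (q : M.PwField T) :
    M.bdryPairing T vb (c • q) = c * M.bdryPairing T vb q := by
  rw [bdryPairing_eq, bdryPairing_eq, Finset.mul_sum]
  refine Finset.sum_congr rfl fun b _ => ?_
  rw [← integral_const_mul]
  simp only [Pi.smul_apply, real_inner_smul_left, mul_left_comm]

/-- Riesz representation on `Λ_k(T)` with the `L²` product, which is definite on piecewise
polynomials. -/
theorem existsUnique_isWeakGrad {k : ℕ} {v : M.WeakFun} (hv : v ∈ M.Vh k) (T : M.Cell) :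
    ∃! g : M.PwField T, M.IsWeakGrad k T v g := by
  have hdiv : ∀ q : M.lamSubmodule T k, ∃ p ∈ polySpace (n + 1) k, M.IsWeakDiv T q.1 p :=
    fun q => q.2.2.1
  -- Uniqueness of the divergence makes the chosen one linear in `q`, so the right-hand side is a
  -- linear functional.
  choose D hD hDw using hdiv
  have huniq : ∀ (q : M.lamSubmodule T k) p, p ∈ polySpace (n + 1) k → M.IsWeakDiv T q.1 p →
      D q = p := fun q p hp h => (hDw q).unique h q.2.1 (hD q) hp
  have hDc := fun q => continuous_of_mem_polySpace (hD q)
  have hvc := continuous_of_mem_polySpace ((mem_Vh.1 hv).1 T)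
  let L : M.lamSubmodule T k →ₗ[ℝ] ℝ :=
    { toFun := fun q => -(∫ x in M.cell T, v.1 T x * D q x) + M.bdryPairing T v.2 q.1
      map_add' := fun q q' => by
        have h1 : D (q + q') = D q + D q' := huniq _ _ (Submodule.add_mem _ (hD q) (hD q'))
          ((hDw q).add (hDw q') (continuous_of_mem_Lam q.2) (continuous_of_mem_Lam q'.2)
            (hDc q) (hDc q'))
        have h2 : ∫ x in M.cell T, v.1 T x * (D q + D q') x =
            (∫ x in M.cell T, v.1 T x * D q x) + ∫ x in M.cell T, v.1 T x * D q' x := by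
          rw [← integral_add (f := fun x => v.1 T x * D q x) (g := fun x => v.1 T x * D q' x)
            (integrableOn_cell (hvc.mul (hDc q))) (integrableOn_cell (hvc.mul (hDc q')))]
          simp only [Pi.add_apply, mul_add]
        rw [h1, h2, Submodule.coe_add, bdryPairing_add_right hv (continuous_of_mem_Lam q.2)
          (continuous_of_mem_Lam q'.2)]
        ring
      map_smul' := fun c q => by
        have h1 : D (c • q) = c • D q := huniq _ _ (Submodule.smul_mem _ c (hD q))
          ((hDw q).smul c)
        rw [h1, Submodule.coe_smul, bdryPairing_smul_right]
        simp only [Pi.smul_apply, smul_eq_mul, mul_left_comm _ c, integral_const_mul,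
          RingHom.id_apply]
        ring }
  obtain ⟨g, hg, hgu⟩ := existsUnique_of_posDef (lamInner (M := M) (T := T) k)
    (fun q hq => Subtype.ext (eq_zero_of_pwInner_self q.2.1 hq)) L
  refine ⟨g.1, ⟨g.2, fun q hq p hp hqp => ?_⟩, fun g' hg' => ?_⟩
  · have h1 := hg ⟨q, hq⟩
    have h2 := huniq ⟨q, hq⟩ p hp hqp
    change M.pwInner T g.1 q = -(∫ x in M.cell T, v.1 T x * D ⟨q, hq⟩ x) + _ at h1
    rw [h1, h2]
  · have := hgu ⟨g', hg'.1⟩ fun q => hg'.2 q.1 q.2 (D q) (hD q) (hDw q)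
    exact congrArg Subtype.val this

theorem isWeakGrad_weakGrad {k : ℕ} {v : M.WeakFun} (hv : v ∈ M.Vh k) (T : M.Cell) :
    M.IsWeakGrad k T v (M.weakGrad k v T) := by
  have h : ∃ g, M.IsWeakGrad k T v g := (existsUnique_isWeakGrad hv T).exists
  rw [weakGrad, dif_pos h]
  exact h.choose_spec

theorem weakGrad_mem_Lam {k : ℕ} {v : M.WeakFun} (hv : v ∈ M.Vh k) (T : M.Cell) :
    M.weakGrad k v T ∈ M.Lam k T := (isWeakGrad_weakGrad hv T).1

theorem weakGrad_eq {k : ℕ} {v : M.WeakFun} (hv : v ∈ M.Vh k) {T : M.Cell} {g : M.PwField T}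
    (h : M.IsWeakGrad k T v g) : M.weakGrad k v T = g :=
  (existsUnique_isWeakGrad hv T).unique (isWeakGrad_weakGrad hv T) h

theorem traceFun_add (vb vb' : M.Face → Pt (n + 1) → ℝ) {b : M.Sub T × Fin (n + 1 + 1)}
    (hb : b ∈ M.bdryFacets T) : traceFun (vb + vb') b = traceFun vb b + traceFun vb' b := by
  obtain ⟨e, _, hbe⟩ := exists_face_of_mem_bdryFacets hb
  simp only [traceFun_eq _ hbe, Pi.add_apply]

theorem traceFun_smul (c : ℝ) (vb : M.Face → Pt (n + 1) → ℝ) {b : M.Sub T × Fin (n + 1 + 1)}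
    (hb : b ∈ M.bdryFacets T) : traceFun (c • vb) b = c • traceFun vb b := by
  obtain ⟨e, _, hbe⟩ := exists_face_of_mem_bdryFacets hb
  simp only [traceFun_eq _ hbe, Pi.smul_apply]

/-- The weak gradient is obtained by choice; uniqueness makes it additive. -/
theorem weakGrad_add {k : ℕ} {u v : M.WeakFun} (hu : u ∈ M.Vh k) (hv : v ∈ M.Vh k) (T : M.Cell) :
    M.weakGrad k (u + v) T = M.weakGrad k u T + M.weakGrad k v T := by
  obtain ⟨hu1, hu2⟩ := isWeakGrad_weakGrad hu T
  obtain ⟨hv1, hv2⟩ := isWeakGrad_weakGrad hv T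
  refine weakGrad_eq (Submodule.add_mem _ hu hv)
    ⟨(M.lamSubmodule T k).add_mem hu1 hv1, fun q hq p hp hqp => ?_⟩
  have hc := fun i => continuous_of_mem_Lam hq i
  rw [pwInner_add_left (continuous_of_mem_Lam hu1) (continuous_of_mem_Lam hv1) hc,
    hu2 q hq p hp hqp, hv2 q hq p hp hqp]
  have h1 : ∫ x in M.cell T, (u + v).1 T x * p x =
      (∫ x in M.cell T, u.1 T x * p x) + ∫ x in M.cell T, v.1 T x * p x := by
    have hpc := continuous_of_mem_polySpace hp
    rw [← integral_add (f := fun x => u.1 T x * p x) (g := fun x => v.1 T x * p x)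
      (integrableOn_cell ((continuous_of_mem_polySpace ((mem_Vh.1 hu).1 T)).mul hpc))
      (integrableOn_cell ((continuous_of_mem_polySpace ((mem_Vh.1 hv).1 T)).mul hpc))]
    simp only [Prod.fst_add, Pi.add_apply, add_mul]
  have h2 : M.bdryPairing T (u + v).2 q = M.bdryPairing T u.2 q + M.bdryPairing T v.2 q := by
    rw [bdryPairing_eq, bdryPairing_eq, bdryPairing_eq, ← Finset.sum_add_distrib]
    refine Finset.sum_congr rfl fun b hb => ?_
    rw [← integral_add (integrableOn_traceFun_mul hu hb ((hc b.1).inner continuous_const))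
      (integrableOn_traceFun_mul hv hb ((hc b.1).inner continuous_const)), Prod.snd_add,
      traceFun_add _ _ hb]
    simp only [Pi.add_apply, add_mul]
  rw [h1, h2]; ring

theorem weakGrad_smul {k : ℕ} (c : ℝ) {v : M.WeakFun} (hv : v ∈ M.Vh k) (T : M.Cell) :
    M.weakGrad k (c • v) T = c • M.weakGrad k v T := by
  obtain ⟨hv1, hv2⟩ := isWeakGrad_weakGrad hv T
  refine weakGrad_eq (Submodule.smul_mem _ c hv)
    ⟨(M.lamSubmodule T k).smul_mem c hv1, fun q hq p hp hqp => ?_⟩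
  rw [pwInner_smul_left, hv2 q hq p hp hqp]
  have h2 : M.bdryPairing T (c • v).2 q = c * M.bdryPairing T v.2 q := by
    rw [bdryPairing_eq, bdryPairing_eq, Finset.mul_sum]
    refine Finset.sum_congr rfl fun b hb => ?_
    rw [← integral_const_mul, Prod.smul_snd, traceFun_smul _ _ hb]
    simp only [Pi.smul_apply, smul_eq_mul, mul_assoc]
  rw [h2]
  simp only [Prod.smul_fst, Pi.smul_apply, smul_eq_mul, mul_assoc, integral_const_mul]
  ring

/-- The weak gradient in terms of the classical gradient and of the jump on the boundary. -/
theorem pwInner_weakGrad {k : ℕ} {v : M.WeakFun} (hv : v ∈ M.Vh k) {T : M.Cell} {q : M.PwField T}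
    (hq : q ∈ M.Lam k T) :
    M.pwInner T (M.weakGrad k v T) q =
      (∑ i, ∫ x in body (M.simplex T i), fderiv ℝ (v.1 T) x (q i x)) +
      ∑ b ∈ M.bdryFacets T, ∫ x in facet (M.simplex T b.1) b.2, (traceFun v.2 b x - v.1 T x) *
        inner ℝ (q b.1 x) (outwardNormal (M.simplex T b.1) b.2) ∂μHE[n] := by
  obtain ⟨p, hp, hqp⟩ := hq.2.1
  have hv0 := (mem_Vh.1 hv).1 T
  have hc := fun i => continuous_of_mem_Lam hq i
  rw [(isWeakGrad_weakGrad hv T).2 q hq p hp hqp, bdryPairing_eq]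
  have h1 := hqp.integral_by_parts hq.1 (continuous_of_mem_polySpace hp)
    (contDiff_of_mem_polySpace hv0)
  have h2 : ∀ b ∈ M.bdryFacets T, ∫ x in facet (M.simplex T b.1) b.2,
      (traceFun v.2 b x - v.1 T x) *
        inner ℝ (q b.1 x) (outwardNormal (M.simplex T b.1) b.2) ∂μHE[n] =
      (∫ x in facet (M.simplex T b.1) b.2, traceFun v.2 b x *
        inner ℝ (q b.1 x) (outwardNormal (M.simplex T b.1) b.2) ∂μHE[n]) -
      ∫ x in facet (M.simplex T b.1) b.2, v.1 T x *
        inner ℝ (q b.1 x) (outwardNormal (M.simplex T b.1) b.2) ∂μHE[n] := by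
    intro b hb
    rw [← integral_sub (integrableOn_traceFun_mul hv hb ((hc b.1).inner continuous_const))
      (integrableOn_facet _ _ (f := fun x => v.1 T x * inner ℝ (q b.1 x) _)
        ((continuous_of_mem_polySpace hv0).mul ((hc b.1).inner continuous_const)))]
    simp only [sub_mul]
  rw [Finset.sum_congr rfl h2, Finset.sum_sub_distrib, ← h1]
  simp only [mul_comm (v.1 T _) (p _)]
  ring

end PolytopalMesh

end WG

end

noncomputable section

namespace WG

variable {n : ℕ}

/-! ### Inverse inequality -/

section InverseInequality

theorem inverse_inequality_reference (s₀ : Affine.Simplex ℝ (Pt (n + 1)) (n + 1)) (m : ℕ) :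
    ∃ C : ℝ, 0 < C ∧ ∀ w : polySpace (n + 1) m,
      ∑ e, ∫ x in body s₀, edgeDeriv s₀ m e w x ^ 2 ≤ C * ∫ x in body s₀, w.1 x ^ 2 := by
  have hE : ∀ e, ∀ v w : polySpace (n + 1) m,
      Integrable (fun x => (1 : ℝ) * (edgeDeriv s₀ m e v x * edgeDeriv s₀ m e w x))
        (volume.restrict (body s₀)) := fun e v w => integrableOn_body s₀
    (continuous_const.mul ((continuous_edgeDeriv s₀ e v).mul (continuous_edgeDeriv s₀ e w)))
  have hc : ∀ v : polySpace (n + 1) m, Continuous (polyFun n m v) := fun v =>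
    continuous_of_mem_polySpace v.2
  have hP : ∀ v w : polySpace (n + 1) m,
      Integrable (fun x => (1 : ℝ) * (polyFun n m v x * polyFun n m w x))
        (volume.restrict (body s₀)) := fun v w => integrableOn_body s₀
    (continuous_const.mul ((hc v).mul (hc w)))
  have hB : ∀ w, weightedForm (volume.restrict (body s₀)) (fun _ => 1) (polyFun n m) hP w w =
      ∫ x in body s₀, w.1 x ^ 2 := fun w => by
    simp only [weightedForm_apply, one_mul, ← sq]; rfl
  obtain ⟨C, hC, h⟩ := exists_bound_mod_ker
    (∑ e, weightedForm (volume.restrict (body s₀)) (fun _ => 1) (edgeDeriv s₀ m e) (hE e))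
    (weightedForm (volume.restrict (body s₀)) (fun _ => 1) (polyFun n m) hP)
    (fun v w => weightedForm_symm _ _ _ _ _ _)
    (fun w => by rw [hB]; exact integral_nonneg fun x => sq_nonneg _)
  refine ⟨C, hC, fun w => ?_⟩
  obtain ⟨w', h1, h2⟩ := h w
  rw [hB] at h1 h2
  have h3 : w = w' :=
    Subtype.ext (sub_eq_zero.1 (eq_zero_of_integral_body_sq_eq_zero s₀ (w - w').2 h1))
  simp only [LinearMap.sum_apply, weightedForm_apply, one_mul, ← sq] at h2
  rwa [← h3] at h2

/-- Write the gradient `u` in the edges leaving vertex `0`; its coefficients are `∇λ_b · u`, at most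
`‖u‖ / h₀` because `|∇λ_b| = 1 / ht`. Pairing with `u` itself and Cauchy–Schwarz over `n + 2`
vertices finish the bound. -/
theorem norm_gradient_le (s : Affine.Simplex ℝ (Pt (n + 1)) (n + 1)) {h₀ : ℝ} (hh₀ : 0 < h₀)
    (hh : ∀ a, h₀ ≤ ht s a) (p : Pt (n + 1) → ℝ) (x : Pt (n + 1)) :
    h₀ ^ 2 * ‖gradient p x‖ ^ 2 ≤
      (n + 2) * ∑ b, fderiv ℝ p x (s.points b - s.points 0) ^ 2 := by
  set u := gradient p x with hu
  have hdec : u = ∑ b, fderiv ℝ (bc s b) 0 u • (s.points b - s.points 0) := by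
    have h1 := sum_bc_smul_sub s u (s.points 0)
    have h2 := sum_bc_smul_sub s 0 (s.points 0)
    have h3 : ∀ b, fderiv ℝ (bc s b) 0 u = bc s b u - bc s b 0 := fun b => by
      rw [← fderiv_bc_sub s b 0 u 0, sub_zero]
    simp only [h3, sub_smul, Finset.sum_sub_distrib, h1, h2]
    simp
  have h1 : ‖u‖ ^ 2 = ∑ b, fderiv ℝ (bc s b) 0 u * fderiv ℝ p x (s.points b - s.points 0) := by
    rw [← real_inner_self_eq_norm_sq]
    conv_lhs => rw [hu]
    rw [inner_gradient_eq, ← hu]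
    conv_lhs => rw [hdec]
    simp [map_sum]
  have h2 : ∀ b, h₀ * |fderiv ℝ (bc s b) 0 u| ≤ ‖u‖ := fun b => by
    have h3 := inner_outwardNormal s b 0 u
    have h4 := abs_real_inner_le_norm (outwardNormal s b) u
    rw [h3, norm_outwardNormal, one_mul, abs_neg, abs_mul, abs_of_pos (ht_pos s b)] at h4
    exact (mul_le_mul_of_nonneg_right (hh b) (abs_nonneg _)).trans h4
  have h3 : h₀ * ‖u‖ ^ 2 ≤ ‖u‖ * ∑ b, |fderiv ℝ p x (s.points b - s.points 0)| := by
    rw [h1, Finset.mul_sum, Finset.mul_sum]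
    refine Finset.sum_le_sum fun b _ => ?_
    calc h₀ * (fderiv ℝ (bc s b) 0 u * fderiv ℝ p x (s.points b - s.points 0))
        ≤ |h₀ * (fderiv ℝ (bc s b) 0 u * fderiv ℝ p x (s.points b - s.points 0))| := le_abs_self _
      _ = h₀ * |fderiv ℝ (bc s b) 0 u| * |fderiv ℝ p x (s.points b - s.points 0)| := by
        rw [abs_mul, abs_mul, abs_of_pos hh₀, mul_assoc]
      _ ≤ _ := mul_le_mul_of_nonneg_right (h2 b) (abs_nonneg _)
  have h4 : h₀ * ‖u‖ ≤ ∑ b, |fderiv ℝ p x (s.points b - s.points 0)| := by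
    rcases (norm_nonneg u).eq_or_lt with h0 | h0
    · rw [← h0, mul_zero]
      exact Finset.sum_nonneg fun b _ => abs_nonneg _
    · refine le_of_mul_le_mul_left ?_ h0
      linarith
  calc h₀ ^ 2 * ‖u‖ ^ 2 = (h₀ * ‖u‖) ^ 2 := by ring
    _ ≤ (∑ b, |fderiv ℝ p x (s.points b - s.points 0)|) ^ 2 := by gcongr
    _ ≤ (Finset.univ : Finset (Fin (n + 1 + 1))).card *
        ∑ b, |fderiv ℝ p x (s.points b - s.points 0)| ^ 2 := sq_sum_le_card_mul_sum_sq
    _ = _ := by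
      simp only [Finset.card_univ, Fintype.card_fin, sq_abs]
      push_cast
      ring

/-- An inverse inequality for polynomials, uniform over all simplices. -/
theorem inverse_inequality (n m : ℕ) : ∃ C : ℝ, 0 < C ∧
    ∀ (s : Affine.Simplex ℝ (Pt (n + 1)) (n + 1)) (h₀ : ℝ), 0 < h₀ → (∀ a, h₀ ≤ ht s a) →
      ∀ p ∈ polySpace (n + 1) m,
        h₀ ^ 2 * ∫ x in body s, ‖gradient p x‖ ^ 2 ≤ C * ∫ x in body s, p x ^ 2 := by
  by_cases hne : Nonempty (Affine.Simplex ℝ (Pt (n + 1)) (n + 1))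
  swap
  · exact ⟨1, one_pos, fun s => (hne ⟨s⟩).elim⟩
  obtain ⟨s₀⟩ := hne
  obtain ⟨C, hC, h⟩ := inverse_inequality_reference s₀ m
  refine ⟨(n + 2) * C, by positivity, fun s h₀ hh₀ hh p hp => ?_⟩
  let w₀ : polySpace (n + 1) m := ⟨fun x => p (transfer s₀ s x), comp_transfer_mem_polySpace s₀ s hp⟩
  have h1 := h w₀
  have h3 : ∀ e x, edgeDeriv s₀ m e w₀ x = edgeDeriv s m e ⟨p, hp⟩ (transfer s₀ s x) := fun e x =>
    fderiv_comp_transfer s₀ s (differentiable_of_mem_polySpace hp) e.1 e.2 x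
  have e3 := bvol_pos s
  have e4 := bvol_pos s₀
  -- For edge derivatives the reference constant holds on every simplex unchanged; heights enter
  -- only in the passage to the gradient.
  have h5 : ∑ e, ∫ x in body s, edgeDeriv s m e ⟨p, hp⟩ x ^ 2 ≤ C * ∫ x in body s, p x ^ 2 := by
    have h4 : ∀ e, ∫ x in body s₀, edgeDeriv s₀ m e w₀ x ^ 2 =
        bvol s₀ / bvol s * ∫ x in body s, edgeDeriv s m e ⟨p, hp⟩ x ^ 2 := fun e => by
      simp only [h3]
      exact setIntegral_body_transfer' s₀ s fun x => edgeDeriv s m e ⟨p, hp⟩ x ^ 2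
    rw [Finset.sum_congr rfl fun e _ => h4 e, ← Finset.mul_sum,
      setIntegral_body_transfer' s₀ s fun x => p x ^ 2, mul_left_comm] at h1
    exact le_of_mul_le_mul_left h1 (div_pos e4 e3)
  have hd := contDiff_of_mem_polySpace (n := 1) hp
  have hce : ∀ b, Continuous fun x => fderiv ℝ p x (s.points b - s.points 0) := fun b =>
    continuous_fderiv_apply hd continuous_const
  rw [mul_assoc]
  calc h₀ ^ 2 * ∫ x in body s, ‖gradient p x‖ ^ 2
      = ∫ x in body s, h₀ ^ 2 * ‖gradient p x‖ ^ 2 := (integral_const_mul _ _).symm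
    _ ≤ ∫ x in body s, (n + 2) * ∑ b, fderiv ℝ p x (s.points b - s.points 0) ^ 2 := by
      refine integral_mono
        (integrableOn_body s (continuous_const.mul ((continuous_gradient hd).norm.pow 2)))
        (integrableOn_body s (continuous_const.mul
          (continuous_finsetSum _ fun b _ => (hce b).pow 2))) fun x => norm_gradient_le s hh₀ hh p x
    _ = (n + 2) * ∑ b, ∫ x in body s, edgeDeriv s m (0, b) ⟨p, hp⟩ x ^ 2 := by
      rw [integral_const_mul, integral_finsetSum _ fun b _ => integrableOn_body s
        (f := fun x => fderiv ℝ p x (s.points b - s.points 0) ^ 2) ((hce b).pow 2)]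
      rfl
    _ ≤ (n + 2) * (C * ∫ x in body s, p x ^ 2) := by
      refine mul_le_mul_of_nonneg_left (le_trans ?_ h5) (by positivity)
      rw [Fintype.sum_prod_type]
      exact Finset.single_le_sum
        (f := fun a => ∑ b, ∫ x in body s, edgeDeriv s m (a, b) ⟨p, hp⟩ x ^ 2)
        (fun a _ => Finset.sum_nonneg fun b _ => integral_nonneg fun x => sq_nonneg _)
        (Finset.mem_univ 0)

end InverseInequality

/-! ### Consequences of shape regularity -/

namespace PolytopalMesh

variable {Ω : Set (Pt (n + 1))} {M : PolytopalMesh (n + 1) Ω}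

theorem norm_sub_le_diam {T : M.Cell} {x y : Pt (n + 1)} (hx : x ∈ M.cell T) (hy : y ∈ M.cell T) :
    ‖x - y‖ ≤ M.diam T := by
  rw [← dist_eq_norm]
  exact Metric.dist_le_diam_of_mem (M.isCompact_cell T).isBounded hx hy

theorem edge_le_diam (T : M.Cell) (i : M.Sub T) (b c : Fin (n + 1 + 1)) :
    ‖(M.simplex T i).points b - (M.simplex T i).points c‖ ≤ M.diam T :=
  norm_sub_le_diam (M.body_subset_cell T i (points_mem_body _ b))
    (M.body_subset_cell T i (points_mem_body _ c))

theorem ht_le_diam (T : M.Cell) (i : M.Sub T) (a : Fin (n + 1 + 1)) :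
    ht (M.simplex T i) a ≤ M.diam T := ht_le_of_edge_le _ (fun a b => edge_le_diam T i b a) a

variable (M) in
theorem diam_pos (T : M.Cell) : 0 < M.diam T := by
  obtain ⟨i⟩ := M.subNonempty T
  exact (ht_pos (M.simplex T i) 0).trans_le (ht_le_diam T i 0)

theorem ShapeRegular.le_ht {ρ : ℝ} (hρ : 0 < ρ) (h : M.ShapeRegular ρ) (T : M.Cell) (i : M.Sub T)
    (a : Fin (n + 1 + 1)) : ρ * M.diam T ≤ ht (M.simplex T i) a := by
  obtain ⟨c, hc⟩ := h T i
  exact le_ht_of_closedBall_subset _ (mul_pos hρ (M.diam_pos T)).le hc a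

theorem volume_closedBall_real (c : Pt (n + 1)) {r : ℝ} (hr : 0 ≤ r) :
    volume.real (Metric.closedBall c r) =
      r ^ (n + 1) * volume.real (Metric.closedBall (0 : Pt (n + 1)) 1) := by
  rw [Measure.real, Measure.addHaar_closedBall' volume c hr, ENNReal.toReal_mul,
    ENNReal.toReal_ofReal (by positivity), Measure.real]
  simp

theorem volume_cell_le (T : M.Cell) : volume.real (M.cell T) ≤
    M.diam T ^ (n + 1) * volume.real (Metric.closedBall (0 : Pt (n + 1)) 1) := by
  obtain ⟨i⟩ := M.subNonempty T
  rw [← volume_closedBall_real ((M.simplex T i).points 0) (M.diam_pos T).le]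
  refine measureReal_mono (fun x hx => ?_) (isCompact_closedBall _ _).measure_lt_top.ne
  rw [Metric.mem_closedBall, dist_eq_norm]
  exact norm_sub_le_diam hx (M.body_subset_cell T i (points_mem_body _ 0))

theorem ShapeRegular.le_bvol {ρ : ℝ} (hρ : 0 < ρ) (h : M.ShapeRegular ρ) (T : M.Cell)
    (i : M.Sub T) : (ρ * M.diam T) ^ (n + 1) *
      volume.real (Metric.closedBall (0 : Pt (n + 1)) 1) ≤ bvol (M.simplex T i) := by
  obtain ⟨c, hc⟩ := h T i
  rw [← volume_closedBall_real c (mul_pos hρ (M.diam_pos T)).le]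
  exact measureReal_mono hc (isCompact_body _).measure_lt_top.ne

theorem sum_bvol (T : M.Cell) : ∑ i, bvol (M.simplex T i) = volume.real (M.cell T) := by
  have h := setIntegral_cell (M := M) (T := T) (f := fun _ => 1)
    (integrableOn_cell continuous_const)
  simpa [bvol, Measure.real] using h.symm

theorem unitBall_pos : 0 < volume.real (Metric.closedBall (0 : Pt (n + 1)) 1) := by
  rw [Measure.real, ENNReal.toReal_pos_iff]
  exact ⟨(Metric.isOpen_ball.measure_pos volume ⟨0, Metric.mem_ball_self one_pos⟩).trans_le
    (measure_mono Metric.ball_subset_closedBall), (isCompact_closedBall _ _).measure_lt_top⟩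

/-- Volume packing: the simplices do not overlap, each has at least the volume of a ball of radius
`ρ h`, and the cell fits into a ball of radius `h`. -/
theorem ShapeRegular.card_le {ρ : ℝ} (hρ : 0 < ρ) (h : M.ShapeRegular ρ) (T : M.Cell) :
    (Fintype.card (M.Sub T) : ℝ) ≤ (ρ⁻¹) ^ (n + 1) := by
  set β := volume.real (Metric.closedBall (0 : Pt (n + 1)) 1)
  have hβ : 0 < β := unitBall_pos
  have hd := M.diam_pos T
  have h1 : Fintype.card (M.Sub T) * ((ρ * M.diam T) ^ (n + 1) * β) ≤ M.diam T ^ (n + 1) * β := by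
    refine le_trans ?_ (volume_cell_le T)
    rw [← sum_bvol, ← nsmul_eq_mul, ← Finset.card_univ, ← Finset.sum_const]
    exact Finset.sum_le_sum fun i _ => h.le_bvol hρ T i
  have h2 : Fintype.card (M.Sub T) * ρ ^ (n + 1) ≤ 1 := by
    rw [mul_pow] at h1
    have h3 : 0 < M.diam T ^ (n + 1) * β := by positivity
    refine le_of_mul_le_mul_right ?_ h3
    linarith
  rw [inv_pow, ← one_div, le_div_iff₀ (by positivity)]
  exact h2

/-- One simplex is no larger than the cell, hence than a ball of radius `h`; the other contains a
ball of radius `ρ h`. -/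
theorem ShapeRegular.bvol_le {ρ : ℝ} (hρ : 0 < ρ) (h : M.ShapeRegular ρ) (T : M.Cell)
    (i j : M.Sub T) : bvol (M.simplex T j) ≤ (ρ⁻¹) ^ (n + 1) * bvol (M.simplex T i) := by
  have h1 : bvol (M.simplex T j) ≤ volume.real (M.cell T) := by
    rw [← sum_bvol]
    exact Finset.single_le_sum (f := fun j => bvol (M.simplex T j))
      (fun j _ => (bvol_pos _).le) (Finset.mem_univ j)
  refine h1.trans ((volume_cell_le T).trans ?_)
  have h2 := h.le_bvol hρ T i
  rw [inv_pow, inv_mul_eq_div, le_div_iff₀ (by positivity)]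
  rw [mul_pow] at h2
  linarith

/-! ### Balancing fluxes on the adjacency graph of a cell -/

section Flux

variable {T : M.Cell}

variable (M T) in
/-- The adjacency graph of the simplices of a cell. -/
def subGraph : SimpleGraph (M.Sub T) where
  Adj i j := i ≠ j ∧ ∃ a b, facetVertices (M.simplex T i) a = facetVertices (M.simplex T j) b
  symm := ⟨fun _ _ ⟨h, a, b, hab⟩ => ⟨h.symm, b, a, hab.symm⟩⟩
  loopless := ⟨fun _ h => h.1 rfl⟩

theorem subGraph_reachable (i j : M.Sub T) : (M.subGraph T).Reachable i j := by
  induction M.sub_connected T i j with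
  | refl => exact SimpleGraph.Reachable.refl _
  | tail _ h ih =>
    rename_i j' k' _
    by_cases hjk : j' = k'
    · exact hjk ▸ ih
    · exact ih.trans (SimpleGraph.Adj.reachable ⟨hjk, h⟩)

/-- Fluxes through the facets of a cell, zero on its boundary, with prescribed balances. -/
structure IsFlux (θ : M.Sub T × Fin (n + 1 + 1) → ℝ) (m : M.Sub T → ℝ) : Prop where
  antisymm : ∀ p q, M.Shared T p q → θ p + θ q = 0
  bdry : ∀ p ∈ M.bdryFacets T, θ p = 0
  balance : ∀ l, ∑ a, θ (l, a) = m l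

theorem isFlux_zero : IsFlux (M := M) (T := T) 0 0 := ⟨by simp, by simp, by simp⟩

theorem IsFlux.add {θ θ' : M.Sub T × Fin (n + 1 + 1) → ℝ} {m m' : M.Sub T → ℝ}
    (h : IsFlux θ m) (h' : IsFlux θ' m') : IsFlux (θ + θ') (m + m') where
  antisymm p q hpq := by
    have := h.antisymm p q hpq
    have := h'.antisymm p q hpq
    simp only [Pi.add_apply]; linarith
  bdry p hp := by simp [h.bdry p hp, h'.bdry p hp]
  balance l := by simp [Finset.sum_add_distrib, h.balance, h'.balance]

theorem IsFlux.smul {θ : M.Sub T × Fin (n + 1 + 1) → ℝ} {m : M.Sub T → ℝ}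
    (h : IsFlux θ m) (c : ℝ) : IsFlux (c • θ) (c • m) where
  antisymm p q hpq := by
    have := h.antisymm p q hpq
    simp only [Pi.smul_apply, smul_eq_mul, ← mul_add, this, mul_zero]
  bdry p hp := by simp [h.bdry p hp]
  balance l := by simp [← Finset.mul_sum, h.balance]

-- A unit of flux leaves through one facet and enters through its partner. Uniqueness of partners
-- ensures that no other pair of facets is affected.
open scoped Classical in
theorem isFlux_single {p q : M.Sub T × Fin (n + 1 + 1)} (h : M.Shared T p q) :
    IsFlux (Pi.single p (1 : ℝ) - Pi.single q 1) (Pi.single p.1 (1 : ℝ) - Pi.single q.1 1) where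
  antisymm p' q' h' := by
    have hpq : p ≠ q := fun e => h.1 (by rw [e])
    by_cases h1 : p' = p
    · subst h1
      rw [← h.unique h']
      simp [hpq, hpq.symm]
    · by_cases h2 : p' = q
      · subst h2
        rw [← h.symm.unique h']
        simp [hpq, hpq.symm]
      · have h3 : q' ≠ p := fun e => h2 ((e ▸ h').symm.unique h)
        have h4 : q' ≠ q := fun e => h1 ((e ▸ h').symm.unique h.symm)
        simp [h1, h2, h3, h4]
  bdry p' hp' := by
    have h1 : p' ≠ p := fun e => mem_bdryFacets.1 hp' ⟨q, e ▸ h⟩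
    have h2 : p' ≠ q := fun e => mem_bdryFacets.1 hp' ⟨p, e ▸ h.symm⟩
    simp [h1, h2]
  balance l := by
    have hs : ∀ r : M.Sub T × Fin (n + 1 + 1),
        ∑ a, (Pi.single r (1 : ℝ) : M.Sub T × Fin (n + 1 + 1) → ℝ) (l, a) =
          (Pi.single r.1 (1 : ℝ) : M.Sub T → ℝ) l := by
      rintro ⟨j, b⟩
      simp only [Pi.single_apply, Prod.mk.injEq]
      by_cases hl : l = j
      · simp [hl]
      · simp [hl]
    simp only [Pi.sub_apply, Finset.sum_sub_distrib, hs]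

-- Add one unit across each shared facet of the walk; the intermediate balances telescope, and a
-- facet is charged at most once per step.
open scoped Classical in
theorem exists_flux_of_walk {i j : M.Sub T} (w : (M.subGraph T).Walk i j) :
    ∃ θ : M.Sub T × Fin (n + 1 + 1) → ℝ, IsFlux θ (Pi.single i (1 : ℝ) - Pi.single j 1) ∧
      ∀ p, |θ p| ≤ w.length := by
  induction w with
  | nil => exact ⟨0, by simpa using isFlux_zero, by simp⟩
  | @cons u v z h w ih =>
    obtain ⟨θ, hθ, hb⟩ := ih
    obtain ⟨huv, a, b, hab⟩ := id h
    have hs : M.Shared T (u, a) (v, b) := ⟨huv, hab⟩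
    refine ⟨(Pi.single (u, a) (1 : ℝ) - Pi.single (v, b) 1) + θ, ?_, fun p => ?_⟩
    · have := (isFlux_single hs).add hθ
      simpa using this
    · have h1 : |(Pi.single (u, a) (1 : ℝ) - Pi.single (v, b) 1 :
          M.Sub T × Fin (n + 1 + 1) → ℝ) p| ≤ 1 := by
        simp only [Pi.sub_apply, Pi.single_apply]
        split_ifs <;> norm_num
      have h2 := abs_add_le ((Pi.single (u, a) (1 : ℝ) - Pi.single (v, b) 1 :
        M.Sub T × Fin (n + 1 + 1) → ℝ) p) (θ p)
      rw [Pi.add_apply, SimpleGraph.Walk.length_cons]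
      push_cast
      linarith [hb p]

open scoped Classical in
/-- Balances of total zero can be transported through the facets of a cell, at a cost that depends
only on the number of simplices. -/
theorem exists_flux (m : M.Sub T → ℝ) (hm : ∑ i, m i = 0) :
    ∃ θ : M.Sub T × Fin (n + 1 + 1) → ℝ, IsFlux θ m ∧
      ∀ p, |θ p| ≤ Fintype.card (M.Sub T) * ∑ i, |m i| := by
  obtain ⟨r⟩ := M.subNonempty T
  have h : ∀ i : M.Sub T, ∃ θ : M.Sub T × Fin (n + 1 + 1) → ℝ,
      IsFlux θ (Pi.single i (1 : ℝ) - Pi.single r 1) ∧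
        ∀ p, |θ p| ≤ Fintype.card (M.Sub T) := by
    intro i
    obtain ⟨w⟩ := subGraph_reachable i r
    obtain ⟨θ, h1, h2⟩ := exists_flux_of_walk w.toPath.1
    refine ⟨θ, h1, fun p => (h2 p).trans ?_⟩
    -- A path visits no simplex twice, so its length is below the number of simplices.
    exact_mod_cast w.toPath.2.length_lt.le
  choose θ hθ hb using h
  refine ⟨∑ i, m i • θ i, ?_, fun p => ?_⟩
  · have hsum : ∀ t : Finset (M.Sub T), IsFlux (∑ i ∈ t, m i • θ i)
        (∑ i ∈ t, m i • (Pi.single i (1 : ℝ) - Pi.single r 1)) := by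
      intro t
      induction t using Finset.induction_on with
      | empty => simpa using isFlux_zero
      | insert i t hi ih =>
        rw [Finset.sum_insert hi, Finset.sum_insert hi]
        exact ((hθ i).smul (m i)).add ih
    have h1 := hsum Finset.univ
    -- All balances are sent to the root `r`, where they add up to zero.
    have h2 : ∑ i, m i • (Pi.single i (1 : ℝ) - Pi.single r 1 : M.Sub T → ℝ) = m := by
      ext l
      simp only [Finset.sum_apply, Pi.smul_apply, Pi.sub_apply, smul_eq_mul, mul_sub,
        Finset.sum_sub_distrib, ← Finset.sum_mul, hm, zero_mul, sub_zero]
      simp [Pi.single_apply]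
    rwa [h2] at h1
  · rw [Finset.sum_apply, Finset.mul_sum]
    refine (Finset.abs_sum_le_sum_abs _ _).trans (Finset.sum_le_sum fun i _ => ?_)
    rw [Pi.smul_apply, smul_eq_mul, abs_mul, mul_comm]
    exact mul_le_mul_of_nonneg_right (hb i p) (abs_nonneg _)

end Flux

end PolytopalMesh

end WG

end

/-! ### Lifting divergence and normal components on one simplex -/

noncomputable section

namespace WG

variable {n : ℕ}

/-- Expand `∫ (V f - I)² ≥ 0` with `V` the total mass and `I = ∫ f`; the case `V = 0` is separate
because a factor `V` is cancelled. -/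
theorem sq_integral_le {X : Type*} [MeasurableSpace X] {μ : Measure X} [IsFiniteMeasure μ]
    {f : X → ℝ} (hf : Integrable f μ) (hf2 : Integrable (fun x => f x ^ 2) μ) :
    (∫ x, f x ∂μ) ^ 2 ≤ μ.real Set.univ * ∫ x, f x ^ 2 ∂μ := by
  set V := μ.real Set.univ with hV
  set I := ∫ x, f x ∂μ with hI
  have hV0 : 0 ≤ V := measureReal_nonneg
  have h1 : ∫ x, (V * f x - I) ^ 2 ∂μ = V * (V * (∫ x, f x ^ 2 ∂μ) - I ^ 2) := by
    have e : ∀ x, (V * f x - I) ^ 2 = V ^ 2 * f x ^ 2 - (2 * V * I * f x - I ^ 2) := fun x => by ring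
    simp only [e]
    rw [integral_sub (g := fun x => 2 * V * I * f x - I ^ 2) (hf2.const_mul _)
        ((hf.const_mul _).sub (integrable_const _)),
      integral_sub (hf.const_mul _) (integrable_const _), integral_const_mul, integral_const_mul,
      integral_const, ← hV, ← hI, smul_eq_mul]
    ring
  have h2 : 0 ≤ V * (V * (∫ x, f x ^ 2 ∂μ) - I ^ 2) := h1 ▸ integral_nonneg fun x => sq_nonneg _
  rcases hV0.eq_or_lt with h0 | h0
  · have hμ : μ = 0 := by
      rw [← Measure.measure_univ_eq_zero]
      have := h0.symm
      rw [hV, measureReal_eq_zero_iff] at this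
      exact this
    have : I = 0 := by rw [hI, hμ, integral_zero_measure]
    rw [this, ← h0]; simp
  · have := nonneg_of_mul_nonneg_right h2 h0
    linarith

theorem sq_setIntegral_body_le (s : Affine.Simplex ℝ (Pt (n + 1)) (n + 1)) {f : Pt (n + 1) → ℝ}
    (hf : Continuous f) : (∫ x in body s, f x) ^ 2 ≤ bvol s * ∫ x in body s, f x ^ 2 := by
  have : IsFiniteMeasure (volume.restrict (body s)) :=
    isFiniteMeasure_restrict.2 (isCompact_body s).measure_lt_top.ne
  have h := sq_integral_le (integrableOn_body s hf) (integrableOn_body s (hf.pow 2))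
  rwa [measureReal_restrict_apply_univ] at h

theorem sq_setIntegral_facet_le (s : Affine.Simplex ℝ (Pt (n + 1)) (n + 1)) (a : Fin (n + 1 + 1))
    {f : Pt (n + 1) → ℝ} (hf : Continuous f) :
    (∫ x in facet s a, f x ∂μHE[n]) ^ 2 ≤ area s a * ∫ x in facet s a, f x ^ 2 ∂μHE[n] := by
  have : IsFiniteMeasure ((μHE[n]).restrict (facet s a)) :=
    isFiniteMeasure_restrict.2 (measure_facet_lt_top s a).ne
  have h := sq_integral_le (integrableOn_facet s a hf) (integrableOn_facet s a (hf.pow 2))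
  rwa [measureReal_restrict_apply_univ] at h

theorem norm_sum_sq_le {ι E : Type*} [NormedAddCommGroup E] (t : Finset ι) (u : ι → E) :
    ‖∑ i ∈ t, u i‖ ^ 2 ≤ t.card * ∑ i ∈ t, ‖u i‖ ^ 2 :=
  (pow_le_pow_left₀ (norm_nonneg _) (norm_sum_le _ _) 2).trans sq_sum_le_card_mul_sum_sq

theorem norm_add_sq_le_two {E : Type*} [NormedAddCommGroup E] (u v : E) :
    ‖u + v‖ ^ 2 ≤ 2 * ‖u‖ ^ 2 + 2 * ‖v‖ ^ 2 := by
  have h1 := pow_le_pow_left₀ (norm_nonneg _) (norm_add_le u v) 2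
  nlinarith [sq_nonneg (‖u‖ - ‖v‖)]

/-- A polynomial field on a simplex with prescribed divergence and normal components. -/
theorem exists_simplex_lift (n k : ℕ) {ρ : ℝ} (hρ : 0 < ρ) : ∃ C : ℝ, 0 < C ∧
    ∀ (s : Affine.Simplex ℝ (Pt (n + 1)) (n + 1)) (h : ℝ), 0 < h →
      (∀ b c, ‖s.points b - s.points c‖ ≤ h) → (∀ a, ρ * h ≤ ht s a) →
      ∀ (G : Fin (n + 1 + 1) → Pt (n + 1) → ℝ) (r : Pt (n + 1) → ℝ),
      (∀ a, G a ∈ polySpace (n + 1) (k + 1)) → r ∈ polySpace (n + 1) k →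
      ∫ x in body s, r x = ∑ a, ∫ x in facet s a, G a x ∂μHE[n] →
      ∃ q : Pt (n + 1) → Pt (n + 1),
        (∀ l, (fun x => q x l) ∈ polySpace (n + 1) (k + 1)) ∧ Green s q r ∧
        (∀ a, ∀ x ∈ facet s a, inner ℝ (q x) (outwardNormal s a) = G a x) ∧
        ∫ x in body s, ‖q x‖ ^ 2 ≤ C * (h * (∑ a, ∫ x in facet s a, G a x ^ 2 ∂μHE[n]) +
          h ^ 2 * ∫ x in body s, r x ^ 2) := by
  obtain ⟨C₁, hC₁, H₁⟩ := exists_facet_lift n k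
  obtain ⟨C₂, hC₂, H₂⟩ := exists_bubble_lift n k
  set D : ℝ := (n + 2) * C₁ * ρ⁻¹ with hD
  have hDpos : 0 < D := by positivity
  refine ⟨2 * D + 2 * (C₂ * (2 + 2 * D)), by positivity, fun s h hh hedge hht G r hG hr hbal => ?_⟩
  choose Q R hQ hR hgr hna hnb hbQ hbR using fun a => H₁ s a h hedge (G a) (hG a)
  have hGc := fun a => continuous_of_mem_polySpace (hG a)
  have hQc := fun a => (hgr a).continuous_field
  have hRc := fun a => (hgr a).continuous_div
  have hrc := continuous_of_mem_polySpace hr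
  -- The sum of the facet lifts has the right normal components, since each lift is silent on the
  -- other facets, but in general the wrong divergence.
  have hg0 : Green s (fun x => ∑ a, Q a x) (fun x => ∑ a, R a x) :=
    Green.sum Finset.univ fun a _ => hgr a
  have hn0 : ∀ a, ∀ x ∈ facet s a, inner ℝ (∑ b, Q b x) (outwardNormal s a) = G a x := by
    intro a x hx
    rw [sum_inner, Finset.sum_eq_single a (fun b _ hb => hnb b a hb.symm x hx) (by simp)]
    exact hna a x hx
  have hR0 : (fun x => ∑ a, R a x) ∈ polySpace (n + 1) k := sum_mem_polySpace _ fun a _ => hR a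
  have hR0c := continuous_of_mem_polySpace hR0
  -- The divergence defect has zero mean by the balance hypothesis, so a bubble field can correct it
  -- without touching the normal components.
  have hmean : ∫ x in body s, (r x - ∑ a, R a x) = 0 := by
    rw [integral_sub (integrableOn_body s hrc) (integrableOn_body s hR0c), hg0.integral_div, hbal,
      sub_eq_zero]
    exact Finset.sum_congr rfl fun a _ => setIntegral_congr_fun (measurableSet_facet s a)
      fun x hx => (hn0 a x hx).symm
  obtain ⟨q₁, hq₁, hg1, hn1, hb1⟩ := H₂ s h hedge _ (sub_mem_polySpace hr hR0) hmean
  have hq₁c := hg1.continuous_field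
  set S : ℝ := ∑ a, ∫ x in facet s a, G a x ^ 2 ∂μHE[n] with hS
  set E : ℝ := ∫ x in body s, r x ^ 2 with hE
  have hE0 : 0 ≤ E := integral_nonneg fun x => sq_nonneg _
  have hS0 : 0 ≤ S := Finset.sum_nonneg fun a _ => integral_nonneg fun x => sq_nonneg _
  have hnn : ∀ f : Pt (n + 1) → ℝ, 0 ≤ ∫ x in body s, f x ^ 2 := fun f =>
    integral_nonneg fun x => sq_nonneg _
  have hbQ' : ∀ a, ∫ x in body s, ‖Q a x‖ ^ 2 ≤
      C₁ * ρ⁻¹ * (h * ∫ x in facet s a, G a x ^ 2 ∂μHE[n]) := by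
    intro a
    have h1 := (mul_le_mul_of_nonneg_right (hht a) (hnn fun x => ‖Q a x‖)).trans (hbQ a)
    have h2 : ρ * h * (∫ x in body s, ‖Q a x‖ ^ 2) ≤
        ρ * h * (C₁ * ρ⁻¹ * (h * ∫ x in facet s a, G a x ^ 2 ∂μHE[n])) := by
      refine h1.trans (le_of_eq ?_)
      field_simp
    exact le_of_mul_le_mul_left h2 (by positivity)
  have hbR' : ∀ a, h ^ 2 * ∫ x in body s, R a x ^ 2 ≤
      C₁ * ρ⁻¹ * (h * ∫ x in facet s a, G a x ^ 2 ∂μHE[n]) := by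
    intro a
    have h1 := (mul_le_mul_of_nonneg_right (hht a) (hnn (R a))).trans (hbR a)
    have h2 : ρ * h * (∫ x in body s, R a x ^ 2) * h ≤
        C₁ * (∫ x in facet s a, G a x ^ 2 ∂μHE[n]) * h := mul_le_mul_of_nonneg_right h1 hh.le
    have h3 : ρ * (h ^ 2 * ∫ x in body s, R a x ^ 2) ≤
        ρ * (C₁ * ρ⁻¹ * (h * ∫ x in facet s a, G a x ^ 2 ∂μHE[n])) := by
      calc _ = ρ * h * (∫ x in body s, R a x ^ 2) * h := by ring
        _ ≤ _ := h2
        _ = _ := by field_simp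
    exact le_of_mul_le_mul_left h3 hρ
  have hq0 : ∫ x in body s, ‖∑ a, Q a x‖ ^ 2 ≤ D * (h * S) := by
    calc ∫ x in body s, ‖∑ a, Q a x‖ ^ 2 ≤ ∫ x in body s, (n + 2) * ∑ a, ‖Q a x‖ ^ 2 := by
          refine integral_mono (integrableOn_body s (hg0.continuous_field.norm.pow 2))
            (integrableOn_body s (continuous_const.mul
              (continuous_finsetSum _ fun a _ => (hQc a).norm.pow 2))) fun x => ?_
          refine (norm_sum_sq_le Finset.univ fun a => Q a x).trans (le_of_eq ?_)
          simp only [Finset.card_univ, Fintype.card_fin]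
          push_cast; ring
      _ = (n + 2) * ∑ a, ∫ x in body s, ‖Q a x‖ ^ 2 := by
          rw [integral_const_mul, integral_finsetSum _ fun a _ => integrableOn_body s
            (f := fun x => ‖Q a x‖ ^ 2) ((hQc a).norm.pow 2)]
      _ ≤ (n + 2) * ∑ a, C₁ * ρ⁻¹ * (h * ∫ x in facet s a, G a x ^ 2 ∂μHE[n]) := by
          gcongr with a
          exact hbQ' a
      _ = D * (h * S) := by
          rw [hS, hD, Finset.mul_sum, Finset.mul_sum, Finset.mul_sum]
          exact Finset.sum_congr rfl fun a _ => by ring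
  have hr0 : h ^ 2 * ∫ x in body s, (∑ a, R a x) ^ 2 ≤ D * (h * S) := by
    calc h ^ 2 * ∫ x in body s, (∑ a, R a x) ^ 2
        ≤ h ^ 2 * ∫ x in body s, (n + 2) * ∑ a, R a x ^ 2 := by
          refine mul_le_mul_of_nonneg_left ?_ (by positivity)
          refine integral_mono (integrableOn_body s (hR0c.pow 2))
            (integrableOn_body s (continuous_const.mul
              (continuous_finsetSum _ fun a _ => (hRc a).pow 2))) fun x => ?_
          refine (sq_sum_le_card_mul_sum_sq (s := Finset.univ) (f := fun a => R a x)).trans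
            (le_of_eq ?_)
          simp only [Finset.card_univ, Fintype.card_fin]
          push_cast; ring
      _ = (n + 2) * ∑ a, h ^ 2 * ∫ x in body s, R a x ^ 2 := by
          rw [integral_const_mul, integral_finsetSum _ fun a _ => integrableOn_body s
            (f := fun x => R a x ^ 2) ((hRc a).pow 2), ← Finset.mul_sum]
          ring
      _ ≤ (n + 2) * ∑ a, C₁ * ρ⁻¹ * (h * ∫ x in facet s a, G a x ^ 2 ∂μHE[n]) := by
          exact mul_le_mul_of_nonneg_left (Finset.sum_le_sum fun a _ => hbR' a) (by positivity)
      _ = D * (h * S) := by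
          rw [hS, hD, Finset.mul_sum, Finset.mul_sum, Finset.mul_sum]
          exact Finset.sum_congr rfl fun a _ => by ring
  have hdiff : h ^ 2 * ∫ x in body s, (r x - ∑ a, R a x) ^ 2 ≤ 2 * (h ^ 2 * E) + 2 * (D * (h * S)) := by
    calc h ^ 2 * ∫ x in body s, (r x - ∑ a, R a x) ^ 2
        ≤ h ^ 2 * ∫ x in body s, (2 * r x ^ 2 + 2 * (∑ a, R a x) ^ 2) := by
          refine mul_le_mul_of_nonneg_left ?_ (by positivity)
          refine integral_mono (integrableOn_body s ((hrc.sub hR0c).pow 2))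
            (integrableOn_body s ((continuous_const.mul (hrc.pow 2)).add
              (continuous_const.mul (hR0c.pow 2)))) fun x => ?_
          dsimp only
          nlinarith [sq_nonneg (r x + ∑ a, R a x)]
      _ = 2 * (h ^ 2 * E) + 2 * (h ^ 2 * ∫ x in body s, (∑ a, R a x) ^ 2) := by
          rw [integral_add (f := fun x => 2 * r x ^ 2) (g := fun x => 2 * (∑ a, R a x) ^ 2)
            (integrableOn_body s (continuous_const.mul (hrc.pow 2)))
            (integrableOn_body s (continuous_const.mul (hR0c.pow 2))), integral_const_mul,
            integral_const_mul]
          ring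
      _ ≤ _ := by linarith
  refine ⟨fun x => (∑ a, Q a x) + q₁ x, fun l => ?_, ?_, fun a x hx => ?_, ?_⟩
  · have h1 : (fun x => ∑ a, Q a x l) ∈ polySpace (n + 1) (k + 1) :=
      sum_mem_polySpace _ fun a _ => hQ a l
    have h2 := add_mem_polySpace h1 (hq₁ l)
    simpa using h2
  · have := hg0.add hg1
    simpa using this
  · rw [inner_add_left, hn0 a x hx, hn1 a x hx, add_zero]
  · have hintg : ∫ x in body s, ‖(∑ a, Q a x) + q₁ x‖ ^ 2 ≤
        2 * (∫ x in body s, ‖∑ a, Q a x‖ ^ 2) + 2 * ∫ x in body s, ‖q₁ x‖ ^ 2 := by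
      rw [← integral_const_mul, ← integral_const_mul,
        ← integral_add (f := fun x => 2 * ‖∑ a, Q a x‖ ^ 2) (g := fun x => 2 * ‖q₁ x‖ ^ 2)
          (integrableOn_body s (continuous_const.mul (hg0.continuous_field.norm.pow 2)))
          (integrableOn_body s (continuous_const.mul (hq₁c.norm.pow 2)))]
      refine integral_mono (integrableOn_body s ((hg0.continuous_field.add hq₁c).norm.pow 2))
        (integrableOn_body s ((continuous_const.mul (hg0.continuous_field.norm.pow 2)).add
          (continuous_const.mul (hq₁c.norm.pow 2)))) fun x => norm_add_sq_le_two _ _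
    have h3 : ∫ x in body s, ‖q₁ x‖ ^ 2 ≤ C₂ * (2 * (h ^ 2 * E) + 2 * (D * (h * S))) := by
      refine hb1.trans ?_
      rw [mul_assoc]
      exact mul_le_mul_of_nonneg_left hdiff hC₂.le
    have hhS : 0 ≤ h * S := by positivity
    have hhE : 0 ≤ h ^ 2 * E := by positivity
    have e1 : 0 ≤ D * (h ^ 2 * E) := by positivity
    have e2 : 0 ≤ C₂ * (h * S) := by positivity
    have e3 : 0 ≤ C₂ * D * (h ^ 2 * E) := by positivity
    nlinarith

end WG

end

/-! ### Lifting divergence and normal components on a cell -/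

noncomputable section

namespace WG

variable {n : ℕ}

namespace PolytopalMesh

variable {Ω : Set (Pt (n + 1))} {M : PolytopalMesh (n + 1) Ω}

theorem Shared.area_eq {T : M.Cell} {p q : M.Sub T × Fin (n + 1 + 1)} (h : M.Shared T p q) :
    area (M.simplex T p.1) p.2 = area (M.simplex T q.1) q.2 := by
  rw [area, area, h.facet_eq]

theorem ShapeRegular.bvol_le_area {ρ : ℝ} (hρ : 0 < ρ) (h : M.ShapeRegular ρ) {T : M.Cell}
    (i : M.Sub T) (p : M.Sub T × Fin (n + 1 + 1)) :
    bvol (M.simplex T i) ≤ (ρ⁻¹) ^ (n + 1) * M.diam T * area (M.simplex T p.1) p.2 := by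
  have h1 := h.bvol_le hρ T p.1 i
  have h2 := ht_mul_area (M.simplex T p.1) p.2
  have h3 := ht_le_diam T p.1 p.2
  have h4 := area_pos (M.simplex T p.1) p.2
  have h5 := bvol_pos (M.simplex T p.1)
  have h6 : bvol (M.simplex T p.1) ≤ M.diam T * area (M.simplex T p.1) p.2 := by
    have : ht (M.simplex T p.1) p.2 * area (M.simplex T p.1) p.2 ≤
      M.diam T * area (M.simplex T p.1) p.2 := mul_le_mul_of_nonneg_right h3 h4.le
    have h7 : bvol (M.simplex T p.1) ≤ (n + 1) * bvol (M.simplex T p.1) :=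
      le_mul_of_one_le_left h5.le (by linarith [n.cast_nonneg (α := ℝ)])
    linarith
  calc _ ≤ _ := h1
    _ ≤ (ρ⁻¹) ^ (n + 1) * (M.diam T * area (M.simplex T p.1) p.2) := by gcongr
    _ = _ := by ring

/-- Areas are volumes divided by heights, up to `n + 1`; heights are comparable to `h` and volumes
to each other. -/
theorem ShapeRegular.area_le {ρ : ℝ} (hρ : 0 < ρ) (h : M.ShapeRegular ρ) {T : M.Cell}
    (p' p : M.Sub T × Fin (n + 1 + 1)) :
    area (M.simplex T p'.1) p'.2 ≤ (ρ⁻¹) ^ (n + 1) * ρ⁻¹ * area (M.simplex T p.1) p.2 := by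
  have h1 := h.bvol_le hρ T p.1 p'.1
  have h2 := ht_mul_area (M.simplex T p.1) p.2
  have h2' := ht_mul_area (M.simplex T p'.1) p'.2
  have h3 := ht_le_diam T p.1 p.2
  have h3' := h.le_ht hρ T p'.1 p'.2
  have h4 := area_pos (M.simplex T p.1) p.2
  have h4' := area_pos (M.simplex T p'.1) p'.2
  have hd := M.diam_pos T
  refine le_of_mul_le_mul_left ?_ (mul_pos hρ hd)
  calc ρ * M.diam T * area (M.simplex T p'.1) p'.2
      ≤ ht (M.simplex T p'.1) p'.2 * area (M.simplex T p'.1) p'.2 := by gcongr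
    _ = (n + 1) * bvol (M.simplex T p'.1) := h2'
    _ ≤ (n + 1) * ((ρ⁻¹) ^ (n + 1) * bvol (M.simplex T p.1)) := by gcongr
    _ = (ρ⁻¹) ^ (n + 1) * (ht (M.simplex T p.1) p.2 * area (M.simplex T p.1) p.2) := by
      rw [h2]; ring
    _ ≤ (ρ⁻¹) ^ (n + 1) * (M.diam T * area (M.simplex T p.1) p.2) := by gcongr
    _ = _ := by field_simp

/-- A field of `H(div, T)` with prescribed divergence and normal components on the boundary. -/
theorem exists_cell_lift (n k : ℕ) {ρ : ℝ} (hρ : 0 < ρ) : ∃ C : ℝ, 0 < C ∧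
    ∀ (Ω : Set (Pt (n + 1))) (M : PolytopalMesh (n + 1) Ω), M.ShapeRegular ρ → ∀ (T : M.Cell)
      (g : M.Sub T × Fin (n + 1 + 1) → Pt (n + 1) → ℝ) (r : Pt (n + 1) → ℝ),
      (∀ p, g p ∈ polySpace (n + 1) (k + 1)) → r ∈ polySpace (n + 1) k →
      ∫ x in M.cell T, r x =
        ∑ p ∈ M.bdryFacets T, ∫ x in facet (M.simplex T p.1) p.2, g p x ∂μHE[n] →
      ∃ q : M.PwField T, (∀ i, ∀ l, (fun x => q i x l) ∈ polySpace (n + 1) (k + 1)) ∧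
        M.IsWeakDiv T q r ∧
        (∀ p ∈ M.bdryFacets T, ∀ x ∈ facet (M.simplex T p.1) p.2,
          inner ℝ (q p.1 x) (outwardNormal (M.simplex T p.1) p.2) = g p x) ∧
        M.pwInner T q q ≤ C * (M.diam T * (∑ p ∈ M.bdryFacets T,
          ∫ x in facet (M.simplex T p.1) p.2, g p x ^ 2 ∂μHE[n]) +
          M.diam T ^ 2 * ∫ x in M.cell T, r x ^ 2) := by
  classical
  obtain ⟨C₀, hC₀, H⟩ := exists_simplex_lift n k hρ
  set K : ℝ := (ρ⁻¹) ^ (n + 1) with hK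
  have hKpos : 0 < K := by positivity
  -- The term `2 K` comes from the divergence data, the other from the `n + 2` facet fluxes of a
  -- simplex.
  set A : ℝ := 2 * K + 2 * (n + 2) * (K * ρ⁻¹) with hA
  have hApos : 0 < A := by positivity
  refine ⟨C₀ * K * ((n + 2) * (1 + K ^ 3 * A) + 1), by positivity,
    fun Ω M hM T g r hg hr hbal => ?_⟩
  set h := M.diam T with hh
  have hpos : 0 < h := M.diam_pos T
  have hgc := fun p => continuous_of_mem_polySpace (hg p)
  have hrc := continuous_of_mem_polySpace hr
  have hN : (Fintype.card (M.Sub T) : ℝ) ≤ K := hM.card_le hρ T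
  set ar : M.Sub T × Fin (n + 1 + 1) → ℝ := fun p => area (M.simplex T p.1) p.2 with har
  have harp : ∀ p, 0 < ar p := fun p => area_pos _ _
  set γ : M.Sub T × Fin (n + 1 + 1) → ℝ := fun p => if p ∈ M.bdryFacets T then
    ∫ x in facet (M.simplex T p.1) p.2, g p x ∂μHE[n] else 0 with hγ
  set Γ : M.Sub T × Fin (n + 1 + 1) → ℝ := fun p => if p ∈ M.bdryFacets T then
    ∫ x in facet (M.simplex T p.1) p.2, g p x ^ 2 ∂μHE[n] else 0 with hΓ
  set E : M.Sub T → ℝ := fun i => ∫ x in body (M.simplex T i), r x ^ 2 with hE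
  have hΓ0 : ∀ p, 0 ≤ Γ p := fun p => by
    simp only [hΓ]; split_ifs
    · exact integral_nonneg fun x => sq_nonneg _
    · exact le_rfl
  have hE0 : ∀ i, 0 ≤ E i := fun i => integral_nonneg fun x => sq_nonneg _
  have hγΓ : ∀ p, γ p ^ 2 ≤ ar p * Γ p := fun p => by
    simp only [hΓ, hγ]; split_ifs
    · exact sq_setIntegral_facet_le _ _ (hgc p)
    · simp
  -- The flux that a simplex still has to send through its shared facets. The compatibility
  -- hypothesis says that these amounts add up to zero.
  set m : M.Sub T → ℝ := fun i => (∫ x in body (M.simplex T i), r x) - ∑ a, γ (i, a) with hm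
  have hm0 : ∑ i, m i = 0 := by
    simp only [hm, Finset.sum_sub_distrib]
    rw [← setIntegral_cell (integrableOn_cell hrc), hbal, ← sum_sub_vertex γ, hγ,
      ← Finset.sum_filter]
    simp
  obtain ⟨θ, hθ, hθb⟩ := exists_flux m hm0
  -- On boundary facets the prescribed data, on shared facets the constant whose integral is the
  -- chosen flux; every simplex is then balanced.
  set G : M.Sub T × Fin (n + 1 + 1) → Pt (n + 1) → ℝ := fun p =>
    if p ∈ M.bdryFacets T then g p else fun _ => θ p / ar p with hG
  have hGmem : ∀ p, G p ∈ polySpace (n + 1) (k + 1) := fun p => by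
    simp only [hG]; split_ifs
    · exact hg p
    · exact const_mem_polySpace _
  have hGint : ∀ p, ∫ x in facet (M.simplex T p.1) p.2, G p x ∂μHE[n] = γ p + θ p := fun p => by
    simp only [hG, hγ]; split_ifs with hp
    · rw [hθ.bdry p hp, add_zero]
    · rw [setIntegral_const, smul_eq_mul, zero_add]
      exact mul_div_cancel₀ _ (harp p).ne'
  have hGbal : ∀ i, ∫ x in body (M.simplex T i), r x =
      ∑ a, ∫ x in facet (M.simplex T i) a, G (i, a) x ∂μHE[n] := fun i => by
    rw [Finset.sum_congr rfl fun a _ => hGint (i, a), Finset.sum_add_distrib, hθ.balance i]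
    simp only [hm]; ring
  choose q hq hgr hnq hbq using fun i => H (M.simplex T i) h hpos (edge_le_diam T i)
    (hM.le_ht hρ T i) (fun a => G (i, a)) r (fun a => hGmem (i, a)) hr (hGbal i)
  set Etot : ℝ := ∑ i, E i with hEtot
  set Γtot : ℝ := ∑ p, Γ p with hΓtot
  have hEtot0 : 0 ≤ Etot := Finset.sum_nonneg fun i _ => hE0 i
  have hΓtot0 : 0 ≤ Γtot := Finset.sum_nonneg fun i _ => hΓ0 i
  set R : ℝ := h * Γtot + h ^ 2 * Etot with hR
  have hR0 : 0 ≤ R := by positivity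
  have hmsq : ∀ p, h * ∑ i, m i ^ 2 ≤ ar p * (A * R) := by
    intro p
    have h1 : ∀ i, m i ^ 2 ≤ ar p * (2 * K * h * E i + 2 * (n + 2) * (K * ρ⁻¹) * ∑ a, Γ (i, a)) := by
      intro i
      have e1 : m i ^ 2 ≤ 2 * (∫ x in body (M.simplex T i), r x) ^ 2 +
          2 * (∑ a, γ (i, a)) ^ 2 := by
        simp only [hm]
        nlinarith [sq_nonneg ((∫ x in body (M.simplex T i), r x) + ∑ a, γ (i, a))]
      have e2 : (∫ x in body (M.simplex T i), r x) ^ 2 ≤ K * h * ar p * E i :=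
        (sq_setIntegral_body_le _ hrc).trans
          (mul_le_mul_of_nonneg_right (hM.bvol_le_area hρ i p) (hE0 i))
      have e3 : (∑ a, γ (i, a)) ^ 2 ≤ (n + 2) * ∑ a, K * ρ⁻¹ * ar p * Γ (i, a) := by
        refine (sq_sum_le_card_mul_sum_sq (s := Finset.univ) (f := fun a => γ (i, a))).trans ?_
        have hcard : ((Finset.univ : Finset (Fin (n + 1 + 1))).card : ℝ) = n + 2 := by
          simp only [Finset.card_univ, Fintype.card_fin]; push_cast; ring
        rw [hcard]
        refine mul_le_mul_of_nonneg_left (Finset.sum_le_sum fun a _ => ?_) (by positivity)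
        exact (hγΓ (i, a)).trans
          (mul_le_mul_of_nonneg_right (hM.area_le hρ (i, a) p) (hΓ0 (i, a)))
      rw [← Finset.mul_sum] at e3
      calc m i ^ 2 ≤ 2 * (K * h * ar p * E i) +
            2 * ((n + 2) * (K * ρ⁻¹ * ar p * ∑ a, Γ (i, a))) := by linarith
        _ = _ := by ring
    calc h * ∑ i, m i ^ 2
        ≤ h * ∑ i, ar p * (2 * K * h * E i + 2 * (n + 2) * (K * ρ⁻¹) * ∑ a, Γ (i, a)) := by
          exact mul_le_mul_of_nonneg_left (Finset.sum_le_sum fun i _ => h1 i) hpos.le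
      _ = ar p * (2 * K * (h ^ 2 * Etot) + 2 * (n + 2) * (K * ρ⁻¹) * (h * Γtot)) := by
          rw [← Finset.mul_sum, Finset.sum_add_distrib, ← Finset.mul_sum, ← Finset.mul_sum,
            hΓtot, sum_sub_vertex Γ]
          ring
      _ ≤ ar p * (A * R) := by
          refine mul_le_mul_of_nonneg_left ?_ (harp p).le
          have e1 : 0 ≤ K * (h * Γtot) := by positivity
          have e2 : 0 ≤ (n + 2) * (K * ρ⁻¹) * (h ^ 2 * Etot) := by positivity
          rw [hA, hR]
          linarith
  -- In `K ^ 3`, two factors bound the squared path length and one comes from Cauchy–Schwarz over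
  -- the simplices.
  have hθsq : ∀ p, h * (θ p ^ 2 / ar p) ≤ K ^ 3 * A * R := by
    intro p
    have h1 : θ p ^ 2 ≤ K ^ 3 * ∑ i, m i ^ 2 := by
      have hS : 0 ≤ ∑ i, m i ^ 2 := Finset.sum_nonneg fun i _ => sq_nonneg _
      calc θ p ^ 2 = |θ p| ^ 2 := (sq_abs _).symm
        _ ≤ (Fintype.card (M.Sub T) * ∑ i, |m i|) ^ 2 := by
          gcongr
          exact hθb p
        _ = (Fintype.card (M.Sub T)) ^ 2 * (∑ i, |m i|) ^ 2 := mul_pow _ _ _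
        _ ≤ (Fintype.card (M.Sub T)) ^ 2 * (Fintype.card (M.Sub T) * ∑ i, |m i| ^ 2) := by
          gcongr
          exact sq_sum_le_card_mul_sum_sq
        _ = (Fintype.card (M.Sub T) : ℝ) ^ 3 * ∑ i, m i ^ 2 := by
          simp only [sq_abs]; ring
        _ ≤ _ := by gcongr
    rw [← mul_div_assoc, div_le_iff₀ (harp p)]
    calc h * θ p ^ 2 ≤ h * (K ^ 3 * ∑ i, m i ^ 2) := by gcongr
      _ = K ^ 3 * (h * ∑ i, m i ^ 2) := by ring
      _ ≤ K ^ 3 * (ar p * (A * R)) := by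
        exact mul_le_mul_of_nonneg_left (hmsq p) (by positivity)
      _ = _ := by ring
  have hGsq : ∀ p, h * ∫ x in facet (M.simplex T p.1) p.2, G p x ^ 2 ∂μHE[n] ≤
      (1 + K ^ 3 * A) * R := by
    intro p
    have hKA : 0 ≤ K ^ 3 * A * R := by positivity
    by_cases hp : p ∈ M.bdryFacets T
    · have h1 : ∫ x in facet (M.simplex T p.1) p.2, G p x ^ 2 ∂μHE[n] = Γ p := by
        simp only [hG, hΓ, if_pos hp]
      rw [h1]
      have h2 : Γ p ≤ Γtot := Finset.single_le_sum (fun p _ => hΓ0 p) (Finset.mem_univ p)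
      have h3 : h * Γ p ≤ h * Γtot := by gcongr
      have h4 : 0 ≤ h ^ 2 * Etot := by positivity
      linarith
    · have h1 : ∫ x in facet (M.simplex T p.1) p.2, G p x ^ 2 ∂μHE[n] = θ p ^ 2 / ar p := by
        simp only [hG, if_neg hp]
        rw [setIntegral_const, smul_eq_mul]
        change ar p * _ = _
        have := (harp p).ne'
        field_simp
      rw [h1]
      linarith [hθsq p]
  have hcellE : ∫ x in M.cell T, r x ^ 2 = Etot :=
    setIntegral_cell (integrableOn_cell (f := fun x => r x ^ 2) (hrc.pow 2))
  have hbdryΓ : ∑ p ∈ M.bdryFacets T, ∫ x in facet (M.simplex T p.1) p.2, g p x ^ 2 ∂μHE[n] =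
      Γtot := by
    rw [hΓtot, hΓ, ← Finset.sum_filter]
    simp
  refine ⟨q, hq, isWeakDiv_of_green hgr fun b c hbc x hx => ?_, fun p hp x hx => ?_, ?_⟩
  · have hb : b ∉ M.bdryFacets T := fun hb => mem_bdryFacets.1 hb ⟨c, hbc⟩
    have hc : c ∉ M.bdryFacets T := fun hc => mem_bdryFacets.1 hc ⟨b, hbc.symm⟩
    rw [hnq b.1 b.2 x hx, hnq c.1 c.2 x (hbc.facet_eq ▸ hx)]
    simp only [hG, if_neg hb, if_neg hc]
    have : ar b = ar c := hbc.area_eq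
    rw [this, ← add_div, hθ.antisymm b c hbc, zero_div]
  · rw [hnq p.1 p.2 x hx]
    simp only [hG, if_pos hp]
  · rw [pwInner_self, hcellE, hbdryΓ]
    have h1 : ∀ i, ∫ x in body (M.simplex T i), ‖q i x‖ ^ 2 ≤
        C₀ * ((n + 2) * (1 + K ^ 3 * A) + 1) * R := by
      intro i
      refine (hbq i).trans ?_
      rw [mul_assoc]
      refine mul_le_mul_of_nonneg_left ?_ hC₀.le
      have e1 : h * ∑ a, ∫ x in facet (M.simplex T i) a, G (i, a) x ^ 2 ∂μHE[n] ≤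
          (n + 2) * ((1 + K ^ 3 * A) * R) := by
        rw [Finset.mul_sum]
        refine (Finset.sum_le_card_nsmul _ _ _ fun a _ => hGsq (i, a)).trans (le_of_eq ?_)
        simp only [Finset.card_univ, Fintype.card_fin, nsmul_eq_mul]
        push_cast; ring
      have e2 : h ^ 2 * ∫ x in body (M.simplex T i), r x ^ 2 ≤ R := by
        have e3 : E i ≤ Etot := Finset.single_le_sum (fun i _ => hE0 i) (Finset.mem_univ i)
        have e4 : h ^ 2 * E i ≤ h ^ 2 * Etot := by gcongr
        have e5 : 0 ≤ h * Γtot := by positivity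
        change h ^ 2 * E i ≤ R
        linarith
      linarith
    calc ∑ i, ∫ x in body (M.simplex T i), ‖q i x‖ ^ 2
        ≤ ∑ i : M.Sub T, C₀ * ((n + 2) * (1 + K ^ 3 * A) + 1) * R :=
          Finset.sum_le_sum fun i _ => h1 i
      _ = Fintype.card (M.Sub T) * (C₀ * ((n + 2) * (1 + K ^ 3 * A) + 1) * R) := by
          rw [Finset.sum_const, Finset.card_univ, nsmul_eq_mul]
      _ ≤ K * (C₀ * ((n + 2) * (1 + K ^ 3 * A) + 1) * R) := by gcongr
      _ = _ := by ring

end PolytopalMesh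

end WG

end

/-! ### Estimates on a single cell -/

noncomputable section

namespace WG

variable {n : ℕ}

namespace PolytopalMesh

section CellNorms

variable {Ω : Set (Pt (n + 1))} {M : PolytopalMesh (n + 1) Ω}

/-- The gradient part of the discrete `H¹` semi-norm on a cell. -/
def gradPart (v : M.WeakFun) (T : M.Cell) : ℝ := ∫ x in M.cell T, ‖gradient (v.1 T) x‖ ^ 2

/-- The squared `L²(∂T)` norm of the jump `v_b - v_0`. -/
def jumpPart (v : M.WeakFun) (T : M.Cell) : ℝ :=
  ∑ b ∈ M.bdryFacets T, ∫ x in facet (M.simplex T b.1) b.2,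
    (traceFun v.2 b x - v.1 T x) ^ 2 ∂μHE[n]

theorem gradPart_nonneg (v : M.WeakFun) (T : M.Cell) : 0 ≤ gradPart v T :=
  integral_nonneg fun _ => sq_nonneg _

theorem jumpPart_nonneg (v : M.WeakFun) (T : M.Cell) : 0 ≤ jumpPart v T :=
  Finset.sum_nonneg fun _ _ => integral_nonneg fun _ => sq_nonneg _

theorem pwInner_le_young {T : M.Cell} {g q : M.PwField T} (hg : ∀ i, Continuous (g i))
    (hq : ∀ i, Continuous (q i)) {t : ℝ} (ht : 0 < t) :
    2 * M.pwInner T g q ≤ t * M.pwInner T g g + t⁻¹ * M.pwInner T q q := by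
  simp only [pwInner, Finset.mul_sum]
  rw [← Finset.sum_add_distrib]
  refine Finset.sum_le_sum fun i _ => ?_
  rw [← integral_const_mul, ← integral_const_mul, ← integral_const_mul,
    ← integral_add (f := fun x => t * inner ℝ (g i x) (g i x))
      (g := fun x => t⁻¹ * inner ℝ (q i x) (q i x))
      (integrableOn_body _ (continuous_const.mul ((hg i).inner (hg i))))
      (integrableOn_body _ (continuous_const.mul ((hq i).inner (hq i))))]
  refine integral_mono (integrableOn_body _ (continuous_const.mul ((hg i).inner (hq i))))
    (integrableOn_body _ ((continuous_const.mul ((hg i).inner (hg i))).add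
      (continuous_const.mul ((hq i).inner (hq i))))) fun x => ?_
  have h1 := real_inner_self_nonneg (x := t • g i x - q i x)
  rw [inner_sub_left, inner_sub_right, inner_sub_right, real_inner_smul_left,
    real_inner_smul_left, real_inner_smul_right, real_inner_smul_right,
    real_inner_comm (g i x) (q i x)] at h1
  have h2 := mul_nonneg (inv_pos.2 ht).le h1
  have h3 : t⁻¹ * (t * (t * inner ℝ (g i x) (g i x)) - t * inner ℝ (g i x) (q i x) -
      (t * inner ℝ (g i x) (q i x) - inner ℝ (q i x) (q i x))) =
      t * inner ℝ (g i x) (g i x) + t⁻¹ * inner ℝ (q i x) (q i x) -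
        2 * inner ℝ (g i x) (q i x) := by
    field_simp
    ring
  dsimp only
  linarith

theorem sum_fderiv_eq_pwInner {T : M.Cell} (w : Pt (n + 1) → ℝ) (q : M.PwField T) :
    ∑ i, ∫ x in body (M.simplex T i), fderiv ℝ w x (q i x) =
      M.pwInner T (fun _ => gradient w) q := by
  simp only [pwInner, inner_gradient_left]

theorem pwInner_gradient_self {k : ℕ} {v : M.WeakFun} (hv : v ∈ M.Vh k) (T : M.Cell) :
    M.pwInner T (fun _ => gradient (v.1 T)) (fun _ => gradient (v.1 T)) = gradPart v T := by
  rw [pwInner_self, gradPart, setIntegral_cell (integrableOn_cell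
    (f := fun x => ‖gradient (v.1 T) x‖ ^ 2)
    ((continuous_gradient (contDiff_of_mem_polySpace ((mem_Vh.1 hv).1 T))).norm.pow 2))]

theorem jumpPart_eq {k : ℕ} {v : M.WeakFun} (hv : v ∈ M.Vh k) (T : M.Cell) :
    ∑ e ∈ M.faces T, ∫ x in M.face e, (v.1 T x - v.2 e x) ^ 2 ∂μHE[n] = jumpPart v T := by
  rw [jumpPart, ← sum_faces_facets]
  refine Finset.sum_congr rfl fun e he => ?_
  obtain ⟨g, hg, hve⟩ := (mem_Vh.1 hv).2 e
  rw [setIntegral_face he]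
  · refine Finset.sum_congr rfl fun b hb => ?_
    rw [traceFun_eq v.2 hb]
    simp only [sub_sq_comm]
  · intro b hb
    refine (integrableOn_congr_fun (fun x hx => ?_) (measurableSet_facet _ _)).2
      (integrableOn_facet _ _ (f := fun x => (v.1 T x - g x) ^ 2)
        (((continuous_of_mem_polySpace ((mem_Vh.1 hv).1 T)).sub
          (continuous_of_mem_polySpace hg)).pow 2))
    simp only [hve, Set.indicator_of_mem (mem_facets.1 hb hx)]

/-- Polynomials that represent the face functions of `v` on the boundary facets of a cell. -/
theorem exists_poly_jump {k : ℕ} {v : M.WeakFun} (hv : v ∈ M.Vh k) (T : M.Cell) :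
    ∃ P : M.Face → Pt (n + 1) → ℝ, (∀ e, P e ∈ polySpace (n + 1) (k + 1)) ∧
      ∀ b ∈ M.bdryFacets T, ∀ x ∈ facet (M.simplex T b.1) b.2,
        traceFun v.2 b x = traceFun P b x := by
  choose P hP hvP using (mem_Vh.1 hv).2
  refine ⟨P, hP, fun b hb x hx => ?_⟩
  obtain ⟨e, _, hbe⟩ := exists_face_of_mem_bdryFacets hb
  rw [traceFun_eq _ hbe, traceFun_eq _ hbe, hvP, Set.indicator_of_mem (mem_facets.1 hbe hx)]

theorem traceFun_mem_polySpace {m : ℕ} {T : M.Cell} {P : M.Face → Pt (n + 1) → ℝ}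
    (hP : ∀ e, P e ∈ polySpace (n + 1) m) (b : M.Sub T × Fin (n + 1 + 1)) :
    traceFun P b ∈ polySpace (n + 1) m := by
  rw [traceFun]
  split_ifs
  · exact hP _
  · exact Submodule.zero_mem _

theorem inner_mem_polySpace {m : ℕ} {q : Pt (n + 1) → Pt (n + 1)}
    (hq : ∀ l, (fun x => q x l) ∈ polySpace (n + 1) m) (u : Pt (n + 1)) :
    (fun x => inner ℝ (q x) u) ∈ polySpace (n + 1) m := by
  have : (fun x => inner ℝ (q x) u) = fun x => ∑ l, u l * q x l := by
    ext x
    simp [PiLp.inner_apply]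
  rw [this]
  exact sum_mem_polySpace _ fun l _ => const_mul_mem_polySpace (u l) (hq l)

end CellNorms

/-- Test the identity for the weak gradient with the weak gradient itself. The boundary term is
controlled by the trace inequality for polynomials, and two quarters of the energy are absorbed. -/
theorem upper_bound_cell (n k : ℕ) {ρ : ℝ} (hρ : 0 < ρ) : ∃ C : ℝ, 0 < C ∧
    ∀ (Ω : Set (Pt (n + 1))) (M : PolytopalMesh (n + 1) Ω), M.ShapeRegular ρ →
      ∀ v ∈ M.Vh k, ∀ T, M.pwInner T (M.weakGrad k v T) (M.weakGrad k v T) ≤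
        C * (gradPart v T + (M.diam T)⁻¹ * jumpPart v T) := by
  obtain ⟨C₁, hC₁, H₁⟩ := trace_inequality n (k + 1)
  set B : ℝ := (n + 2) * (C₁ * ρ⁻¹) with hB
  have hBpos : 0 < B := by positivity
  refine ⟨2 + 2 * B, by positivity, fun Ω M hM v hv T => ?_⟩
  set w := M.weakGrad k v T with hw
  have hwL : w ∈ M.Lam k T := weakGrad_mem_Lam hv T
  have hwc : ∀ i, Continuous (w i) := continuous_of_mem_Lam hwL
  set h := M.diam T with hh
  have hpos : 0 < h := M.diam_pos T
  set A := M.pwInner T w w with hA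
  have hv0 := (mem_Vh.1 hv).1 T
  have hgc := continuous_gradient (contDiff_of_mem_polySpace (n := 1) hv0)
  have h1 : A = M.pwInner T (fun _ => gradient (v.1 T)) w +
      ∑ b ∈ M.bdryFacets T, ∫ x in facet (M.simplex T b.1) b.2, (traceFun v.2 b x - v.1 T x) *
        inner ℝ (w b.1 x) (outwardNormal (M.simplex T b.1) b.2) ∂μHE[n] := by
    rw [hA, pwInner_weakGrad hv hwL, sum_fderiv_eq_pwInner]
  -- With `t = 2` the volume term is at most the gradient part plus a quarter of the energy.
  have h2 := pwInner_le_young (M := M) (T := T) (g := fun _ => gradient (v.1 T)) (q := w)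
    (fun _ => hgc) hwc (t := 2) two_pos
  rw [pwInner_gradient_self hv] at h2
  obtain ⟨P, hP, hvP⟩ := exists_poly_jump hv T
  have hPc : ∀ b : M.Sub T × Fin (n + 1 + 1), Continuous (traceFun P b) := fun b =>
    continuous_of_mem_polySpace (traceFun_mem_polySpace hP b)
  have hv0c := continuous_of_mem_polySpace hv0
  set W : M.Sub T × Fin (n + 1 + 1) → ℝ := fun b => ∫ x in facet (M.simplex T b.1) b.2,
    inner ℝ (w b.1 x) (outwardNormal (M.simplex T b.1) b.2) ^ 2 ∂μHE[n] with hW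
  have hWle : ∀ b, h * W b ≤ C₁ * ρ⁻¹ * ∫ x in body (M.simplex T b.1), ‖w b.1 x‖ ^ 2 := by
    intro b
    have e1 := H₁ (M.simplex T b.1) b.2 _
      (inner_mem_polySpace (hwL.1 b.1) (outwardNormal (M.simplex T b.1) b.2))
    have e2 : ρ * h * W b ≤ ht (M.simplex T b.1) b.2 * W b :=
      mul_le_mul_of_nonneg_right (hM.le_ht hρ T b.1 b.2) (integral_nonneg fun x => sq_nonneg _)
    have e3 : ∫ x in body (M.simplex T b.1),
        inner ℝ (w b.1 x) (outwardNormal (M.simplex T b.1) b.2) ^ 2 ≤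
        ∫ x in body (M.simplex T b.1), ‖w b.1 x‖ ^ 2 := by
      refine integral_mono (integrableOn_body _ (((hwc b.1).inner continuous_const).pow 2))
        (integrableOn_body _ ((hwc b.1).norm.pow 2)) fun x => ?_
      have := abs_real_inner_le_norm (w b.1 x) (outwardNormal (M.simplex T b.1) b.2)
      rw [norm_outwardNormal, mul_one] at this
      exact sq_le_sq' (by linarith [neg_abs_le (inner ℝ (w b.1 x)
        (outwardNormal (M.simplex T b.1) b.2))]) ((le_abs_self _).trans this)
    refine le_of_mul_le_mul_left ?_ hρ
    calc ρ * (h * W b) = ρ * h * W b := by ring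
      _ ≤ _ := e2
      _ ≤ _ := e1
      _ ≤ C₁ * ∫ x in body (M.simplex T b.1), ‖w b.1 x‖ ^ 2 := by gcongr
      _ = _ := by field_simp
  have hWsum : h * ∑ b ∈ M.bdryFacets T, W b ≤ B * A := by
    calc h * ∑ b ∈ M.bdryFacets T, W b ≤ h * ∑ b, W b := by
          refine mul_le_mul_of_nonneg_left ?_ hpos.le
          exact Finset.sum_le_sum_of_subset_of_nonneg (Finset.subset_univ _)
            fun b _ _ => integral_nonneg fun x => sq_nonneg _
      _ = ∑ i, ∑ a, h * W (i, a) := by rw [← sum_sub_vertex (fun b => h * W b), Finset.mul_sum]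
      _ ≤ ∑ i, ∑ _a : Fin (n + 1 + 1), C₁ * ρ⁻¹ * ∫ x in body (M.simplex T i), ‖w i x‖ ^ 2 :=
          Finset.sum_le_sum fun i _ => Finset.sum_le_sum fun a _ => hWle (i, a)
      _ = B * A := by
          rw [hA, pwInner_self, Finset.mul_sum]
          refine Finset.sum_congr rfl fun i _ => ?_
          rw [Finset.sum_const, Finset.card_univ, Fintype.card_fin, nsmul_eq_mul, hB]
          push_cast; ring
  -- The weight `h / (4 B)` is chosen so that, with `h ∑ W ≤ B A`, these terms cost another quarter
  -- of the energy.
  have hbd : ∀ b ∈ M.bdryFacets T, ∫ x in facet (M.simplex T b.1) b.2,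
      (traceFun v.2 b x - v.1 T x) *
        inner ℝ (w b.1 x) (outwardNormal (M.simplex T b.1) b.2) ∂μHE[n] ≤
      B * h⁻¹ * (∫ x in facet (M.simplex T b.1) b.2,
        (traceFun v.2 b x - v.1 T x) ^ 2 ∂μHE[n]) + h * (4 * B)⁻¹ * W b := by
    intro b hb
    have hic : Continuous fun x => inner ℝ (w b.1 x) (outwardNormal (M.simplex T b.1) b.2) :=
      (hwc b.1).inner continuous_const
    have hjc := (hPc b).sub hv0c
    rw [setIntegral_congr_fun (g := fun x => (traceFun P b x - v.1 T x) *
        inner ℝ (w b.1 x) (outwardNormal (M.simplex T b.1) b.2)) (measurableSet_facet _ _)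
        fun x hx => by simp only [hvP b hb x hx],
      setIntegral_congr_fun (f := fun x => (traceFun v.2 b x - v.1 T x) ^ 2)
        (g := fun x => (traceFun P b x - v.1 T x) ^ 2) (measurableSet_facet _ _) fun x hx => by simp only [hvP b hb x hx], hW,
      ← integral_const_mul, ← integral_const_mul,
      ← integral_add (f := fun x => B * h⁻¹ * (traceFun P b x - v.1 T x) ^ 2)
        (g := fun x => h * (4 * B)⁻¹ *
          inner ℝ (w b.1 x) (outwardNormal (M.simplex T b.1) b.2) ^ 2)
        (integrableOn_facet _ _ (continuous_const.mul (hjc.pow 2)))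
        (integrableOn_facet _ _ (continuous_const.mul (hic.pow 2)))]
    refine integral_mono (integrableOn_facet _ _ (hjc.mul hic))
      (integrableOn_facet _ _ ((continuous_const.mul (hjc.pow 2)).add
        (continuous_const.mul (hic.pow 2)))) fun x => ?_
    dsimp only
    set y := traceFun P b x - v.1 T x
    set z := inner ℝ (w b.1 x) (outwardNormal (M.simplex T b.1) b.2)
    have e : B * h⁻¹ * y ^ 2 + h * (4 * B)⁻¹ * z ^ 2 - y * z =
        B * h⁻¹ * (y - h * (2 * B)⁻¹ * z) ^ 2 := by
      field_simp
      ring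
    have e' : 0 ≤ B * h⁻¹ * (y - h * (2 * B)⁻¹ * z) ^ 2 := by positivity
    linarith
  have hsum := Finset.sum_le_sum hbd
  rw [Finset.sum_add_distrib, ← Finset.mul_sum, ← Finset.mul_sum] at hsum
  have hWs : h * (4 * B)⁻¹ * ∑ b ∈ M.bdryFacets T, W b ≤ A / 4 := by
    calc _ = (4 * B)⁻¹ * (h * ∑ b ∈ M.bdryFacets T, W b) := by ring
      _ ≤ (4 * B)⁻¹ * (B * A) := by gcongr
      _ = A / 4 := by field_simp
  change _ ≤ B * h⁻¹ * jumpPart v T + _ at hsum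
  have hX := gradPart_nonneg v T
  have hY := jumpPart_nonneg v T
  have hY' : 0 ≤ h⁻¹ * jumpPart v T := by positivity
  have hBX : 0 ≤ B * gradPart v T := by positivity
  have hBY : B * h⁻¹ * jumpPart v T = B * (h⁻¹ * jumpPart v T) := by ring
  rw [hBY] at hsum
  linarith

theorem mem_Lam_of_poly {Ω : Set (Pt (n + 1))} {M : PolytopalMesh (n + 1) Ω} {k : ℕ} {T : M.Cell}
    {q : M.PwField T} {r : Pt (n + 1) → ℝ}
    (hq : ∀ i, ∀ l, (fun x => q i x l) ∈ polySpace (n + 1) (k + 1))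
    (hr : r ∈ polySpace (n + 1) k) (hdiv : M.IsWeakDiv T q r) {P : M.Face → Pt (n + 1) → ℝ}
    (hP : ∀ e, P e ∈ polySpace (n + 1) (k + 1))
    (hn : ∀ b ∈ M.bdryFacets T, ∀ x ∈ facet (M.simplex T b.1) b.2,
      inner ℝ (q b.1 x) (outwardNormal (M.simplex T b.1) b.2) = traceFun P b x) :
    q ∈ M.Lam k T := by
  refine ⟨hq, ⟨r, hr, hdiv⟩, fun e he => ⟨P e, hP e, fun b hb x hx => ?_⟩⟩
  rw [hn b (facets_subset_bdryFacets he hb) x hx, traceFun_eq P hb]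

/-- A test field without normal component does not see the face functions, so the gradient of `v₀`
is bounded by the weak gradient alone, with no jump term. -/
theorem gradient_bound_cell (n k : ℕ) {ρ : ℝ} (hρ : 0 < ρ) : ∃ C : ℝ, 0 < C ∧
    ∀ (Ω : Set (Pt (n + 1))) (M : PolytopalMesh (n + 1) Ω), M.ShapeRegular ρ →
      ∀ v ∈ M.Vh k, ∀ T,
        gradPart v T ≤ C * M.pwInner T (M.weakGrad k v T) (M.weakGrad k v T) := by
  obtain ⟨C₁, hC₁, H₁⟩ := exists_cell_lift n k hρ
  obtain ⟨C₂, hC₂, H₂⟩ := inverse_inequality n k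
  refine ⟨C₂ * (ρ⁻¹) ^ 2 * C₁, by positivity, fun Ω M hM v hv T => ?_⟩
  set w := M.weakGrad k v T with hw
  have hwc : ∀ i, Continuous (w i) := continuous_of_mem_Lam (weakGrad_mem_Lam hv T)
  set h := M.diam T with hh
  have hpos : 0 < h := M.diam_pos T
  have hv0 := (mem_Vh.1 hv).1 T
  have hv0c := continuous_of_mem_polySpace hv0
  have hvol : 0 < volume.real (M.cell T) := by
    rw [← sum_bvol]
    exact Finset.sum_pos (fun i _ => bvol_pos _) Finset.univ_nonempty
  set c : ℝ := (∫ x in M.cell T, v.1 T x) / volume.real (M.cell T) with hc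
  have hdev : (fun x => v.1 T x - c) ∈ polySpace (n + 1) k :=
    sub_mem_polySpace hv0 (const_mem_polySpace c)
  have hdevc := continuous_of_mem_polySpace hdev
  have hmean : ∫ x in M.cell T, (v.1 T x - c) = 0 := by
    rw [integral_sub (integrableOn_cell hv0c) (integrableOn_cell continuous_const),
      setIntegral_const, smul_eq_mul, hc]
    field_simp
    ring
  have hr : (fun x => (-1) * (v.1 T x - c)) ∈ polySpace (n + 1) k :=
    const_mul_mem_polySpace (-1) hdev
  -- Divergence minus the deviation of `v₀` from its mean; its integral is zero, as required by the
  -- vanishing normal component.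
  obtain ⟨q, hq, hdiv, hn, hb⟩ := H₁ Ω M hM T (fun _ _ => 0) _ (fun _ => const_mem_polySpace 0) hr
    (by rw [integral_const_mul, hmean]; simp)
  have hqL : q ∈ M.Lam k T := mem_Lam_of_poly hq hr hdiv (P := fun _ _ => 0)
    (fun _ => const_mem_polySpace 0) fun b hb x hx => by
      obtain ⟨e, _, hbe⟩ := exists_face_of_mem_bdryFacets hb
      rw [hn b hb x hx, traceFun_eq _ hbe]
  have hqc : ∀ i, Continuous (q i) := continuous_of_mem_Lam hqL
  set Z : ℝ := ∫ x in M.cell T, (v.1 T x - c) ^ 2 with hZ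
  have hZ0 : 0 ≤ Z := integral_nonneg fun x => sq_nonneg _
  have hZeq : Z = M.pwInner T w q := by
    have e1 := pwInner_weakGrad hv hqL
    have e2 := hdiv.integral_by_parts hq (continuous_of_mem_polySpace hr)
      (contDiff_of_mem_polySpace hv0)
    have e3 : ∀ f : M.Sub T × Fin (n + 1 + 1) → Pt (n + 1) → ℝ,
        ∑ b ∈ M.bdryFacets T, ∫ x in facet (M.simplex T b.1) b.2, f b x *
          inner ℝ (q b.1 x) (outwardNormal (M.simplex T b.1) b.2) ∂μHE[n] = 0 := fun f =>
      Finset.sum_eq_zero fun b hb => setIntegral_eq_zero_of_forall_eq_zero fun x hx => by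
        rw [hn b hb x hx, mul_zero]
    rw [e3 fun b x => traceFun v.2 b x - v.1 T x, add_zero] at e1
    rw [e3 fun b x => v.1 T x, ← e1] at e2
    have e4 : ∫ x in M.cell T, (-1) * (v.1 T x - c) * v.1 T x =
        -Z - c * ∫ x in M.cell T, (v.1 T x - c) := by
      rw [hZ, ← integral_neg, ← integral_const_mul,
        ← integral_sub (f := fun x => -(v.1 T x - c) ^ 2) (g := fun x => c * (v.1 T x - c))
          (integrableOn_cell (hdevc.pow 2).neg)
          (integrableOn_cell (continuous_const.mul hdevc))]
      congr 1
      ext x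
      ring
    rw [e4, hmean, mul_zero, sub_zero] at e2
    linarith
  have hqb : M.pwInner T q q ≤ C₁ * h ^ 2 * Z := by
    refine hb.trans (le_of_eq ?_)
    have e1 : ∀ x, ((-1) * (v.1 T x - c)) ^ 2 = (v.1 T x - c) ^ 2 := fun x => by ring
    simp only [e1]
    simp
    ring
  -- This weight turns the `q`-term into at most `Z`, half of the left-hand side `2 Z`.
  have hyoung := pwInner_le_young hwc hqc (t := C₁ * h ^ 2) (by positivity)
  have hZle : Z ≤ C₁ * h ^ 2 * M.pwInner T w w := by
    have e1 : (C₁ * h ^ 2)⁻¹ * M.pwInner T q q ≤ Z := by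
      rw [inv_mul_le_iff₀ (by positivity)]
      exact hqb
    rw [← hZeq] at hyoung
    linarith
  -- Subtracting the mean leaves the gradient unchanged, so the inverse inequality acts on the
  -- deviation.
  have hgrad : ∀ i, (ρ * h) ^ 2 * ∫ x in body (M.simplex T i), ‖gradient (v.1 T) x‖ ^ 2 ≤
      C₂ * ∫ x in body (M.simplex T i), (v.1 T x - c) ^ 2 := fun i => by
    have e1 := H₂ (M.simplex T i) (ρ * h) (by positivity) (hM.le_ht hρ T i) _ hdev
    have e2 : ∀ x, gradient (fun x => v.1 T x - c) x = gradient (v.1 T) x := fun x => by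
      rw [gradient, gradient, fderiv_sub_const]
    simpa only [e2] using e1
  have hsum : (ρ * h) ^ 2 * gradPart v T ≤ C₂ * Z := by
    rw [← pwInner_gradient_self hv, pwInner_self, hZ, setIntegral_cell (integrableOn_cell
      (f := fun x => (v.1 T x - c) ^ 2) (hdevc.pow 2)), Finset.mul_sum, Finset.mul_sum]
    exact Finset.sum_le_sum fun i _ => hgrad i
  have hfin : (ρ * h) ^ 2 * gradPart v T ≤ (ρ * h) ^ 2 *
      (C₂ * (ρ⁻¹) ^ 2 * C₁ * M.pwInner T w w) := by
    calc _ ≤ _ := hsum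
      _ ≤ C₂ * (C₁ * h ^ 2 * M.pwInner T w w) := by gcongr
      _ = _ := by field_simp
  exact le_of_mul_le_mul_left hfin (by positivity)

/-- A field whose normal component is the jump divided by `h` turns the boundary term of the weak
gradient identity into the squared jump norm. Its own norm is bounded by the same quantity, which
can then be absorbed. -/
theorem jump_bound_cell (n k : ℕ) {ρ : ℝ} (hρ : 0 < ρ) : ∃ C : ℝ, 0 < C ∧
    ∀ (Ω : Set (Pt (n + 1))) (M : PolytopalMesh (n + 1) Ω), M.ShapeRegular ρ →
      ∀ v ∈ M.Vh k, ∀ T, (M.diam T)⁻¹ * jumpPart v T ≤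
        C * (M.pwInner T (M.weakGrad k v T) (M.weakGrad k v T) + gradPart v T) := by
  obtain ⟨C₁, hC₁, H₁⟩ := exists_cell_lift n k hρ
  set K : ℝ := (ρ⁻¹) ^ (n + 1) with hK
  have hKpos : 0 < K := by positivity
  -- At most `K (n + 2)` boundary facets, each of area at most `(n + 1) V / (ρ h)`.
  set C₄ : ℝ := K * (n + 2) * ((n + 1) * ρ⁻¹) with hC₄
  have hC₄pos : 0 < C₄ := by positivity
  set C₅ : ℝ := C₁ * (1 + C₄) with hC₅
  have hC₅pos : 0 < C₅ := by positivity
  refine ⟨2 * C₅, by positivity, fun Ω M hM v hv T => ?_⟩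
  set w := M.weakGrad k v T with hw
  have hwc : ∀ i, Continuous (w i) := continuous_of_mem_Lam (weakGrad_mem_Lam hv T)
  set h := M.diam T with hh
  have hpos : 0 < h := M.diam_pos T
  have hv0 := (mem_Vh.1 hv).1 T
  have hv0c := continuous_of_mem_polySpace hv0
  set V := volume.real (M.cell T) with hV
  have hvol : 0 < V := by
    rw [hV, ← sum_bvol]
    exact Finset.sum_pos (fun i _ => bvol_pos _) Finset.univ_nonempty
  obtain ⟨P, hP, hvP⟩ := exists_poly_jump hv T
  have hv0' : v.1 T ∈ polySpace (n + 1) (k + 1) := polySpace_mono (Nat.le_succ k) hv0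
  -- One polynomial per face, of degree `k + 1` because `P_k ⊆ P_{k+1}`; this gives membership in
  -- `Λ_k(T)`.
  set P' : M.Face → Pt (n + 1) → ℝ := fun e x => h⁻¹ * (P e x - v.1 T x) with hP'
  have hP'mem : ∀ e, P' e ∈ polySpace (n + 1) (k + 1) := fun e =>
    const_mul_mem_polySpace _ (sub_mem_polySpace (hP e) hv0')
  set g : M.Sub T × Fin (n + 1 + 1) → Pt (n + 1) → ℝ := fun b => traceFun P' b with hg
  have hgmem : ∀ b, g b ∈ polySpace (n + 1) (k + 1) := fun b => traceFun_mem_polySpace hP'mem b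
  have hgc := fun b => continuous_of_mem_polySpace (hgmem b)
  have hgeq : ∀ b ∈ M.bdryFacets T, ∀ x ∈ facet (M.simplex T b.1) b.2,
      g b x = h⁻¹ * (traceFun v.2 b x - v.1 T x) := by
    intro b hb x hx
    obtain ⟨e, _, hbe⟩ := exists_face_of_mem_bdryFacets hb
    rw [hvP b hb x hx]
    simp only [hg, traceFun_eq _ hbe, hP']
  set I : ℝ := ∑ b ∈ M.bdryFacets T, ∫ x in facet (M.simplex T b.1) b.2, g b x ∂μHE[n] with hI
  set Γ : ℝ := ∑ b ∈ M.bdryFacets T, ∫ x in facet (M.simplex T b.1) b.2, g b x ^ 2 ∂μHE[n] with hΓ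
  have hΓ0 : 0 ≤ Γ := Finset.sum_nonneg fun _ _ => integral_nonneg fun _ => sq_nonneg _
  have hΓeq : Γ = h⁻¹ ^ 2 * jumpPart v T := by
    rw [hΓ, jumpPart, Finset.mul_sum]
    refine Finset.sum_congr rfl fun b hb => ?_
    rw [← integral_const_mul]
    refine setIntegral_congr_fun (measurableSet_facet _ _) fun x hx => ?_
    simp only [hgeq b hb x hx]
    ring
  -- The divergence is the constant that compatibility with the total flux `I` dictates.
  obtain ⟨q, hq, hdiv, hn, hb⟩ := H₁ Ω M hM T g (fun _ => I / V) hgmem (const_mem_polySpace _) (by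
    rw [setIntegral_const, smul_eq_mul]
    exact mul_div_cancel₀ _ hvol.ne')
  have hqL : q ∈ M.Lam k T := mem_Lam_of_poly hq (const_mem_polySpace _) hdiv hP'mem hn
  have hqc : ∀ i, Continuous (q i) := continuous_of_mem_Lam hqL
  have hIsq : I ^ 2 ≤ K * (n + 2) * ((n + 1) * ρ⁻¹ * h⁻¹ * V * Γ) := by
    have hcard : ((M.bdryFacets T).card : ℝ) ≤ K * (n + 2) := by
      have e1 : (M.bdryFacets T).card ≤ Fintype.card (M.Sub T) * (n + 2) := by
        refine (Finset.card_le_univ _).trans (le_of_eq ?_)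
        simp
      calc ((M.bdryFacets T).card : ℝ) ≤ (Fintype.card (M.Sub T) * (n + 2) : ℕ) := by
            exact_mod_cast e1
        _ = Fintype.card (M.Sub T) * ((n : ℝ) + 2) := by push_cast; ring
        _ ≤ _ := by
          have := hM.card_le hρ T
          gcongr
    calc I ^ 2 ≤ (M.bdryFacets T).card * ∑ b ∈ M.bdryFacets T,
          (∫ x in facet (M.simplex T b.1) b.2, g b x ∂μHE[n]) ^ 2 := sq_sum_le_card_mul_sum_sq
      _ ≤ (M.bdryFacets T).card * ((n + 1) * ρ⁻¹ * h⁻¹ * V * Γ) := by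
        refine mul_le_mul_of_nonneg_left ?_ (Nat.cast_nonneg _)
        rw [hΓ, Finset.mul_sum]
        refine Finset.sum_le_sum fun b _ => ?_
        refine (sq_setIntegral_facet_le _ _ (hgc b)).trans ?_
        refine mul_le_mul_of_nonneg_right ?_ (integral_nonneg fun _ => sq_nonneg _)
        have e1 := ht_mul_area (M.simplex T b.1) b.2
        have e2 : bvol (M.simplex T b.1) ≤ V := by
          rw [hV, ← sum_bvol]
          exact Finset.single_le_sum (f := fun i => bvol (M.simplex T i))
            (fun j _ => (bvol_pos _).le) (Finset.mem_univ b.1)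
        have e3 := hM.le_ht hρ T b.1 b.2
        have e4 := area_pos (M.simplex T b.1) b.2
        refine le_of_mul_le_mul_left ?_ (mul_pos hρ hpos)
        calc ρ * h * area (M.simplex T b.1) b.2
            ≤ ht (M.simplex T b.1) b.2 * area (M.simplex T b.1) b.2 := by gcongr
          _ = (n + 1) * bvol (M.simplex T b.1) := e1
          _ ≤ (n + 1) * V := by gcongr
          _ = _ := by field_simp
      _ ≤ _ := by gcongr
  have hqb : M.pwInner T q q ≤ C₅ * (h⁻¹ * jumpPart v T) := by
    refine hb.trans ?_
    have e1 : ∫ x in M.cell T, (I / V) ^ 2 = I ^ 2 / V := by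
      rw [setIntegral_const, smul_eq_mul, ← hV]
      field_simp
    have e2 : h ^ 2 * (I ^ 2 / V) ≤ C₄ * (h * Γ) := by
      rw [← mul_div_assoc, div_le_iff₀ hvol]
      calc h ^ 2 * I ^ 2 ≤ h ^ 2 * (K * (n + 2) * ((n + 1) * ρ⁻¹ * h⁻¹ * V * Γ)) := by gcongr
        _ = _ := by rw [hC₄]; field_simp
    have e3 : h * Γ = h⁻¹ * jumpPart v T := by rw [hΓeq]; field_simp
    rw [e1, hC₅, mul_assoc, ← e3]
    refine mul_le_mul_of_nonneg_left ?_ hC₁.le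
    linarith
  have hid := pwInner_weakGrad hv hqL
  rw [sum_fderiv_eq_pwInner] at hid
  have hbd : ∑ b ∈ M.bdryFacets T, ∫ x in facet (M.simplex T b.1) b.2,
      (traceFun v.2 b x - v.1 T x) *
        inner ℝ (q b.1 x) (outwardNormal (M.simplex T b.1) b.2) ∂μHE[n] = h⁻¹ * jumpPart v T := by
    rw [jumpPart, Finset.mul_sum]
    refine Finset.sum_congr rfl fun b hb => ?_
    rw [← integral_const_mul]
    refine setIntegral_congr_fun (measurableSet_facet _ _) fun x hx => ?_
    simp only [hn b hb x hx, hgeq b hb x hx]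
    ring
  rw [hbd] at hid
  have hgc' := continuous_gradient (contDiff_of_mem_polySpace (n := 1) hv0)
  -- Each Young inequality leaves half a copy of the jump term, so one of the two copies on the left
  -- survives.
  have y1 := pwInner_le_young hwc hqc (t := 2 * C₅) (by positivity)
  have y2 := pwInner_le_young (M := M) (T := T) (g := fun _ => -gradient (v.1 T)) (q := q)
    (fun _ => hgc'.neg) hqc (t := 2 * C₅) (by positivity)
  have y3 : M.pwInner T (fun _ => -gradient (v.1 T)) q =
      -M.pwInner T (fun _ => gradient (v.1 T)) q := by
    have := pwInner_smul_left (M := M) (T := T) (-1) (fun _ => gradient (v.1 T)) q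
    rw [neg_one_mul] at this
    rw [← this]
    congr 1
    ext i : 1
    simp
  have y4 : M.pwInner T (fun _ => -gradient (v.1 T)) (fun _ => -gradient (v.1 T)) =
      gradPart v T := by
    rw [← pwInner_gradient_self hv]
    simp [pwInner]
  rw [y3, y4] at y2
  have hY : 0 ≤ h⁻¹ * jumpPart v T := mul_nonneg (inv_pos.2 hpos).le (jumpPart_nonneg v T)
  have e5 : (2 * C₅)⁻¹ * M.pwInner T q q ≤ h⁻¹ * jumpPart v T / 2 := by
    rw [inv_mul_le_iff₀ (by positivity)]
    linarith
  rw [← hw] at hid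
  linarith

end PolytopalMesh

end WG

end

/-! ### Norm equivalence -/

noncomputable section

namespace WG

variable {n : ℕ}

namespace PolytopalMesh

section NormEquivalence

variable {Ω : Set (Pt (n + 1))} {M : PolytopalMesh (n + 1) Ω}

theorem oneNorm_eq {k : ℕ} {v : M.WeakFun} (hv : v ∈ M.Vh k) :
    M.oneNorm v = √(∑ T, (gradPart v T + (M.diam T)⁻¹ * jumpPart v T)) := by
  rw [oneNorm]
  refine congrArg Real.sqrt (Finset.sum_congr rfl fun T _ => ?_)
  rw [← jumpPart_eq hv]
  rfl

theorem cellNorm_nonneg (v : M.WeakFun) (T : M.Cell) :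
    0 ≤ gradPart v T + (M.diam T)⁻¹ * jumpPart v T :=
  add_nonneg (gradPart_nonneg v T)
    (mul_nonneg (inv_pos.2 (M.diam_pos T)).le (jumpPart_nonneg v T))

end NormEquivalence

theorem norm_equivalence (n k : ℕ) {ρ : ℝ} (hρ : 0 < ρ) : ∃ C₁ C₂ : ℝ, 0 < C₁ ∧ 0 < C₂ ∧
    ∀ (Ω : Set (Pt (n + 1))) (M : PolytopalMesh (n + 1) Ω), M.ShapeRegular ρ →
      ∀ v ∈ M.Vh k, C₁ * M.oneNorm v ≤ M.tripleNorm k v ∧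
        M.tripleNorm k v ≤ C₂ * M.oneNorm v := by
  obtain ⟨A, hA, HA⟩ := upper_bound_cell n k hρ
  obtain ⟨B, hB, HB⟩ := gradient_bound_cell n k hρ
  obtain ⟨D, hD, HD⟩ := jump_bound_cell n k hρ
  -- The gradient part costs `B`; the jump part costs `D` times energy plus gradient part, hence `D
  -- (1 + B)`.
  set E : ℝ := B + D * (1 + B) with hE
  have hEpos : 0 < E := by positivity
  refine ⟨(√E)⁻¹, √A, inv_pos.2 (Real.sqrt_pos.2 hEpos), Real.sqrt_pos.2 hA,
    fun Ω M hM v hv => ⟨?_, ?_⟩⟩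
  · rw [inv_mul_le_iff₀ (Real.sqrt_pos.2 hEpos), oneNorm_eq hv, tripleNorm, form,
      ← Real.sqrt_mul hEpos.le]
    refine Real.sqrt_le_sqrt ?_
    rw [Finset.mul_sum]
    refine Finset.sum_le_sum fun T _ => ?_
    have h1 := HB Ω M hM v hv T
    have h2 := HD Ω M hM v hv T
    have h3 := mul_le_mul_of_nonneg_left h1 hD.le
    rw [hE]
    linarith
  · rw [oneNorm_eq hv, tripleNorm, form, ← Real.sqrt_mul hA.le]
    refine Real.sqrt_le_sqrt ?_
    rw [Finset.mul_sum]
    exact Finset.sum_le_sum fun T _ => HA Ω M hM v hv T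

/-! ### Definiteness of the bilinear form -/

section Kernel

variable {Ω : Set (Pt (n + 1))} {M : PolytopalMesh (n + 1) Ω}

variable (M) in
-- A mesh has finitely many nondegenerate simplices. Hence the norm equivalence is available for the
-- scheme on every mesh.
theorem exists_shapeRegular : ∃ ρ : ℝ, 0 < ρ ∧ M.ShapeRegular ρ := by
  have h : ∀ p : (Σ T, M.Sub T), ∃ (c : Pt (n + 1)) (r : ℝ), 0 < r ∧
      Metric.closedBall c r ⊆ body (M.simplex p.1 p.2) := by
    intro p
    obtain ⟨c, hc⟩ := interior_body_nonempty (M.simplex p.1 p.2)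
    obtain ⟨r, hr, hsub⟩ := Metric.nhds_basis_closedBall.mem_iff.1 (mem_interior_iff_mem_nhds.1 hc)
    exact ⟨c, r, hr, hsub⟩
  choose c r hr hsub using h
  have hpos : ∀ p : (Σ T, M.Sub T), 0 < M.diam p.1 / r p := fun p =>
    div_pos (M.diam_pos p.1) (hr p)
  set S : ℝ := 1 + ∑ p : (Σ T, M.Sub T), M.diam p.1 / r p with hS
  have hSpos : 0 < S := add_pos_of_pos_of_nonneg one_pos
    (Finset.sum_nonneg fun p _ => (hpos p).le)
  refine ⟨S⁻¹, inv_pos.2 hSpos, fun T i => ⟨c ⟨T, i⟩, ?_⟩⟩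
  refine (Metric.closedBall_subset_closedBall ?_).trans (hsub ⟨T, i⟩)
  rw [inv_mul_le_iff₀ hSpos, ← div_le_iff₀ (hr ⟨T, i⟩)]
  have := Finset.single_le_sum (f := fun p : (Σ T, M.Sub T) => M.diam p.1 / r p)
    (fun p _ => (hpos p).le) (Finset.mem_univ ⟨T, i⟩)
  simp only at this
  linarith

/-- The two cells at a face may subdivide it differently; a facet from one side is cut along the
facets from the other side. -/
theorem setIntegral_facet_split {T T' : M.Cell} {e : M.Face} (he' : e ∈ M.faces T')
    {b : M.Sub T × Fin (n + 1 + 1)} (hb : b ∈ M.facets T e) {f : Pt (n + 1) → ℝ}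
    (hf : Continuous f) :
    ∫ x in facet (M.simplex T b.1) b.2, f x ∂μHE[n] = ∑ b' ∈ M.facets T' e,
      ∫ x in facet (M.simplex T b.1) b.2 ∩ facet (M.simplex T' b'.1) b'.2, f x ∂μHE[n] := by
  have hE : facet (M.simplex T b.1) b.2 = ⋃ b' : M.facets T' e,
      facet (M.simplex T b.1) b.2 ∩ facet (M.simplex T' b'.1.1) b'.1.2 := by
    ext x
    rw [Set.mem_iUnion]
    constructor
    · intro hx
      obtain ⟨b', hb', hx'⟩ := (mem_iUnion_facets he').1 (mem_facets.1 hb hx)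
      exact ⟨⟨b', hb'⟩, hx, hx'⟩
    · rintro ⟨b', hx, _⟩
      exact hx
  have hintg := integrableOn_facet (M.simplex T b.1) b.2 hf
  conv_lhs => rw [hE]
  rw [hE] at hintg
  rw [integral_iUnion_ae (fun b' => ((measurableSet_facet _ _).inter
    (measurableSet_facet _ _)).nullMeasurableSet) (fun b₁ b₂ h12 => ?_) hintg, tsum_fintype,
    Finset.univ_eq_attach, Finset.sum_attach (M.facets T' e) fun b' =>
      ∫ x in facet (M.simplex T b.1) b.2 ∩ facet (M.simplex T' b'.1) b'.2, f x ∂μHE[n]]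
  exact measure_mono_null (Set.inter_subset_inter Set.inter_subset_right Set.inter_subset_right)
    (aedisjoint_facet (facets_subset_bdryFacets he' b₁.2) fun h => h12 (Subtype.ext h))

/-- The fluxes of a field through a face, seen from its two sides, cancel. -/
theorem face_flux_cancel {T T' : M.Cell} (hT : T ≠ T') {e : M.Face} (he : e ∈ M.faces T)
    (he' : e ∈ M.faces T') {φ : Pt (n + 1) → ℝ} (hφ : Continuous φ) (u : Pt (n + 1)) :
    (∑ b ∈ M.facets T e, inner ℝ u (outwardNormal (M.simplex T b.1) b.2) *
      ∫ x in facet (M.simplex T b.1) b.2, φ x ∂μHE[n]) +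
    ∑ b ∈ M.facets T' e, inner ℝ u (outwardNormal (M.simplex T' b.1) b.2) *
      ∫ x in facet (M.simplex T' b.1) b.2, φ x ∂μHE[n] = 0 := by
  obtain ⟨ν, c, hν, hflat⟩ := M.face_flat e
  rw [Finset.sum_congr rfl fun b hb => by rw [setIntegral_facet_split he' hb hφ, Finset.mul_sum],
    Finset.sum_congr (s₁ := M.facets T' e) rfl fun b hb => by
      rw [setIntegral_facet_split he hb hφ, Finset.mul_sum],
    Finset.sum_comm (s := M.facets T' e), ← Finset.sum_add_distrib]
  refine Finset.sum_eq_zero fun b hb => ?_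
  rw [← Finset.sum_add_distrib]
  refine Finset.sum_eq_zero fun b' hb' => ?_
  rw [Set.inter_comm (facet (M.simplex T' b'.1) b'.2), ← add_mul, ← inner_add_right]
  -- Either the two facets have a common relative interior point, and their normals are opposite, or
  -- they meet in a null set.
  by_cases hex : ∃ x, (x ∈ facet (M.simplex T b.1) b.2 ∧
      ∀ c, c ≠ b.2 → 0 < bc (M.simplex T b.1) c x) ∧ ∀ c, c ≠ b'.2 → 0 < bc (M.simplex T' b'.1) c x
  · obtain ⟨x, ⟨hx0, hx⟩, hx'⟩ := hex
    have hd : Disjoint (interior (body (M.simplex T b.1))) (interior (body (M.simplex T' b'.1))) :=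
      (M.cell_disjoint T T' hT).mono (interior_mono (M.body_subset_cell T _))
        (interior_mono (M.body_subset_cell T' _))
    rw [outwardNormal_eq_neg_of_flat hν (fun y hy => hflat y (mem_facets.1 hb hy))
      (fun y hy => hflat y (mem_facets.1 hb' hy)) ((mem_facet _).1 hx0).1 hx hx' hd,
      add_neg_cancel, inner_zero_right, zero_mul]
  · have h1 := (ae_restrict_iff' (measurableSet_facet _ _)).1
      (ae_facet_pos (M.simplex T b.1) b.2)
    have h2 := (ae_restrict_iff' (measurableSet_facet _ _)).1
      (ae_facet_pos (M.simplex T' b'.1) b'.2)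
    have h3 : ∀ᵐ x ∂μHE[n],
        x ∉ facet (M.simplex T b.1) b.2 ∩ facet (M.simplex T' b'.1) b'.2 := by
      filter_upwards [h1, h2] with x hx1 hx2 hx
      exact hex ⟨x, hx1 hx.1, (hx2 hx.2).2⟩
    have h4 : μHE[n] (facet (M.simplex T b.1) b.2 ∩ facet (M.simplex T' b'.1) b'.2) = 0 :=
      measure_eq_zero_iff_ae_notMem.2 h3
    rw [setIntegral_measure_zero _ h4, mul_zero]

/-- The field `⟨u, x⟩ u` has divergence `‖u‖²`; apply the divergence theorem on each simplex and
cancel the shared facets. -/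
theorem volume_cell_eq_sum_faces (T : M.Cell) (u : Pt (n + 1)) :
    ‖u‖ ^ 2 * volume.real (M.cell T) = ∑ e ∈ M.faces T, ∑ b ∈ M.facets T e,
      inner ℝ u (outwardNormal (M.simplex T b.1) b.2) *
        ∫ x in facet (M.simplex T b.1) b.2, inner ℝ u x ∂μHE[n] := by
  rw [sum_faces_facets (fun b => inner ℝ u (outwardNormal (M.simplex T b.1) b.2) *
        ∫ x in facet (M.simplex T b.1) b.2, inner ℝ u x ∂μHE[n]), ← sum_shared_cancel,
    sum_sub_vertex, ← sum_bvol, Finset.mul_sum]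
  · refine Finset.sum_congr rfl fun i _ => ?_
    have h := setIntegral_body_fderiv (M.simplex T i) (f := fun x => inner ℝ u x)
      (innerSL ℝ u).contDiff u
    rw [← h]
    have h1 : ∀ x, fderiv ℝ (fun x => inner ℝ u x) x u = ‖u‖ ^ 2 := fun x => by
      have : fderiv ℝ (fun x => inner ℝ u x) x = innerSL ℝ u := (innerSL ℝ u).fderiv
      rw [this, innerSL_apply_apply, real_inner_self_eq_norm_sq]
    simp only [h1, setIntegral_const, smul_eq_mul, bvol]
    ring
  · intro p q hpq
    rw [hpq.outwardNormal_eq, hpq.facet_eq, inner_neg_right]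
    ring

/-- A piecewise constant function that is continuous across the faces and zero on the boundary of
the domain vanishes. -/
theorem piecewise_const_eq_zero (c : M.Cell → ℝ)
    (h1 : ∀ e T T', e ∈ M.faces T → e ∈ M.faces T' → c T = c T')
    (h2 : ∀ e T, e ∈ M.faces T → M.face e ⊆ frontier Ω → c T = 0) (T : M.Cell) : c T = 0 := by
  classical
  set u : Pt (n + 1) := EuclideanSpace.single 0 1 with hu
  have hu1 : ‖u‖ ^ 2 = 1 := by simp [hu]
  set H : M.Cell → M.Face → ℝ := fun T e => ∑ b ∈ M.facets T e,
      inner ℝ u (outwardNormal (M.simplex T b.1) b.2) *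
        ∫ x in facet (M.simplex T b.1) b.2, inner ℝ u x ∂μHE[n] with hH
  have hvol : ∀ T, volume.real (M.cell T) = ∑ e, if e ∈ M.faces T then H T e else 0 := by
    intro T
    have := volume_cell_eq_sum_faces T u
    rw [hu1, one_mul] at this
    rw [this, ← Finset.sum_filter]
    simp [hH]
  -- Each volume is expressed by face fluxes and the sum is reordered by faces. A boundary face
  -- contributes zero since `c_T = 0`; at a shared face the coefficients `c_T ^ 2` agree and the
  -- fluxes cancel.
  have hzero : ∑ T, c T ^ 2 * volume.real (M.cell T) = 0 := by
    simp only [hvol, Finset.mul_sum]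
    rw [Finset.sum_comm]
    refine Finset.sum_eq_zero fun e _ => ?_
    rcases M.face_shared e with hb | hs
    · refine Finset.sum_eq_zero fun T _ => ?_
      by_cases he : e ∈ M.faces T
      · rw [h2 e T he hb]; simp
      · simp [he]
    · obtain ⟨T₁, T₂, hne, hset⟩ := Set.ncard_eq_two.1 hs
      have hmem : ∀ T, e ∈ M.faces T ↔ T = T₁ ∨ T = T₂ := fun T => by
        rw [mem_faces]
        have : T ∈ {T | M.face e ⊆ frontier (M.cell T)} ↔ T ∈ ({T₁, T₂} : Set M.Cell) := by rw [hset]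
        simpa using this
      have e1 : e ∈ M.faces T₁ := (hmem T₁).2 (Or.inl rfl)
      have e2 : e ∈ M.faces T₂ := (hmem T₂).2 (Or.inr rfl)
      rw [← Finset.sum_subset (Finset.subset_univ {T₁, T₂}) fun T _ hT => by
        rw [if_neg, mul_zero]
        rw [hmem]
        simpa using hT, Finset.sum_pair hne, if_pos e1, if_pos e2, h1 e T₁ T₂ e1 e2, ← mul_add]
      have := face_flux_cancel hne e1 e2 (φ := fun x => inner ℝ u x) (by fun_prop) u
      simp only [hH]
      rw [this, mul_zero]
  have hpos : ∀ T, 0 < volume.real (M.cell T) := fun T => by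
    rw [← sum_bvol]
    exact Finset.sum_pos (fun i _ => bvol_pos _) Finset.univ_nonempty
  have h3 := (Finset.sum_eq_zero_iff_of_nonneg fun T _ =>
    mul_nonneg (sq_nonneg (c T)) (hpos T).le).1 hzero T (Finset.mem_univ T)
  rcases mul_eq_zero.1 h3 with h4 | h4
  · exact pow_eq_zero_iff two_ne_zero |>.1 h4
  · exact ((hpos T).ne' h4).elim

theorem exists_const_of_gradPart {k : ℕ} {v : M.WeakFun} (hv : v ∈ M.Vh k) {T : M.Cell}
    (h : gradPart v T = 0) : ∃ c, ∀ x, v.1 T x = c := by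
  have hv0 := (mem_Vh.1 hv).1 T
  have hgc := continuous_gradient (contDiff_of_mem_polySpace (n := 1) hv0)
  rw [← pwInner_gradient_self hv, pwInner_self] at h
  obtain ⟨i⟩ := M.subNonempty T
  have h1 := (Finset.sum_eq_zero_iff_of_nonneg fun i _ =>
    integral_nonneg fun x => sq_nonneg ‖gradient (v.1 T) x‖).1 h i (Finset.mem_univ i)
  have h2 := eqOn_zero_of_integral_body_eq_zero _ (f := fun x => ‖gradient (v.1 T) x‖ ^ 2)
    (hgc.norm.pow 2) (fun x _ => sq_nonneg _) h1
  have h3 : ∀ u, (fun x => fderiv ℝ (v.1 T) x u) = 0 := fun u =>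
    eq_zero_of_eqOn_open (fderiv_mem_polySpace hv0 u) isOpen_interior
      (interior_body_nonempty (M.simplex T i)) fun x hx => by
        have h4 := h2 x (interior_subset hx)
        simp only [pow_eq_zero_iff two_ne_zero, norm_eq_zero] at h4
        rw [← inner_gradient_eq, h4, inner_zero_right]
  have h5 : ∀ x, fderiv ℝ (v.1 T) x = 0 := fun x => by
    ext u
    exact congrFun (h3 u) x
  exact ⟨v.1 T 0, fun x =>
    is_const_of_fderiv_eq_zero (differentiable_of_mem_polySpace hv0) h5 x 0⟩

theorem eq_on_face_of_jumpPart {k : ℕ} {v : M.WeakFun} (hv : v ∈ M.Vh k) {T : M.Cell}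
    (h : jumpPart v T = 0) {e : M.Face} (he : e ∈ M.faces T) {x : Pt (n + 1)}
    (hx : x ∈ M.face e) : v.2 e x = v.1 T x := by
  obtain ⟨b, hb, hxb⟩ := (mem_iUnion_facets he).1 hx
  have hbb := facets_subset_bdryFacets he hb
  obtain ⟨g, hg, hgx⟩ := exists_poly_traceFun hv hbb
  have h1 := (Finset.sum_eq_zero_iff_of_nonneg fun b _ =>
    integral_nonneg fun x => sq_nonneg (traceFun v.2 b x - v.1 T x)).1 h b hbb
  rw [setIntegral_congr_fun (g := fun x => (g x - v.1 T x) ^ 2) (measurableSet_facet _ _)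
    fun x hx => by simp only [hgx x hx]] at h1
  have h2 := eqOn_zero_of_integral_facet_eq_zero _ _ (f := fun x => (g x - v.1 T x) ^ 2)
    (((continuous_of_mem_polySpace hg).sub
      (continuous_of_mem_polySpace ((mem_Vh.1 hv).1 T))).pow 2)
    (fun x _ => sq_nonneg _) h1 x hxb
  have h3 : g x - v.1 T x = 0 := pow_eq_zero_iff two_ne_zero |>.1 h2
  rw [← traceFun_eq v.2 hb, hgx x hxb]
  linarith

/-- Zero energy gives zero discrete `H¹` semi-norm, so `v₀` is constant on each cell and equals
`v_b` on its faces; these constants agree across shared faces and vanish at `∂Ω`. -/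
theorem eq_zero_of_form_self {k : ℕ} {v : M.WeakFun} (hv : v ∈ M.Vh0 k)
    (h : M.form k v v = 0) : v = 0 := by
  obtain ⟨hvV, hvb⟩ := hv
  obtain ⟨ρ, hρ, hM⟩ := M.exists_shapeRegular
  obtain ⟨C₁, C₂, hC₁, _, H⟩ := norm_equivalence n k hρ
  have h1 := (H Ω M hM v hvV).1
  rw [tripleNorm, h, Real.sqrt_zero] at h1
  have h2 : M.oneNorm v = 0 :=
    le_antisymm (nonpos_of_mul_nonpos_right h1 hC₁) (Real.sqrt_nonneg _)
  rw [oneNorm_eq hvV, Real.sqrt_eq_zero (Finset.sum_nonneg fun T _ => cellNorm_nonneg v T)] at h2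
  have h3 := (Finset.sum_eq_zero_iff_of_nonneg fun T _ => cellNorm_nonneg v T).1 h2
  have hX : ∀ T, gradPart v T = 0 := fun T => by
    have := h3 T (Finset.mem_univ T)
    have := gradPart_nonneg v T
    have := mul_nonneg (inv_pos.2 (M.diam_pos T)).le (jumpPart_nonneg v T)
    linarith
  have hY : ∀ T, jumpPart v T = 0 := fun T => by
    have e1 := h3 T (Finset.mem_univ T)
    rw [hX T, zero_add] at e1
    rcases mul_eq_zero.1 e1 with e2 | e2
    · exact ((inv_pos.2 (M.diam_pos T)).ne' e2).elim
    · exact e2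
  choose c hc using fun T => exists_const_of_gradPart hvV (hX T)
  have hface : ∀ e T, e ∈ M.faces T → ∀ x ∈ M.face e, v.2 e x = c T := fun e T he x hx => by
    rw [eq_on_face_of_jumpPart hvV (hY T) he hx, hc T x]
  have hc0 : ∀ T, c T = 0 := piecewise_const_eq_zero c
    (fun e T T' he he' => by
      obtain ⟨x, hx⟩ := M.face_nonempty e
      rw [← hface e T he x hx, hface e T' he' x hx])
    (fun e T he hb => by
      obtain ⟨x, hx⟩ := M.face_nonempty e
      rw [← hface e T he x hx, hvb e hb]
      rfl)
  refine Prod.ext ?_ ?_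
  · ext T x
    rw [hc T x, hc0 T]
    rfl
  · ext e x
    obtain ⟨T, hT⟩ := M.exists_cell e
    by_cases hx : x ∈ M.face e
    · rw [hface e T (mem_faces.2 hT) x hx, hc0 T]
      rfl
    -- Off the face the function is zero by the convention of extension by zero.
    · obtain ⟨g, _, hg⟩ := (mem_Vh.1 hvV).2 e
      rw [hg, Set.indicator_of_notMem hx]
      rfl

end Kernel

/-! ### Unique solvability of the scheme -/

section Scheme

variable {Ω : Set (Pt (n + 1))} {M : PolytopalMesh (n + 1) Ω}

instance finiteDimensional_polySpaceOn (S : Set (Pt (n + 1))) (m : ℕ) :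
    FiniteDimensional ℝ (polySpaceOn S m) := by
  let F : polySpace (n + 1) m →ₗ[ℝ] polySpaceOn S m :=
    { toFun := fun p => ⟨S.indicator p.1, p.1, p.2, rfl⟩
      map_add' := fun p q => Subtype.ext (Set.indicator_add' S p.1 q.1)
      map_smul' := fun c p => Subtype.ext (Set.indicator_const_smul S c p.1) }
  refine Module.Finite.of_surjective F ?_
  rintro ⟨_, p, hp, rfl⟩
  exact ⟨⟨p, hp⟩, rfl⟩

instance finiteDimensional_Vh0 (k : ℕ) : FiniteDimensional ℝ (M.Vh0 k) := by
  let F : M.Vh0 k →ₗ[ℝ] (M.Cell → polySpace (n + 1) k) ×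
      (∀ e : M.Face, polySpaceOn (M.face e) (k + 1)) :=
    { toFun := fun v => (fun T => ⟨v.1.1 T, (mem_Vh.1 v.2.1).1 T⟩,
        fun e => ⟨v.1.2 e, (mem_Vh.1 v.2.1).2 e⟩)
      map_add' := fun _ _ => rfl
      map_smul' := fun _ _ => rfl }
  refine FiniteDimensional.of_injective F fun v w h => Subtype.ext (Prod.ext ?_ ?_)
  · ext T : 1
    exact congrArg Subtype.val (congrFun (congrArg Prod.fst h) T)
  · ext e : 1
    exact congrArg Subtype.val (congrFun (congrArg Prod.snd h) e)

theorem form_comm (k : ℕ) (u v : M.WeakFun) : M.form k u v = M.form k v u :=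
  Finset.sum_congr rfl fun _ _ => pwInner_comm _ _

theorem form_add_left {k : ℕ} {u u' v : M.WeakFun} (hu : u ∈ M.Vh k) (hu' : u' ∈ M.Vh k)
    (hv : v ∈ M.Vh k) : M.form k (u + u') v = M.form k u v + M.form k u' v := by
  rw [form, form, form, ← Finset.sum_add_distrib]
  refine Finset.sum_congr rfl fun T _ => ?_
  rw [weakGrad_add hu hu', pwInner_add_left (continuous_of_mem_Lam (weakGrad_mem_Lam hu T))
    (continuous_of_mem_Lam (weakGrad_mem_Lam hu' T))
    (continuous_of_mem_Lam (weakGrad_mem_Lam hv T))]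

theorem form_smul_left {k : ℕ} (c : ℝ) {u : M.WeakFun} (hu : u ∈ M.Vh k) (v : M.WeakFun) :
    M.form k (c • u) v = c * M.form k u v := by
  rw [form, form, Finset.mul_sum]
  refine Finset.sum_congr rfl fun T _ => ?_
  rw [weakGrad_smul c hu, pwInner_smul_left]

/-- Square integrability is given on `Ω`, which contains the interior of the cell; the rest of the
cell lies in frontiers of simplices and is null. -/
theorem integrableOn_cell_mul {f : Pt (n + 1) → ℝ} (hf : MemLp f 2 (volume.restrict Ω))
    {w : Pt (n + 1) → ℝ} (hw : Continuous w) (T : M.Cell) :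
    IntegrableOn (fun x => f x * w x) (M.cell T) := by
  have h1 : MemLp f 2 (volume.restrict (M.cell T)) := by
    have h2 : MemLp f 2 (volume.restrict (interior (M.cell T))) :=
      hf.mono_measure (Measure.restrict_mono (M.interior_cell_subset T) le_rfl)
    have h3 : volume.restrict (interior (M.cell T)) = volume.restrict (M.cell T) := by
      refine Measure.restrict_congr_set ?_
      refine Filter.EventuallyEq.symm ?_
      refine (ae_le_set.2 ?_).antisymm interior_subset.eventuallyLE
      have h4 : M.cell T \ interior (M.cell T) ⊆
          ⋃ i, frontier (body (M.simplex T i)) := by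
        rintro x ⟨hx, hxi⟩
        rw [M.cell_eq] at hx
        obtain ⟨i, hi⟩ := Set.mem_iUnion.1 hx
        exact Set.mem_iUnion.2 ⟨i, subset_closure hi,
          fun h => hxi (interior_mono (M.body_subset_cell T i) h)⟩
      exact measure_mono_null h4 (measure_iUnion_null fun i =>
        (convex_body _).addHaar_frontier volume)
    rwa [h3] at h2
  have : IsFiniteMeasure (volume.restrict (M.cell T)) :=
    isFiniteMeasure_restrict.2 (M.isCompact_cell T).measure_lt_top.ne
  exact IntegrableOn.mul_continuousOn (h1.integrable (by norm_num)) hw.continuousOn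
    (M.isCompact_cell T)

theorem existsUnique_isWGSolution (k : ℕ) {f : Pt (n + 1) → ℝ}
    (hf : MemLp f 2 (volume.restrict Ω)) : ∃! u : M.WeakFun, M.IsWGSolution k f u := by
  let B : M.Vh0 k →ₗ[ℝ] M.Vh0 k →ₗ[ℝ] ℝ := LinearMap.mk₂ ℝ (fun u v => M.form k u.1 v.1)
    (fun u u' v => form_add_left u.2.1 u'.2.1 v.2.1)
    (fun c u v => form_smul_left c u.2.1 v.1)
    (fun u v v' => by
      rw [form_comm, form_comm k u.1 v.1, form_comm k u.1 v'.1]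
      exact form_add_left v.2.1 v'.2.1 u.2.1)
    (fun c u v => by
      rw [form_comm, form_comm k u.1 v.1]
      exact form_smul_left c v.2.1 u.1)
  have hc : ∀ (v : M.Vh0 k) (T : M.Cell), Continuous (v.1.1 T) := fun v T =>
    continuous_of_mem_polySpace ((mem_Vh.1 v.2.1).1 T)
  let L : M.Vh0 k →ₗ[ℝ] ℝ :=
    { toFun := fun v => ∑ T, ∫ x in M.cell T, f x * v.1.1 T x
      map_add' := fun v w => by
        rw [← Finset.sum_add_distrib]
        refine Finset.sum_congr rfl fun T _ => ?_
        rw [← integral_add (integrableOn_cell_mul hf (hc v T) T)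
          (integrableOn_cell_mul hf (hc w T) T)]
        simp only [Submodule.coe_add, Prod.fst_add, Pi.add_apply, mul_add]
      map_smul' := fun c v => by
        rw [RingHom.id_apply, smul_eq_mul, Finset.mul_sum]
        refine Finset.sum_congr rfl fun T _ => ?_
        rw [← integral_const_mul]
        simp only [Submodule.coe_smul, Prod.smul_fst, Pi.smul_apply, smul_eq_mul, mul_left_comm] }
  obtain ⟨u, hu, huu⟩ := existsUnique_of_posDef B
    (fun v hv => Subtype.ext (eq_zero_of_form_self v.2 hv)) L
  refine ⟨u.1, ⟨u.2, fun v hv => hu ⟨v, hv⟩⟩, fun u' hu' => ?_⟩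
  exact congrArg Subtype.val (huu ⟨u', hu'.1⟩ fun v => hu'.2 v.1 v.2)

end Scheme

end PolytopalMesh

end WG

end

theorem mainTheorem4 (d k : ℕ) (hd : 2 ≤ d) :
    -- the weak gradient is well defined
    (∀ (Ω : Set (WG.Pt d)) (M : WG.PolytopalMesh d Ω), ∀ v ∈ M.Vh k, ∀ T : M.Cell,
      ∃! g : M.PwField T, M.IsWeakGrad k T v g) ∧
    -- norm equivalence, with constants that depend only on `d`, `k` and the shape regularity
    (∀ ρ : ℝ, 0 < ρ → ∃ C₁ C₂ : ℝ, 0 < C₁ ∧ 0 < C₂ ∧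
      ∀ (Ω : Set (WG.Pt d)) (M : WG.PolytopalMesh d Ω), M.ShapeRegular ρ →
        ∀ v ∈ M.Vh k, C₁ * M.oneNorm v ≤ M.tripleNorm k v ∧
          M.tripleNorm k v ≤ C₂ * M.oneNorm v) ∧
    -- well-posedness of the scheme
    (∀ (Ω : Set (WG.Pt d)) (M : WG.PolytopalMesh d Ω) (f : WG.Pt d → ℝ),
      MemLp f 2 (volume.restrict Ω) → ∃! u : M.WeakFun, M.IsWGSolution k f u) := by
  -- With `d = n + 1` the facets have dimension `n` and `d - 1` reduces to `n`.
  obtain ⟨n, rfl⟩ : ∃ n, d = n + 1 := ⟨d - 1, by omega⟩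
  exact ⟨fun Ω M v hv T => WG.PolytopalMesh.existsUnique_isWeakGrad hv T,
    fun ρ hρ => WG.PolytopalMesh.norm_equivalence n k hρ,
    fun Ω M f hf => WG.PolytopalMesh.existsUnique_isWGSolution k hf⟩
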